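/- **Conventions.** $\mathbb N=\{1,2,\dots\}$ and $[n]=\{1,\dots,n\}$. A composition of $[n]$ is an ordered sequence of disjoint non-empty subsets (blocks) of $[n]$ with union $[n]$; $\mathcal C_n$ is the set of these, and $\mathcal C$ is the projective limit of the $\mathcal C_n$ under restriction (the compositions of $\mathbb N$, i.e. partitions of $\mathbb N$ with totally ordered blocks), with its Borel σ-algebra for the product topology. $\gamma_{[n]}$ is the restriction of $\gamma\in\mathcal C$ to $[n]$, and $\mathbf 1_n$, $\mathbf 1_{\mathbb N}$ are the one-block compositions. A measure $\mu$ on $\mathcal C$ is *exchangeable* if for all $n$, all permutations $\sigma$ of $[n]$ and all $c\in\mathcal C_n$, $\mu(\gamma_{[n]}=c)=\mu(\sigma(\gamma_{[n]})=c)$. It is a *fragmentation measure* if it is exchangeable, $\mu(\{\mathbf 1_{\mathbb N}\})=0$, and $\mu(\{\gamma:\gamma_{[n]}\neq\mathbf 1_n\})<\infty$ for every $n$. Let $\mathcal U$ be the set of open subsets of $]0,1[$ with the Borel σ-algebra of the distance $d(U,V)=\sup_{x\in[0,1]}|\chi_U(x)-\chi_V(x)|$, where $\chi_U(x)$ is the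 distance from $x$ to $[0,1]\setminus U$, and let $\mathbf 1=\,]0,1[$. For $U\in\mathcal U$, $|U|^{\downarrow}=(s_1,s_2,\dots)$ is the decreasing sequence of the lengths of the interval components of $U$ (completed by zeros). A *dislocation measure* is a measure $\nu$ on $\mathcal U$ with $\nu(\{\mathbf 1\})=0$ and $\int_{\mathcal U}(1-s_1)\,\nu(dU)<\infty$. $P^U$ is the law of the random composition obtained from i.i.d. uniform variables $X_i$ on $[0,1]$ by putting $i,j$ in the same block if $i=j$ or $X_i,X_j$ lie in the same component of $U$, and otherwise putting the block of $i$ before that of $j$ if $X_i<X_j$; $P^\nu=\int_{\mathcal U}P^U\,\nu(dU)$. If the successive blocks of $\gamma_{[n]}$ have sizes $n_1,\dots,n_k$, let $U_n(\gamma)=\bigcup_{i=1}^k\,\bigl]\tfrac{n_1+\dots+n_{i-1}}n,\tfrac{n_1+\dots+n_i}n\bigr[$; when $U_n(\gamma)$ converges in $\mathcal U$, its limit $U_\gamma$ is the asymptotic open set of $\gamma$. Let $\epsilon=\sum_{i}\delta_{(\{i\},\,\mathbb N\setminus\{i\})}$ and $\epsilon'=\sum_i\delta_{(\mathbb N\setminus\{i\},\,\{i\})}$.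 On partitions of $\mathbb N$ (with the σ-algebra generated by the restrictions to the $[n]$), let $\tilde\epsilon=\sum_i\delta_{\{\{i\},\mathbb N\setminus\{i\}\}}$. Let $\mathcal S^{\downarrow}=\{s_1\ge s_2\ge\dots\ge0,\ \sum_i s_i\le1\}$ with the product σ-algebra. For $s\in\mathcal S^{\downarrow}$, $\rho_s$ is the law of the partition in which $i\sim j$ if $i=j$ or if, for some $k\ge0$, $X_i$ and $X_j$ both lie in $[s_1+\dots+s_k,\ s_1+\dots+s_{k+1}[$, where the $X_i$ are i.i.d. uniform on $[0,1]$. For a measure $\tilde\nu$ on $\mathcal S^{\downarrow}$ let $\rho_{\tilde\nu}=\int\rho_s\,\tilde\nu(ds)$. **Theorem.** The measures $\epsilon$ and $\epsilon'$ are exchangeable. Let $\mu$ be a fragmentation measure on $\mathcal C$. Then there exist $c_l\ge0$, $c_r\ge0$ and a dislocation measure $\nu$ such that $$\mu=c_l\,\epsilon+c_r\,\epsilon'+P^\nu ,$$ and the triple $(c_l,c_r,\nu)$ with these properties is unique. Moreover: 1. the restriction of $\mu$ to $\{\gamma: U_\gamma \text{ exists and } U_\gamma=\mathbf 1\}$ is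 $c_l\epsilon+c_r\epsilon'$, and the restriction of $\mu$ to $\{\gamma:U_\gamma\text{ exists and }U_\gamma\neq\mathbf 1\}$ is $P^\nu$; 2. let $\tilde\mu$ be the image of $\mu$ under the map from compositions to partitions that forgets the order of the blocks, and let $\tilde\nu$ be the image of $\nu$ under $U\mapsto|U|^{\downarrow}$. Then $\tilde\nu(\{(1,0,0,\dots)\})=0$, $\int_{\mathcal S^{\downarrow}}(1-s_1)\,\tilde\nu(ds)<\infty$ and $\tilde\mu=\rho_{\tilde\nu}+(c_l+c_r)\,\tilde\epsilon$. Moreover $(\tilde\nu,\,c_l+c_r)$ is the only pair $(\nu',c)$, with $c\ge0$ and $\nu'$ a measure on $\mathcal S^{\downarrow}$ satisfying $\nu'(\{(1,0,0,\dots)\})=0$ and $\int(1-s_1)\,d\nu'<\infty$, for which $\tilde\mu=\rho_{\nu'}+c\,\tilde\epsilon$. -/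

import Mathlib

open MeasureTheory Filter Topology Set
open scoped ENNReal NNReal

noncomputable section

namespace Frag

/-! ### Compositions

A composition of a set `α` (a partition of `α` whose blocks are totally ordered) is encoded by
the relation `i ≼ j`: "the block of `i` is before, or equal to, the block of `j`", a total
preorder. For `α = Fin n` this is the same thing as an ordered sequence of disjoint non-empty
blocks covering `Fin n`, and `Compo ℕ` is the projective limit of the `Compo (Fin n)`. The index
set `{1, 2, …}` is shifted to `ℕ = {0, 1, …}`, and `[n]` is `{0, …, n - 1} = Fin n`. -/

/-- A composition of `α`, given by the relation `rel i j`: the block of `i` is before or equal to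
the block of `j`. -/
@[ext] structure Compo (α : Type) where
  rel : α → α → Prop
  total : ∀ i j, rel i j ∨ rel j i
  trans : ∀ i j k, rel i j → rel j k → rel i k

namespace Compo

/-- `i ∼ j`: same block. -/
def Same {α : Type} (γ : Compo α) (i j : α) : Prop := γ.rel i j ∧ γ.rel j i

/-- `i ≺ j`: the block of `i` is strictly before the block of `j`. -/
def Before {α : Type} (γ : Compo α) (i j : α) : Prop := γ.rel i j ∧ ¬ γ.rel j i

/-- The composition with a single block. -/
def one (α : Type) : Compo α where
  rel _ _ := True
  total _ _ := Or.inl trivial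
  trans _ _ _ _ _ := trivial

/-- The image of a composition by a permutation `σ`: its blocks are the `σ(A)`, `A` a block of
`γ`, in the same order. -/
def perm {α : Type} (σ : Equiv.Perm α) (γ : Compo α) : Compo α where
  rel i j := γ.rel (σ.symm i) (σ.symm j)
  total _ _ := γ.total _ _
  trans _ _ _ := γ.trans _ _ _

/-- The restriction `γ_[n]` of a composition of `ℕ` to `[n]`. -/
def restrict (n : ℕ) (γ : Compo ℕ) : Compo (Fin n) where
  rel i j := γ.rel i j
  total _ _ := γ.total _ _
  trans _ _ _ := γ.trans _ _ _

/-- The composition `({i}, ℕ \ {i})`. -/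
def left (i : ℕ) : Compo ℕ where
  rel a b := a = i ∨ b ≠ i
  total a b := by tauto
  trans a b c := by tauto

/-- The composition `(ℕ \ {i}, {i})`. -/
def right (i : ℕ) : Compo ℕ where
  rel a b := b = i ∨ a ≠ i
  total a b := by tauto
  trans a b c := by tauto

/-- The partition of `ℕ` into the blocks of a composition, with their order forgotten (the
canonical projection). Partitions of `ℕ` are equivalence relations on `ℕ`. -/
def toPartition (γ : Compo ℕ) : Setoid ℕ where
  r := γ.Same
  iseqv :=
    ⟨fun i => ⟨(γ.total i i).elim id id, (γ.total i i).elim id id⟩,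
      fun h => ⟨h.2, h.1⟩,
      fun h h' => ⟨γ.trans _ _ _ h.1 h'.1, γ.trans _ _ _ h'.2 h.2⟩⟩

end Compo

/-- The restriction of a partition of `ℕ` to `[n]`. -/
def partRestrict (n : ℕ) (π : Setoid ℕ) : Setoid (Fin n) := Setoid.comap Fin.val π

/-- The Borel σ-algebra of the projective limit topology on compositions of `ℕ`: the one generated
by the restrictions to `[n]`, where the finite set `Compo (Fin n)` is discrete. -/
instance instMeasurableSpaceCompo : MeasurableSpace (Compo ℕ) :=
  ⨆ n : ℕ, MeasurableSpace.comap (Compo.restrict n) ⊤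

/-- The σ-algebra on partitions of `ℕ` generated by the restrictions to `[n]`. -/
instance instMeasurableSpacePartition : MeasurableSpace (Setoid ℕ) :=
  ⨆ n : ℕ, MeasurableSpace.comap (partRestrict n) ⊤

/-- The measure `ε = ∑ᵢ δ_{({i}, ℕ \ {i})}`. -/
def epsLeft : Measure (Compo ℕ) := Measure.sum fun i => Measure.dirac (Compo.left i)

/-- The measure `ε' = ∑ᵢ δ_{(ℕ \ {i}, {i})}`. -/
def epsRight : Measure (Compo ℕ) := Measure.sum fun i => Measure.dirac (Compo.right i)

/-- The partition `{{i}, ℕ \ {i}}`. -/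
def singlePartition (i : ℕ) : Setoid ℕ where
  r a b := a = i ↔ b = i
  iseqv := ⟨fun _ => Iff.rfl, fun h => h.symm, fun h h' => h.trans h'⟩

/-- The measure `∑ᵢ δ_{{{i}, ℕ \ {i}}}` on partitions. -/
def epsPart : Measure (Setoid ℕ) := Measure.sum fun i => Measure.dirac (singlePartition i)

/-- Exchangeability: the marginal on compositions of `[n]` is invariant under the permutations
of `[n]`, for every `n`. -/
def IsExchangeable (μ : Measure (Compo ℕ)) : Prop :=
  ∀ (n : ℕ) (σ : Equiv.Perm (Fin n)) (c : Compo (Fin n)),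
    μ {γ | γ.restrict n = c} = μ {γ | (γ.restrict n).perm σ = c}

/-- Fragmentation measures on compositions of `ℕ`. -/
structure IsFragmentationMeasure (μ : Measure (Compo ℕ)) : Prop where
  exchangeable : IsExchangeable μ
  one_eq_zero : μ {Compo.one ℕ} = 0
  finite : ∀ n : ℕ, μ {γ | γ.restrict n ≠ Compo.one (Fin n)} < ∞

/-! ### Open subsets of `]0,1[` -/

/-- The set of open subsets of `]0,1[`. -/
@[ext] structure OpenSub where
  carrier : Set ℝ
  isOpen : IsOpen carrier
  subset : carrier ⊆ Ioo 0 1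

namespace OpenSub

/-- The full interval `]0,1[`. -/
def full : OpenSub := ⟨Ioo 0 1, isOpen_Ioo, subset_rfl⟩

/-- `χ_U(x)`, the distance from `x ∈ [0,1]` to `[0,1] \ U`. -/
def chi (U : OpenSub) : C(Icc (0 : ℝ) 1, ℝ) where
  toFun x := Metric.infDist (x : ℝ) (Icc 0 1 \ U.carrier)
  continuous_toFun := (Metric.continuous_infDist_pt _).comp continuous_subtype_val

theorem chi_injective : Function.Injective chi := by
  have key : ∀ (U : OpenSub) (x : Icc (0 : ℝ) 1), (x : ℝ) ∈ U.carrier ↔ chi U x ≠ 0 := by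
    intro U x
    have hne : (Icc (0 : ℝ) 1 \ U.carrier).Nonempty :=
      ⟨0, ⟨le_rfl, zero_le_one⟩, fun h => lt_irrefl _ (U.subset h).1⟩
    have hcl : IsClosed (Icc (0 : ℝ) 1 \ U.carrier) := isClosed_Icc.sdiff U.isOpen
    have h := hcl.mem_iff_infDist_zero hne (x := (x : ℝ))
    change _ ↔ Metric.infDist (x : ℝ) (Icc 0 1 \ U.carrier) ≠ 0
    rw [ne_eq, ← h]
    simp only [Set.mem_sdiff, x.2, true_and, not_not]
  intro U V h
  ext x
  constructor
  · intro hx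
    have h1 := (key U ⟨x, Ioo_subset_Icc_self (U.subset hx)⟩).1 hx
    rw [h] at h1
    exact (key V _).2 h1
  · intro hx
    have h1 := (key V ⟨x, Ioo_subset_Icc_self (V.subset hx)⟩).1 hx
    rw [← h] at h1
    exact (key U _).2 h1

/-- The distance `d(U, V) = sup_{x ∈ [0,1]} |χ_U(x) - χ_V(x)|`. -/
instance : MetricSpace OpenSub := MetricSpace.induced chi chi_injective inferInstance

/-- The Borel σ-algebra. -/
instance : MeasurableSpace OpenSub := borel OpenSub

instance : BorelSpace OpenSub := ⟨rfl⟩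

/-- The interval components of `U`. -/
def components (U : OpenSub) : Set (Set ℝ) :=
  {I | ∃ x ∈ U.carrier, I = connectedComponentIn U.carrier x}

/-- The length `s₁` of the largest interval component of `U` (`0` if `U` is empty). -/
def maxLength (U : OpenSub) : ℝ≥0∞ := ⨆ I ∈ U.components, volume I

/-- The `(k+1)`-st largest length (with multiplicity) of an interval component of `U`, and `0`
if `U` has at most `k` components: the largest `t` such that some `k + 1` distinct components all
have length at least `t`. -/
def rankedLength (U : OpenSub) (k : ℕ) : ℝ≥0∞ :=
  ⨆ F : {F : Finset (Set ℝ) // (F : Set (Set ℝ)) ⊆ U.components ∧ F.card = k + 1},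
    ⨅ I ∈ F.1, volume I

end OpenSub

/-- Dislocation measures on the open subsets of `]0,1[`. -/
structure IsDislocationMeasure (ν : Measure OpenSub) : Prop where
  full_eq_zero : ν {OpenSub.full} = 0
  integral_lt_top : ∫⁻ U, (1 - U.maxLength) ∂ν < ∞

/-! ### Paintboxes and asymptotic open sets -/

/-- The law of an i.i.d. sequence of uniform variables on `[0,1]`. -/
def uniformSeq : Measure (ℕ → unitInterval) :=
  Measure.infinitePi fun _ => (volume : Measure unitInterval)

/-- The composition built from `U` and the sample `x`. One has `i ∼ j` if `x i`, `x j` are in the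
same component of `U`, and otherwise `i ≺ j` if `x i < x j` and `j ≺ i` if `x j < x i`. (Ties
`x i = x j` outside `U` with `i ≠ j` have probability zero; `i` and `j` are then put in the same
block.) -/
def paintbox (U : OpenSub) (x : ℕ → unitInterval) : Compo ℕ where
  rel i j := (x i : ℝ) ≤ x j ∨ (x j : ℝ) ∈ connectedComponentIn U.carrier (x i)
  total i j := (le_total (x i : ℝ) (x j)).imp Or.inl Or.inl
  trans i j k := by
    have oc : ∀ y, OrdConnected (connectedComponentIn U.carrier y) := fun y =>
      isPreconnected_connectedComponentIn.ordConnected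
    have hs : ∀ {y z : ℝ}, z ∈ connectedComponentIn U.carrier y →
        y ∈ connectedComponentIn U.carrier y := fun {y z} h =>
      mem_connectedComponentIn (connectedComponentIn_nonempty_iff.1 ⟨z, h⟩)
    rintro (h | h) (h' | h')
    · exact Or.inl (h.trans h')
    · rcases le_total (x i : ℝ) (x k) with h2 | h2
      · exact Or.inl h2
      · right
        have hi := (oc (x j)).out h' (hs h') ⟨h2, h⟩
        rw [← connectedComponentIn_eq hi]
        exact h'
    · rcases le_total (x i : ℝ) (x k) with h2 | h2
      · exact Or.inl h2
      · exact Or.inr ((oc (x i)).out h (hs h) ⟨h', h2⟩)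
    · right
      rw [connectedComponentIn_eq h]
      exact h'

/-- The law `P^U` of the composition built from `U` by the paintbox construction. -/
def paintboxLaw (U : OpenSub) : Measure (Compo ℕ) := uniformSeq.map (paintbox U)

/-- The mixture `P^ν = ∫ P^U ν(dU)`. -/
def mixedLaw (ν : Measure OpenSub) : Measure (Compo ℕ) := ν.bind paintboxLaw

open Classical in
/-- The open set `U_n` of a composition: if the successive blocks of `γ_[n]` have sizes
`n₁, …, n_k`, it is the union over `i` of
`](n₁ + ⋯ + n_{i-1}) / n, (n₁ + ⋯ + n_i) / n[`. The interval of the block of `j` runs from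
`#{i < n : i ≺ j} / n` to `#{i < n : i ≺ j or i ∼ j} / n`. -/
def empiricalOpen (γ : Compo ℕ) (n : ℕ) : OpenSub where
  carrier := ⋃ j : Fin n, Ioo
    (((Finset.univ.filter fun i : Fin n => (γ.restrict n).Before i j).card : ℝ) / n)
    (((Finset.univ.filter fun i : Fin n => (γ.restrict n).rel i j).card : ℝ) / n)
  isOpen := isOpen_iUnion fun _ => isOpen_Ioo
  subset := by
    refine iUnion_subset fun j => Ioo_subset_Ioo (by positivity) ?_
    refine div_le_one_of_le₀ ?_ (Nat.cast_nonneg n)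
    exact_mod_cast (Finset.card_le_univ _).trans_eq (Fintype.card_fin n)

/-- `U` is the asymptotic open set `U_γ` of `γ`. -/
def IsAsymptoticOpenSet (γ : Compo ℕ) (U : OpenSub) : Prop :=
  Tendsto (empiricalOpen γ) atTop (𝓝 U)

/-! ### Partitions and mass sequences -/

/-- Mass sequences `s₁ ≥ s₂ ≥ ⋯ ≥ 0` with `∑ sᵢ ≤ 1` (indexed from `0`), with the product
σ-algebra. -/
abbrev MassSeq : Type := {s : ℕ → ℝ≥0∞ // Antitone s ∧ ∑' k, s k ≤ 1}

/-- The mass sequence `(1, 0, 0, …)`. -/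
def MassSeq.one : MassSeq :=
  ⟨fun k => if k = 0 then 1 else 0, by
    constructor
    · intro a b hab
      by_cases hb : b = 0
      · have ha : a = 0 := by omega
        simp [ha, hb]
      · simp [hb]
    · simp⟩

/-- The partition built from `s` and the sample `x`: `i ∼ j` if `i = j`, or if `x i` and `x j`
are in the same interval `[s₁ + ⋯ + s_k, s₁ + ⋯ + s_{k+1}[`. -/
def massPaintbox (s : MassSeq) (x : ℕ → unitInterval) : Setoid ℕ where
  r i j := i = j ∨ ∃ k : ℕ,
    (∑ l ∈ Finset.range k, s.1 l ≤ ENNReal.ofReal (x i) ∧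
      ENNReal.ofReal (x i) < ∑ l ∈ Finset.range (k + 1), s.1 l) ∧
    (∑ l ∈ Finset.range k, s.1 l ≤ ENNReal.ofReal (x j) ∧
      ENNReal.ofReal (x j) < ∑ l ∈ Finset.range (k + 1), s.1 l)
  iseqv := by
    refine ⟨fun i => Or.inl rfl, ?_, ?_⟩
    · rintro i j (h | ⟨k, h1, h2⟩)
      · exact Or.inl h.symm
      · exact Or.inr ⟨k, h2, h1⟩
    · rintro i j m (rfl | ⟨k, h1, h2⟩) (rfl | ⟨k', h3, h4⟩)
      · exact Or.inl rfl
      · exact Or.inr ⟨k', h3, h4⟩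
      · exact Or.inr ⟨k, h1, h2⟩
      · have mono : Monotone fun k : ℕ => ∑ l ∈ Finset.range k, s.1 l := fun a b hab =>
          Finset.sum_le_sum_of_subset (Finset.range_mono hab)
        have hk : k = k' := by
          rcases lt_trichotomy k k' with h | h | h
          · exact absurd (h2.2.trans_le ((mono (Nat.succ_le_of_lt h)).trans h3.1)) (lt_irrefl _)
          · exact h
          · exact absurd (h3.2.trans_le ((mono (Nat.succ_le_of_lt h)).trans h2.1)) (lt_irrefl _)
        subst hk
        exact Or.inr ⟨k, h1, h4⟩

/-- The law `ρ_s` of the exchangeable partition with frequencies `s`. -/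
def massPaintboxLaw (s : MassSeq) : Measure (Setoid ℕ) := uniformSeq.map (massPaintbox s)

/-- The mixture `ρ_ν̃ = ∫ ρ_s ν̃(ds)`. -/
def mixedPartLaw (ν : Measure MassSeq) : Measure (Setoid ℕ) := ν.bind massPaintboxLaw

/-- Dislocation measures on mass sequences. -/
structure IsMassDislocationMeasure (ν : Measure MassSeq) : Prop where
  one_eq_zero : ν {MassSeq.one} = 0
  integral_lt_top : ∫⁻ s, (1 - s.1 0) ∂ν < ∞

/-- `(ν, c)` is a dislocation-erosion decomposition of the measure `μ` on partitions of `ℕ`. -/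
def IsPartitionDecomposition (μ : Measure (Setoid ℕ)) (ν : Measure MassSeq) (c : ℝ≥0) : Prop :=
  IsMassDislocationMeasure ν ∧ μ = mixedPartLaw ν + c • epsPart

/-- `(c_l, c_r, ν)` is a dislocation-erosion decomposition of the measure `μ` on compositions
of `ℕ`. -/
def IsDecomposition (μ : Measure (Compo ℕ)) (c_l c_r : ℝ≥0) (ν : Measure OpenSub) : Prop :=
  IsDislocationMeasure ν ∧ μ = c_l • epsLeft + c_r • epsRight + mixedLaw ν

theorem OpenSub.rankedLength_antitone (U : OpenSub) : Antitone U.rankedLength := by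
  refine antitone_nat_of_succ_le fun k => iSup_le ?_
  rintro ⟨F, hF, hc⟩
  obtain ⟨G, hG, hGc⟩ := Finset.exists_subset_card_eq (show k + 1 ≤ F.card by omega)
  refine le_trans ?_ (le_iSup (fun F : {F : Finset (Set ℝ) //
    (F : Set (Set ℝ)) ⊆ U.components ∧ F.card = k + 1} => ⨅ I ∈ F.1, volume I)
    ⟨G, (Finset.coe_subset.2 hG).trans hF, hGc⟩)
  exact biInf_mono fun I hI => hG hI

theorem OpenSub.sum_volume_le_one (U : OpenSub) (F : Finset (Set ℝ))
    (hF : (F : Set (Set ℝ)) ⊆ U.components) : ∑ I ∈ F, volume I ≤ 1 := by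
  have hd : (F : Set (Set ℝ)).PairwiseDisjoint id := by
    intro I hI J hJ hne
    obtain ⟨x, hx, rfl⟩ := hF hI
    obtain ⟨y, hy, rfl⟩ := hF hJ
    refine Set.disjoint_left.2 fun z hz hz' => hne ?_
    rw [connectedComponentIn_eq hz, connectedComponentIn_eq hz']
  have hm : ∀ I ∈ F, MeasurableSet (id I) := by
    intro I hI
    obtain ⟨x, hx, rfl⟩ := hF hI
    exact U.isOpen.connectedComponentIn.measurableSet
  have h := measure_biUnion_finset (μ := (volume : Measure ℝ)) hd hm
  simp only [id] at h
  rw [← h]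
  calc volume (⋃ I ∈ F, I) ≤ volume (Ioo (0 : ℝ) 1) := by
        refine measure_mono (iUnion₂_subset fun I hI => ?_)
        obtain ⟨x, hx, rfl⟩ := hF hI
        exact (connectedComponentIn_subset _ _).trans U.subset
    _ = 1 := by simp

theorem OpenSub.exists_components_of_lt (U : OpenSub) (t : ℕ → ℝ≥0∞)
    (ht : ∀ k, t k < U.rankedLength k ∨ t k = 0) (n : ℕ) :
    ∃ F : Finset (Set ℝ), (F : Set (Set ℝ)) ⊆ U.components ∧ F.card ≤ n ∧
      ∑ k ∈ Finset.range n, t k ≤ ∑ I ∈ F, volume I := by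
  classical
  induction n with
  | zero => exact ⟨∅, by simp, by simp, by simp⟩
  | succ n ih =>
    obtain ⟨F, hF, hc, hs⟩ := ih
    rcases ht n with h | h
    · obtain ⟨⟨G, hG, hGc⟩, hlt⟩ := lt_iSup_iff.1 h
      obtain ⟨I, hIG, hIF⟩ := Finset.exists_mem_notMem_of_card_lt_card
        (show F.card < G.card by omega)
      refine ⟨insert I F, ?_, ?_, ?_⟩
      · rw [Finset.coe_insert]
        exact Set.insert_subset (hG hIG) hF
      · rw [Finset.card_insert_of_notMem hIF]
        omega
      · rw [Finset.sum_range_succ, Finset.sum_insert hIF, add_comm]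
        exact add_le_add (hlt.le.trans (iInf₂_le I hIG)) hs
    · refine ⟨F, hF, by omega, ?_⟩
      rw [Finset.sum_range_succ, h, add_zero]
      exact hs

theorem OpenSub.tsum_rankedLength_le_one (U : OpenSub) : ∑' k, U.rankedLength k ≤ 1 := by
  have h1 : ∀ k, U.rankedLength k ≤ 1 := by
    intro k
    refine iSup_le ?_
    rintro ⟨F, hF, hc⟩
    have hne : F.Nonempty := Finset.card_pos.1 (by omega)
    obtain ⟨I, hI⟩ := hne
    refine (iInf₂_le I hI).trans (le_trans ?_ (U.sum_volume_le_one F hF))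
    exact Finset.single_le_sum (f := fun I => volume I) (fun _ _ => zero_le) hI
  rw [ENNReal.tsum_eq_iSup_nat]
  refine iSup_le fun n => ?_
  refine ENNReal.le_of_forall_pos_le_add fun ε hε _ => ?_
  obtain ⟨δ, hδ, hδs⟩ := ENNReal.exists_pos_sum_of_countable
    (ENNReal.coe_pos.2 hε).ne' ℕ
  have ht : ∀ k, U.rankedLength k - δ k < U.rankedLength k ∨ U.rankedLength k - δ k = 0 := by
    intro k
    by_cases h0 : U.rankedLength k = 0
    · right
      simp [h0]
    · left
      exact ENNReal.sub_lt_self ((h1 k).trans_lt ENNReal.one_lt_top).ne h0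
        (ENNReal.coe_pos.2 (hδ k)).ne'
  obtain ⟨F, hF, -, hs⟩ := U.exists_components_of_lt _ ht n
  calc ∑ k ∈ Finset.range n, U.rankedLength k
      ≤ ∑ k ∈ Finset.range n, ((U.rankedLength k - δ k) + δ k) :=
        Finset.sum_le_sum fun k _ => le_tsub_add
    _ = ∑ k ∈ Finset.range n, (U.rankedLength k - δ k)
          + ∑ k ∈ Finset.range n, (δ k : ℝ≥0∞) := Finset.sum_add_distrib
    _ ≤ 1 + ε := add_le_add (hs.trans (U.sum_volume_le_one F hF))
        ((ENNReal.sum_le_tsum _).trans hδs.le)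

/-- `|U|↓`, the decreasing sequence of the lengths of the interval components of `U`. -/
def OpenSub.toMassSeq (U : OpenSub) : MassSeq :=
  ⟨U.rankedLength, U.rankedLength_antitone, U.tsum_rankedLength_le_one⟩

/-! ### Measurability

The maps along which measures are transported above are measurable. -/

theorem measurable_compo_iff {Ω : Type*} [MeasurableSpace Ω] {f : Ω → Compo ℕ} :
    Measurable f ↔ ∀ i j, MeasurableSet {ω | (f ω).rel i j} := by
  have hfin : ∀ n, Finite (Compo (Fin n)) := fun n =>
    Finite.of_injective (fun γ => γ.rel) fun _ _ h => Compo.ext h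
  constructor
  · intro hf i j
    have h1 : MeasurableSet {γ : Compo ℕ | γ.rel i j} := by
      let n := max i j + 1
      have h2 : MeasurableSet[MeasurableSpace.comap (Compo.restrict n) ⊤]
          {γ : Compo ℕ | γ.rel i j} :=
        ⟨{c | c.rel ⟨i, by omega⟩ ⟨j, by omega⟩}, trivial, rfl⟩
      exact (le_iSup (fun n => MeasurableSpace.comap (Compo.restrict n) ⊤) n) _ h2
    exact hf h1
  · intro h
    rw [measurable_iff_comap_le]
    change MeasurableSpace.comap f (⨆ n, MeasurableSpace.comap (Compo.restrict n) ⊤) ≤ _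
    rw [MeasurableSpace.comap_iSup]
    refine iSup_le fun n => ?_
    rw [MeasurableSpace.comap_comp]
    let _ : MeasurableSpace (Compo (Fin n)) := ⊤
    have := hfin n
    refine Measurable.comap_le (measurable_to_countable' fun c => ?_)
    have : (Compo.restrict n ∘ f) ⁻¹' {c} =
        ⋂ (i : Fin n) (j : Fin n), {ω | (f ω).rel i j ↔ c.rel i j} := by
      ext ω
      simp only [mem_preimage, Function.comp_apply, mem_singleton_iff, mem_iInter, mem_ofPred_eq,
        Compo.ext_iff, funext_iff, eq_iff_iff, Compo.restrict]
    rw [this]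
    exact MeasurableSet.iInter fun i => MeasurableSet.iInter fun j =>
      (h i j).iff (MeasurableSet.const _)

theorem measurable_partition_iff {Ω : Type*} [MeasurableSpace Ω] {f : Ω → Setoid ℕ} :
    Measurable f ↔ ∀ i j, MeasurableSet {ω | (f ω).r i j} := by
  have hfin : ∀ n, Finite (Setoid (Fin n)) := fun n =>
    Finite.of_injective (fun π => π.r) fun _ _ h => Setoid.ext fun a b => iff_of_eq
      (congrFun (congrFun h a) b)
  constructor
  · intro hf i j
    have h1 : MeasurableSet {π : Setoid ℕ | π.r i j} := by
      let n := max i j + 1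
      have h2 : MeasurableSet[MeasurableSpace.comap (partRestrict n) ⊤]
          {π : Setoid ℕ | π.r i j} :=
        ⟨{c | c.r ⟨i, by omega⟩ ⟨j, by omega⟩}, trivial, rfl⟩
      exact (le_iSup (fun n => MeasurableSpace.comap (partRestrict n) ⊤) n) _ h2
    exact hf h1
  · intro h
    rw [measurable_iff_comap_le]
    change MeasurableSpace.comap f (⨆ n, MeasurableSpace.comap (partRestrict n) ⊤) ≤ _
    rw [MeasurableSpace.comap_iSup]
    refine iSup_le fun n => ?_
    rw [MeasurableSpace.comap_comp]
    let _ : MeasurableSpace (Setoid (Fin n)) := ⊤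
    have := hfin n
    refine Measurable.comap_le (measurable_to_countable' fun c => ?_)
    have : (partRestrict n ∘ f) ⁻¹' {c} =
        ⋂ (i : Fin n) (j : Fin n), {ω | (f ω).r i j ↔ c.r i j} := by
      ext ω
      simp only [mem_preimage, Function.comp_apply, mem_singleton_iff, mem_iInter, mem_ofPred_eq,
        Setoid.ext_iff]
      exact Iff.rfl
    rw [this]
    exact MeasurableSet.iInter fun i => MeasurableSet.iInter fun j =>
      (h i j).iff (MeasurableSet.const _)

theorem measurable_toPartition : Measurable Compo.toPartition := by
  rw [measurable_partition_iff]
  intro i j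
  have h := measurable_compo_iff.1 (measurable_id (α := Compo ℕ))
  exact (h i j).inter (h j i)

instance : IsProbabilityMeasure uniformSeq := by unfold uniformSeq; infer_instance

instance : SecondCountableTopology OpenSub :=
  (Topology.IsInducing.mk rfl : Topology.IsInducing OpenSub.chi).secondCountableTopology

theorem OpenSub.mem_carrier_iff (U : OpenSub) (x : Icc (0 : ℝ) 1) :
    (x : ℝ) ∈ U.carrier ↔ 0 < U.chi x := by
  have hne : (Icc (0 : ℝ) 1 \ U.carrier).Nonempty :=
    ⟨0, ⟨le_rfl, zero_le_one⟩, fun h => lt_irrefl _ (U.subset h).1⟩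
  have hcl : IsClosed (Icc (0 : ℝ) 1 \ U.carrier) := isClosed_Icc.sdiff U.isOpen
  change _ ↔ 0 < Metric.infDist (x : ℝ) (Icc 0 1 \ U.carrier)
  rw [← hcl.notMem_iff_infDist_pos hne]
  simp only [Set.mem_sdiff, x.2, true_and, not_not]

theorem measurableSet_exists {Ω : Type*} [MeasurableSpace Ω] {ι : Sort*} [Countable ι]
    {p : ι → Ω → Prop} (h : ∀ i, MeasurableSet {ω | p i ω}) : MeasurableSet {ω | ∃ i, p i ω} := by
  convert MeasurableSet.iUnion h using 1
  ext ω
  simp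

theorem measurableSet_forall {Ω : Type*} [MeasurableSpace Ω] {ι : Sort*} [Countable ι]
    {p : ι → Ω → Prop} (h : ∀ i, MeasurableSet {ω | p i ω}) : MeasurableSet {ω | ∀ i, p i ω} := by
  convert MeasurableSet.iInter h using 1
  ext ω
  simp

theorem segment_mem (a b t : unitInterval) :
    (1 - (t : ℝ)) * a + t * b ∈ Icc (0 : ℝ) 1 := by
  have h1 := t.2.1
  have h2 := t.2.2
  have h3 := a.2.1
  have h4 := a.2.2
  have h5 := b.2.1
  have h6 := b.2.2
  constructor <;> nlinarith

theorem mem_connectedComponentIn_iff_uIcc (U : OpenSub) (a b : ℝ) :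
    b ∈ connectedComponentIn U.carrier a ↔ uIcc a b ⊆ U.carrier := by
  constructor
  · intro h
    have ha : a ∈ connectedComponentIn U.carrier a :=
      mem_connectedComponentIn (connectedComponentIn_nonempty_iff.1 ⟨b, h⟩)
    exact (isPreconnected_connectedComponentIn.ordConnected.uIcc_subset ha h).trans
      (connectedComponentIn_subset _ _)
  · intro h
    exact isPreconnected_uIcc.subset_connectedComponentIn left_mem_uIcc h right_mem_uIcc

theorem isOpen_segment_subset :
    IsOpen {p : OpenSub × unitInterval × unitInterval |
      uIcc (p.2.1 : ℝ) p.2.2 ⊆ p.1.carrier} := by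
  let pt : (OpenSub × unitInterval × unitInterval) × unitInterval → Icc (0 : ℝ) 1 := fun q =>
    ⟨(1 - (q.2 : ℝ)) * q.1.2.1 + q.2 * q.1.2.2, segment_mem _ _ _⟩
  have hpt : Continuous pt := by
    refine Continuous.subtype_mk ?_ _
    fun_prop
  have hchi : Continuous OpenSub.chi := continuous_induced_dom
  have hF : Continuous fun q : (OpenSub × unitInterval × unitInterval) × unitInterval =>
      OpenSub.chi q.1.1 (pt q) :=
    (hchi.comp (continuous_fst.comp continuous_fst)).eval hpt
  have hcl : IsClosed (Prod.fst '' {q : (OpenSub × unitInterval × unitInterval) × unitInterval |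
      OpenSub.chi q.1.1 (pt q) ≤ 0}) :=
    isClosedMap_fst_of_compactSpace _ (isClosed_le hF continuous_const)
  convert hcl.isOpen_compl using 1
  ext ⟨U, a, b⟩
  simp only [mem_ofPred_eq, mem_compl_iff, mem_image, Prod.exists, not_exists, not_and]
  constructor
  · rintro h U' a' b' t hle heq
    obtain ⟨rfl, rfl, rfl⟩ : U' = U ∧ a' = a ∧ b' = b := by simpa using heq
    refine absurd hle (not_le.2 ((U'.mem_carrier_iff _).1 (h ?_)))
    rw [← segment_eq_uIcc, segment_eq_image]
    exact ⟨t, t.2, rfl⟩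
  · intro h y hy
    rw [← segment_eq_uIcc, segment_eq_image] at hy
    obtain ⟨t, ht, rfl⟩ := hy
    have h1 := h U a b ⟨t, ht⟩
    have h2 : 0 < OpenSub.chi U ⟨_, segment_mem a b ⟨t, ht⟩⟩ := by
      by_contra hc
      exact h1 (not_lt.1 hc) rfl
    exact (U.mem_carrier_iff _).2 h2

theorem measurable_paintbox_uncurry :
    Measurable fun p : OpenSub × (ℕ → unitInterval) => paintbox p.1 p.2 := by
  rw [measurable_compo_iff]
  intro i j
  have h1 : Measurable fun p : OpenSub × (ℕ → unitInterval) => (p.2 i : ℝ) := by fun_prop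
  have h2 : Measurable fun p : OpenSub × (ℕ → unitInterval) => (p.2 j : ℝ) := by fun_prop
  have h0 : {p : OpenSub × (ℕ → unitInterval) | (paintbox p.1 p.2).rel i j} =
      {p | (p.2 i : ℝ) ≤ p.2 j} ∪ {p | uIcc (p.2 i : ℝ) (p.2 j) ⊆ p.1.carrier} := by
    ext p
    exact or_congr Iff.rfl (mem_connectedComponentIn_iff_uIcc _ _ _)
  rw [h0]
  refine (measurableSet_le h1 h2).union ?_
  have h3 : Measurable fun p : OpenSub × (ℕ → unitInterval) => (p.1, p.2 i, p.2 j) := by fun_prop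
  exact h3 isOpen_segment_subset.measurableSet

theorem measurable_paintboxLaw : Measurable paintboxLaw := by
  have h : paintboxLaw = fun U => (uniformSeq.map (Prod.mk U)).map
      fun p : OpenSub × (ℕ → unitInterval) => paintbox p.1 p.2 := by
    funext U
    rw [Measure.map_map measurable_paintbox_uncurry measurable_prodMk_left]
    rfl
  rw [h]
  exact (Measure.measurable_map _ measurable_paintbox_uncurry).comp
    Measurable.map_prodMk_left

theorem measurable_massPaintbox_uncurry :
    Measurable fun p : MassSeq × (ℕ → unitInterval) => massPaintbox p.1 p.2 := by
  rw [measurable_partition_iff]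
  intro i j
  have hx : ∀ i, Measurable fun p : MassSeq × (ℕ → unitInterval) =>
      ENNReal.ofReal (p.2 i) := fun i => by fun_prop
  have hs : ∀ k, Measurable fun p : MassSeq × (ℕ → unitInterval) =>
      ∑ l ∈ Finset.range k, p.1.1 l := fun k => by fun_prop
  refine (MeasurableSet.const (i = j)).union ?_
  refine measurableSet_exists fun k => ?_
  exact ((measurableSet_le (hs k) (hx i)).inter (measurableSet_lt (hx i) (hs (k + 1)))).inter
    ((measurableSet_le (hs k) (hx j)).inter (measurableSet_lt (hx j) (hs (k + 1))))

theorem measurable_massPaintboxLaw : Measurable massPaintboxLaw := by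
  have h : massPaintboxLaw = fun s => (uniformSeq.map (Prod.mk s)).map
      fun p : MassSeq × (ℕ → unitInterval) => massPaintbox p.1 p.2 := by
    funext s
    rw [Measure.map_map measurable_massPaintbox_uncurry measurable_prodMk_left]
    rfl
  rw [h]
  exact (Measure.measurable_map _ measurable_massPaintbox_uncurry).comp
    Measurable.map_prodMk_left

theorem OpenSub.measurableSet_segment (a b : ℝ) :
    MeasurableSet {U : OpenSub | uIcc a b ⊆ U.carrier} := by
  by_cases h : a ∈ Icc (0 : ℝ) 1 ∧ b ∈ Icc (0 : ℝ) 1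
  · have h3 : Measurable fun U : OpenSub =>
        (U, (⟨a, h.1⟩ : unitInterval), (⟨b, h.2⟩ : unitInterval)) := by fun_prop
    exact h3 isOpen_segment_subset.measurableSet
  · convert MeasurableSet.empty using 1
    refine eq_empty_of_forall_notMem fun U hU => h ?_
    exact ⟨Ioo_subset_Icc_self (U.subset (hU left_mem_uIcc)),
      Ioo_subset_Icc_self (U.subset (hU right_mem_uIcc))⟩

theorem OpenSub.lt_rankedLength_iff (U : OpenSub) (k : ℕ) (t : ℝ≥0∞) :
    t < U.rankedLength k ↔ ∃ a b : Fin (k + 1) → ℚ,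
      (∀ i, (a i : ℝ) ≤ b i ∧ t < ENNReal.ofReal (b i - a i) ∧
        uIcc (a i : ℝ) (b i) ⊆ U.carrier) ∧
      ∀ i j, i ≠ j → ¬ uIcc (a i : ℝ) (a j) ⊆ U.carrier := by
  classical
  constructor
  · intro h
    obtain ⟨⟨F, hF, hc⟩, hlt⟩ := lt_iSup_iff.1 h
    let e := F.equivFinOfCardEq hc
    have hvol : ∀ i, t < volume (e.symm i : Set ℝ) := fun i =>
      hlt.trans_le (iInf₂_le _ (e.symm i).2)
    have key : ∀ i, ∃ a b : ℚ, (a : ℝ) ≤ b ∧ t < ENNReal.ofReal (b - a) ∧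
        uIcc (a : ℝ) b ⊆ U.carrier ∧ (a : ℝ) ∈ (e.symm i : Set ℝ) := by
      intro i
      obtain ⟨x, hx, hI⟩ := hF (e.symm i).2
      have hop : IsOpen (e.symm i : Set ℝ) := hI ▸ U.isOpen.connectedComponentIn
      have hoc : OrdConnected (e.symm i : Set ℝ) :=
        hI ▸ isPreconnected_connectedComponentIn.ordConnected
      have hsub : (e.symm i : Set ℝ) ⊆ U.carrier := hI ▸ connectedComponentIn_subset _ _
      obtain ⟨K, hK, hKc, hKt⟩ := hop.measurableSet.exists_lt_isCompact (hvol i)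
      have hKne : K.Nonempty := by
        by_contra hne
        rw [not_nonempty_iff_eq_empty] at hne
        simp [hne] at hKt
      have hm := hK (hKc.sInf_mem hKne)
      have hM := hK (hKc.sSup_mem hKne)
      have hle : sInf K ≤ sSup K := Real.sInf_le_sSup K hKc.bddBelow hKc.bddAbove
      have hKlen : t < ENNReal.ofReal (sSup K - sInf K) := by
        refine hKt.trans_le ?_
        rw [← Real.volume_Icc]
        exact measure_mono fun y hy => ⟨csInf_le hKc.bddBelow hy, le_csSup hKc.bddAbove hy⟩
      obtain ⟨l, hl, hl'⟩ := Metric.isOpen_iff.1 hop _ hm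
      obtain ⟨r, hr, hr'⟩ := Metric.isOpen_iff.1 hop _ hM
      obtain ⟨a, ha1, ha2⟩ := exists_rat_btwn (show sInf K - l < sInf K by linarith)
      obtain ⟨b, hb1, hb2⟩ := exists_rat_btwn (show sSup K < sSup K + r by linarith)
      have ham : (a : ℝ) ∈ (e.symm i : Set ℝ) := hl' (by
        rw [Metric.mem_ball, Real.dist_eq, abs_lt]; constructor <;> linarith)
      have hbm : (b : ℝ) ∈ (e.symm i : Set ℝ) := hr' (by
        rw [Metric.mem_ball, Real.dist_eq, abs_lt]; constructor <;> linarith)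
      exact ⟨a, b, by linarith, hKlen.trans_le (ENNReal.ofReal_le_ofReal (by linarith)),
        (hoc.uIcc_subset ham hbm).trans hsub, ham⟩
    choose a b h1 h2 h3 h4 using key
    refine ⟨a, b, fun i => ⟨h1 i, h2 i, h3 i⟩, fun i j hij hs => hij ?_⟩
    obtain ⟨x, hx, hI⟩ := hF (e.symm i).2
    obtain ⟨y, hy, hJ⟩ := hF (e.symm j).2
    have hi := h4 i
    have hj := h4 j
    rw [hI] at hi
    rw [hJ] at hj
    have := (mem_connectedComponentIn_iff_uIcc U _ _).2 hs
    apply e.symm.injective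
    apply Subtype.ext
    rw [hI, hJ, connectedComponentIn_eq hi, connectedComponentIn_eq hj,
      connectedComponentIn_eq this]
  · rintro ⟨a, b, h1, h2⟩
    let c : Fin (k + 1) → Set ℝ := fun i => connectedComponentIn U.carrier (a i)
    have hinj : Function.Injective c := by
      intro i j hij
      by_contra hne
      refine h2 i j hne ((mem_connectedComponentIn_iff_uIcc U _ _).1 ?_)
      change (a j : ℝ) ∈ c i
      rw [hij]
      exact mem_connectedComponentIn ((h1 j).2.2 left_mem_uIcc)
    have hlt : ∀ i, t < volume (c i) := by
      intro i
      refine (h1 i).2.1.trans_le ?_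
      rw [← Real.volume_Icc, ← uIcc_of_le (h1 i).1]
      exact measure_mono
        (isPreconnected_uIcc.subset_connectedComponentIn left_mem_uIcc (h1 i).2.2)
    refine lt_of_lt_of_le ?_ (le_iSup (fun F : {F : Finset (Set ℝ) //
      (F : Set (Set ℝ)) ⊆ U.components ∧ F.card = k + 1} => ⨅ I ∈ F.1, volume I)
      ⟨Finset.univ.image c, ?_, ?_⟩)
    · obtain ⟨i, -, hi⟩ := Finset.exists_min_image Finset.univ (fun i => volume (c i))
        Finset.univ_nonempty
      refine (hlt i).trans_le (le_iInf₂ fun I hI => ?_)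
      obtain ⟨j, -, rfl⟩ := Finset.mem_image.1 hI
      exact hi j (Finset.mem_univ j)
    · intro I hI
      obtain ⟨j, -, rfl⟩ := Finset.mem_image.1 (Finset.mem_coe.1 hI)
      exact ⟨a j, (h1 j).2.2 left_mem_uIcc, rfl⟩
    · rw [Finset.card_image_of_injective _ hinj, Finset.card_univ, Fintype.card_fin]

theorem measurable_toMassSeq : Measurable OpenSub.toMassSeq := by
  refine Measurable.subtype_mk (measurable_pi_lambda _ fun k => measurable_of_Ioi fun t => ?_)
  have : (fun U : OpenSub => U.rankedLength k) ⁻¹' Ioi t =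
      ⋃ (a : Fin (k + 1) → ℚ) (b : Fin (k + 1) → ℚ), {U : OpenSub |
        (∀ i, (a i : ℝ) ≤ b i ∧ t < ENNReal.ofReal (b i - a i) ∧
          uIcc (a i : ℝ) (b i) ⊆ U.carrier) ∧
        ∀ i j, i ≠ j → ¬ uIcc (a i : ℝ) (a j) ⊆ U.carrier} := by
    ext U
    simp only [mem_preimage, mem_Ioi, mem_iUnion, mem_ofPred_eq]
    exact U.lt_rankedLength_iff k t
  rw [this]
  refine MeasurableSet.iUnion fun a => MeasurableSet.iUnion fun b => MeasurableSet.inter ?_ ?_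
  · exact measurableSet_forall fun i => (MeasurableSet.const _).inter
      ((MeasurableSet.const _).inter (OpenSub.measurableSet_segment _ _))
  · exact measurableSet_forall fun i => measurableSet_forall fun j => measurableSet_forall
      fun _ => (OpenSub.measurableSet_segment _ _).compl

end Frag

end

open Frag

noncomputable section

namespace Frag

/-! ### Pullbacks of compositions, cylinders and exchangeability -/

namespace Compo

/-! Finite exchangeable measures come first, in the manner of de Finetti and Kingman. The law `P^U`,
with `U` the empirical open set of `γ_[N]`, is the law of the composition read off from a sample
with replacement from `[N]` (`paintboxLaw_empiricalOpen`). A sample of fixed size has no repetition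
with probability tending to 1, and exchangeability gives a sample without repetition the law of
`γ_[n]` (`tendsto_mixedLaw_empiricalOpen`). The space of open sets is compact and `U ↦ P^U(γ_[n] =
c)` is continuous, so a limit point of the laws of the empirical open sets is a mixing measure
(`IsExchangeable.exists_eq_mixedLaw`).

A fragmentation measure `μ` may be infinite. Restricting it to the event that `γ_[k]` is non-trivial
and forgetting the first `k` integers gives a finite exchangeable measure, hence some `P^{ν_k}`,
with `ν_k` increasing in `k`. For non-trivial `c`, the mass `μ(γ_[n] = c)` can be computed on the
window `k, …, k + n - 1`. The part where `[k]` is cut is `P^{ν_k}(γ_[n] = c)`; the other part, after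
exchanging the window with `[k]`, is the mass of `γ_[n] = c` with the next `k` integers in one
block. As `k → ∞` this leaves `P^ν` and the compositions in which all integers from `n` on share a
block (`IsFragmentationMeasure.exists_mixedLaw_add`). There are finitely many of these. If two
integers lie outside the big block, moving one of them far away while keeping the other produces
infinitely many compositions of equal mass inside an event of finite measure, so this mass is zero
(`IsFragmentationMeasure.measure_singleton_eq_zero`). Only the atoms of `ε` and `ε'` survive, with
masses independent of `i`.

For uniqueness, the Glivenko–Cantelli theorem gives `U_γ = U` almost surely under `P^U`, while `U_γ
= ]0,1[` for every atom of `ε` and `ε'`. The two parts therefore live on disjoint events, `ν` is the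
image of the dislocation part under `asymptoticOpen`, and the coefficients are masses of atoms.

On partitions, the paintbox depends only on the law of one i.i.d. label, the rank of the component
hit, which gives `ρ` of the ranked lengths. The ranked block frequencies then play the role that
`U_γ` plays for compositions. -/

/-- The composition of `β` pulled back from a composition of `α` along `f : β → α`. -/
def comap {α β : Type} (f : β → α) (γ : Compo α) : Compo β where
  rel i j := γ.rel (f i) (f j)
  total _ _ := γ.total _ _
  trans _ _ _ := γ.trans _ _ _

theorem rel_refl {α : Type} (γ : Compo α) (i : α) : γ.rel i i := (γ.total i i).elim id id

instance finite_compo (n : ℕ) : Finite (Compo (Fin n)) :=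
  Finite.of_injective (fun γ => γ.rel) fun _ _ h => Compo.ext h

theorem measurableSet_rel (i j : ℕ) : MeasurableSet {γ : Compo ℕ | γ.rel i j} :=
  measurable_compo_iff.1 (measurable_id (α := Compo ℕ)) i j

theorem measurable_comap (f : ℕ → ℕ) : Measurable (comap f) :=
  measurable_compo_iff.2 fun i j => measurableSet_rel (f i) (f j)

theorem measurableSet_comap_eq {n : ℕ} (f : Fin n → ℕ) (c : Compo (Fin n)) :
    MeasurableSet {γ : Compo ℕ | γ.comap f = c} := by
  have : {γ : Compo ℕ | γ.comap f = c} =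
      ⋂ (i : Fin n) (j : Fin n), {γ | γ.rel (f i) (f j) ↔ c.rel i j} := by
    ext γ
    simp only [mem_iInter, mem_ofPred_eq, Compo.ext_iff, funext_iff, eq_iff_iff, comap]
  rw [this]
  exact MeasurableSet.iInter fun i => MeasurableSet.iInter fun j =>
    (measurableSet_rel _ _).iff (MeasurableSet.const _)

theorem measurableSet_comap_mem {n : ℕ} (f : Fin n → ℕ) (S : Set (Compo (Fin n))) :
    MeasurableSet {γ : Compo ℕ | γ.comap f ∈ S} := by
  have : {γ : Compo ℕ | γ.comap f ∈ S} = ⋃ c ∈ S, {γ | γ.comap f = c} := by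
    ext γ
    simp
  rw [this]
  exact MeasurableSet.biUnion S.to_countable fun c _ => measurableSet_comap_eq f c

theorem measurableSet_restrict_mem {n : ℕ} (S : Set (Compo (Fin n))) :
    MeasurableSet {γ : Compo ℕ | γ.restrict n ∈ S} :=
  measurableSet_comap_mem Fin.val S

theorem measurableSet_restrict_eq {n : ℕ} (c : Compo (Fin n)) :
    MeasurableSet {γ : Compo ℕ | γ.restrict n = c} :=
  measurableSet_restrict_mem {c}

theorem eq_one_iff {α : Type} {γ : Compo α} : γ = one α ↔ ∀ i j, γ.rel i j := by
  simp only [Compo.ext_iff, funext_iff, one, eq_iff_iff, iff_true]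

theorem restrict_eq_one_iff {n : ℕ} {γ : Compo ℕ} :
    γ.restrict n = one (Fin n) ↔ ∀ i < n, ∀ j < n, γ.rel i j := by
  rw [eq_one_iff]
  exact ⟨fun h i hi j hj => h ⟨i, hi⟩ ⟨j, hj⟩, fun h i j => h i i.2 j j.2⟩

theorem eq_one_iff_restrict {γ : Compo ℕ} :
    γ = one ℕ ↔ ∀ n, γ.restrict n = one (Fin n) := by
  simp only [restrict_eq_one_iff]
  rw [eq_one_iff]
  exact ⟨fun h n i _ j _ => h i j, fun h i j => h (i + j + 1) i (by omega) j (by omega)⟩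

theorem measurableSet_singleton_one : MeasurableSet {one ℕ} := by
  have : ({one ℕ} : Set (Compo ℕ)) = ⋂ n, {γ | γ.restrict n = one (Fin n)} := by
    ext γ
    simp only [mem_singleton_iff, mem_iInter, mem_ofPred_eq, eq_one_iff_restrict]
  rw [this]
  exact MeasurableSet.iInter fun n => measurableSet_restrict_eq _

/-- The cylinders of non-trivial compositions of `[n]`, together with the trivial composition. -/
def cylinders : Set (Set (Compo ℕ)) :=
  insert {one ℕ} {s | ∃ (n : ℕ) (c : Compo (Fin n)), c ≠ one (Fin n) ∧ s = {γ | γ.restrict n = c}}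

theorem countable_cylinders : cylinders.Countable := by
  refine Countable.insert _ ?_
  refine (countable_range fun p : Σ n, Compo (Fin n) => {γ : Compo ℕ | γ.restrict p.1 = p.2}).mono ?_
  rintro s ⟨n, c, -, rfl⟩
  exact ⟨⟨n, c⟩, rfl⟩

theorem generateFrom_cylinders :
    instMeasurableSpaceCompo = MeasurableSpace.generateFrom cylinders := by
  refine le_antisymm ?_ (MeasurableSpace.generateFrom_le ?_)
  · refine iSup_le fun n => ?_
    rintro _ ⟨S, -, rfl⟩
    have key : ∀ c : Compo (Fin n), MeasurableSet[MeasurableSpace.generateFrom cylinders]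
        {γ : Compo ℕ | γ.restrict n = c} := by
      intro c
      by_cases hc : c = one (Fin n)
      · have : {γ : Compo ℕ | γ.restrict n = c} =
            (⋃ d ∈ {d : Compo (Fin n) | d ≠ one (Fin n)}, {γ | γ.restrict n = d})ᶜ := by
          ext γ
          simp only [hc, mem_ofPred_eq, mem_compl_iff, mem_iUnion, exists_prop, exists_eq_right',
            not_not]
        rw [this]
        refine MeasurableSet.compl (MeasurableSet.biUnion (to_countable _) fun d hd => ?_)
        exact MeasurableSpace.measurableSet_generateFrom (Or.inr ⟨n, d, hd, rfl⟩)
      · exact MeasurableSpace.measurableSet_generateFrom (Or.inr ⟨n, c, hc, rfl⟩)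
    have : Compo.restrict n ⁻¹' S = ⋃ c ∈ S, {γ : Compo ℕ | γ.restrict n = c} := by
      ext γ
      simp
    rw [this]
    exact MeasurableSet.biUnion S.to_countable fun c _ => key c
  · rintro s (rfl | ⟨n, c, -, rfl⟩)
    · exact measurableSet_singleton_one
    · exact measurableSet_restrict_eq c

theorem restrict_castLE {n k : ℕ} (h : n ≤ k) (γ : Compo ℕ) :
    (γ.restrict k).comap (Fin.castLE h) = γ.restrict n := rfl

/-- The restriction to `[k]` determines the one to `[n]` for `n ≤ k`, so two cylinders are nested or
disjoint; the trivial composition lies in no non-trivial cylinder. -/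
theorem isPiSystem_cylinders : IsPiSystem cylinders := by
  have key : ∀ {n k : ℕ} (_ : n ≤ k) (c : Compo (Fin n)) (d : Compo (Fin k)),
      ({γ : Compo ℕ | γ.restrict n = c} ∩ {γ | γ.restrict k = d}).Nonempty →
      {γ : Compo ℕ | γ.restrict n = c} ∩ {γ | γ.restrict k = d} = {γ | γ.restrict k = d} := by
    rintro n k h c d ⟨γ, rfl, rfl⟩
    refine inter_eq_right.2 fun γ' hγ' => ?_
    change γ'.restrict n = γ.restrict n
    rw [← restrict_castLE h, ← restrict_castLE h, show γ'.restrict k = γ.restrict k from hγ']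
  rintro s (rfl | ⟨n, c, hc, rfl⟩) t (rfl | ⟨k, d, hd, rfl⟩) hne
  · exact Or.inl (inter_self _)
  · obtain ⟨γ, rfl, h⟩ := hne
    exact absurd (show (one ℕ).restrict k = d from h).symm hd
  · obtain ⟨γ, h, rfl⟩ := hne
    exact absurd (show (one ℕ).restrict n = c from h).symm hc
  · rcases le_total n k with h | h
    · exact Or.inr ⟨k, d, hd, key h c d hne⟩
    · rw [inter_comm] at hne ⊢
      exact Or.inr ⟨n, c, hc, key h d c hne⟩

/-- Two measures on compositions agree as soon as they agree on the non-trivial cylinders, where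
they are finite, and on the trivial composition. -/
theorem measure_ext {m₁ m₂ : Measure (Compo ℕ)}
    (hfin : ∀ (n : ℕ) (c : Compo (Fin n)), c ≠ one (Fin n) → m₁ {γ | γ.restrict n = c} ≠ ∞)
    (h : ∀ (n : ℕ) (c : Compo (Fin n)), c ≠ one (Fin n) →
      m₁ {γ | γ.restrict n = c} = m₂ {γ | γ.restrict n = c})
    (hfin_one : m₁ {one ℕ} ≠ ∞) (h_one : m₁ {one ℕ} = m₂ {one ℕ}) : m₁ = m₂ := by
  refine Measure.ext_of_generateFrom_of_cover_subset generateFrom_cylinders isPiSystem_cylinders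
    subset_rfl countable_cylinders ?_ ?_ ?_
  -- A composition other than the trivial one is already non-trivial on some `[n]`.
  · refine eq_univ_of_forall fun γ => ?_
    by_cases hγ : γ = one ℕ
    · exact ⟨_, Or.inl rfl, hγ⟩
    · rw [eq_one_iff_restrict, not_forall] at hγ
      obtain ⟨n, hn⟩ := hγ
      exact ⟨_, Or.inr ⟨n, _, hn, rfl⟩, rfl⟩
  · rintro s (rfl | ⟨n, c, hc, rfl⟩)
    exacts [hfin_one, hfin n c hc]
  · rintro s (rfl | ⟨n, c, hc, rfl⟩)
    exacts [h_one, h n c hc]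

/-- This recovers the atom at the trivial composition from cylinder masses, as a decreasing limit.
It fails for infinite fragmentation measures, which is why their definition prescribes that atom. -/
theorem tendsto_measure_restrict_eq_one (m : Measure (Compo ℕ)) [IsFiniteMeasure m] :
    Tendsto (fun n => m {γ | γ.restrict n = one (Fin n)}) atTop (𝓝 (m {one ℕ})) := by
  have h0 : ({one ℕ} : Set (Compo ℕ)) = ⋂ n, {γ | γ.restrict n = one (Fin n)} := by
    ext γ
    simp only [mem_singleton_iff, mem_iInter, mem_ofPred_eq, eq_one_iff_restrict]
  rw [h0]
  refine tendsto_measure_iInter_atTop (fun n => (measurableSet_restrict_eq _).nullMeasurableSet)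
    ?_ ⟨0, measure_ne_top _ _⟩
  intro n k hnk γ (hγ : γ.restrict k = one (Fin k))
  change γ.restrict n = one (Fin n)
  rw [restrict_eq_one_iff] at hγ ⊢
  exact fun i hi j hj => hγ i (by omega) j (by omega)

/-- Two finite measures on compositions agree as soon as they agree on cylinders. -/
theorem measure_ext_of_isFiniteMeasure {m₁ m₂ : Measure (Compo ℕ)} [IsFiniteMeasure m₁]
    [IsFiniteMeasure m₂]
    (h : ∀ (n : ℕ) (c : Compo (Fin n)),
      m₁ {γ | γ.restrict n = c} = m₂ {γ | γ.restrict n = c}) : m₁ = m₂ := by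
  refine measure_ext (fun n c _ => measure_ne_top _ _) (fun n c _ => h n c) (measure_ne_top _ _) ?_
  refine tendsto_nhds_unique (tendsto_measure_restrict_eq_one m₁) ?_
  simp only [h]
  exact tendsto_measure_restrict_eq_one m₂

theorem measure_comap_mem_eq_sum (μ : Measure (Compo ℕ)) {n : ℕ} (f : Fin n → ℕ)
    (S : Set (Compo (Fin n))) :
    μ {γ | γ.comap f ∈ S} = ∑' c : S, μ {γ | γ.comap f = c} := by
  have : {γ : Compo ℕ | γ.comap f ∈ S} = ⋃ c ∈ S, {γ | γ.comap f = c} := by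
    ext γ
    simp
  rw [this, measure_biUnion S.to_countable ?_ fun c _ => measurableSet_comap_eq f c]
  intro c _ d _ hcd
  exact Set.disjoint_left.2 fun γ h h' => hcd (h.symm.trans h')

end Compo

open Compo

/-! ### Exchangeability along injections -/

theorem IsExchangeable.measure_perm_mem {μ : Measure (Compo ℕ)} (hμ : IsExchangeable μ) {n : ℕ}
    (σ : Equiv.Perm (Fin n)) (S : Set (Compo (Fin n))) :
    μ {γ | γ.comap (fun i => (σ i : ℕ)) ∈ S} = μ {γ | γ.restrict n ∈ S} := by
  change _ = μ {γ | γ.comap Fin.val ∈ S}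
  rw [measure_comap_mem_eq_sum, measure_comap_mem_eq_sum]
  exact tsum_congr fun c => (hμ n σ.symm c).symm

/-- For an exchangeable measure, the law of the pullback along an injection of `[n]` does not
depend on the injection. -/
theorem IsExchangeable.measure_comap_mem {μ : Measure (Compo ℕ)} (hμ : IsExchangeable μ) {n : ℕ}
    {f : Fin n → ℕ} (hf : Function.Injective f) (S : Set (Compo (Fin n))) :
    μ {γ | γ.comap f ∈ S} = μ {γ | γ.restrict n ∈ S} := by
  -- `[M]` contains both `[n]` and the range of `f`, so that `f` extends to a permutation of `[M]`.
  obtain ⟨M, hnM, hM⟩ : ∃ M, n ≤ M ∧ ∀ i, f i < M := by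
    refine ⟨n + ∑ i, (f i + 1), by omega, fun i => ?_⟩
    have := Finset.single_le_sum (f := fun i => f i + 1) (fun _ _ => Nat.zero_le _)
      (Finset.mem_univ i)
    have h' : f i + 1 ≤ ∑ i, (f i + 1) := this
    omega
  obtain ⟨τ, hτ⟩ : ∃ τ : Equiv.Perm (Fin M), ∀ i, τ (Fin.castLE hnM i) = ⟨f i, hM i⟩ := by
    obtain ⟨τ, hτ⟩ := Equiv.Perm.exists_extending_pair (Fin.castLE hnM)
      (fun i => (⟨f i, hM i⟩ : Fin M)) (Fin.castLE_injective hnM)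
      fun i j h => hf (by simpa using h)
    exact ⟨τ, hτ⟩
  have h := hμ.measure_perm_mem τ {d | d.comap (Fin.castLE hnM) ∈ S}
  have h1 : ∀ γ : Compo ℕ, (γ.comap fun i => (τ i : ℕ)).comap (Fin.castLE hnM) = γ.comap f :=
    fun γ => by simp only [Compo.comap, hτ]
  simpa only [mem_ofPred_eq, h1, restrict_castLE] using h

/-- A permutation of `[n]`, extended by the identity to a permutation of `ℕ`. -/
theorem exists_perm_extend {n : ℕ} (σ : Equiv.Perm (Fin n)) :
    ∃ τ : Equiv.Perm ℕ, ∀ i : Fin n, τ i = σ i :=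
  ⟨σ.viaFintypeEmbedding Fin.valEmbedding, fun i =>
    Equiv.Perm.viaFintypeEmbedding_apply_image σ Fin.valEmbedding i⟩

/-- A permutation of `[n]`, extended to `ℕ`, only relabels the atoms, and the sum over atoms is
invariant under reindexing. -/
theorem isExchangeable_sum_dirac {g : ℕ → Compo ℕ}
    (hg : ∀ (τ : Equiv.Perm ℕ) (i : ℕ), (g i).perm τ = g (τ i)) :
    IsExchangeable (Measure.sum fun i => Measure.dirac (g i)) := by
  intro n σ c
  obtain ⟨τ, hτ⟩ := exists_perm_extend σ
  have hτ' : ∀ i : Fin n, (τ.symm i : ℕ) = σ.symm i := fun i => by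
    rw [Equiv.symm_apply_eq, hτ, Equiv.apply_symm_apply]
  have hm : MeasurableSet {γ : Compo ℕ | (γ.restrict n).perm σ = c} :=
    measurableSet_comap_eq (fun i => (σ.symm i : ℕ)) c
  rw [Measure.sum_apply _ (measurableSet_restrict_eq c), Measure.sum_apply _ hm, ← τ.tsum_eq]
  refine tsum_congr fun i => ?_
  rw [Measure.dirac_apply' _ (measurableSet_restrict_eq c), Measure.dirac_apply' _ hm, ← hg]
  have : ((g i).perm τ).restrict n = ((g i).restrict n).perm σ := by
    simp only [Compo.restrict, Compo.perm, hτ']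
  by_cases hc : ((g i).restrict n).perm σ = c <;> simp [indicator, this, hc]

theorem perm_left (τ : Equiv.Perm ℕ) (i : ℕ) : (left i).perm τ = left (τ i) := by
  ext a b
  simp only [perm, left, Equiv.symm_apply_eq, ne_eq]

theorem perm_right (τ : Equiv.Perm ℕ) (i : ℕ) : (right i).perm τ = right (τ i) := by
  ext a b
  simp only [perm, right, Equiv.symm_apply_eq, ne_eq]

theorem isExchangeable_epsLeft : IsExchangeable epsLeft := isExchangeable_sum_dirac perm_left

theorem isExchangeable_epsRight : IsExchangeable epsRight := isExchangeable_sum_dirac perm_right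

/-! ### Compactness of the space of open sets, and measurability of asymptotic open sets -/

namespace OpenSub

open TopologicalSpace

instance : Inhabited OpenSub := ⟨full⟩

/-- The open set obtained by removing a compact set from `]0,1[`. -/
def ofCompact (K : NonemptyCompacts (Icc (0 : ℝ) 1)) : OpenSub where
  carrier := Ioo 0 1 \ (Subtype.val '' (K : Set (Icc (0 : ℝ) 1)))
  isOpen := isOpen_Ioo.sdiff (K.isCompact.image continuous_subtype_val).isClosed
  subset := sdiff_subset

/-- The two endpoints of `[0,1]`. -/
def endpoints : NonemptyCompacts (Icc (0 : ℝ) 1) :=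
  ⟨⟨{0, 1}, (Set.toFinite _).isCompact⟩, ⟨0, Or.inl rfl⟩⟩

/-- The endpoints always belong to the complement of `U`, even when `K` misses them, so they must be
adjoined to `K`. This turns the metric on open sets into a comparison with the Hausdorff metric. -/
theorem chi_ofCompact (K : NonemptyCompacts (Icc (0 : ℝ) 1)) (x : Icc (0 : ℝ) 1) :
    (ofCompact K).chi x =
      Metric.infDist x ((K ⊔ endpoints : NonemptyCompacts (Icc (0 : ℝ) 1)) : Set _) := by
  rw [← Metric.infDist_image (isometry_subtype_coe (s := Icc (0 : ℝ) 1))]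
  change Metric.infDist (x : ℝ) _ = _
  congr 1
  ext y
  simp only [ofCompact, NonemptyCompacts.coe_sup, image_union]
  constructor
  · rintro ⟨hy, hyU⟩
    by_cases hy' : y ∈ Ioo (0 : ℝ) 1
    · exact Or.inl (by_contra fun h => hyU ⟨hy', h⟩)
    · right
      rcases hy.1.eq_or_lt with h | h
      · exact ⟨0, Or.inl rfl, h⟩
      · refine ⟨1, Or.inr rfl, ?_⟩
        exact (hy.2.eq_or_lt.resolve_right fun h' => hy' ⟨h, h'⟩).symm
  · rintro (⟨z, hz, rfl⟩ | ⟨z, (rfl | rfl), rfl⟩)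
    · exact ⟨z.2, fun h => h.2 ⟨z, hz, rfl⟩⟩
    · exact ⟨⟨le_rfl, zero_le_one⟩, fun h => lt_irrefl _ h.1.1⟩
    · exact ⟨⟨zero_le_one, le_rfl⟩, fun h => lt_irrefl _ h.1.2⟩

theorem dist_def (U V : OpenSub) : dist U V = dist U.chi V.chi := rfl

/-- Both the distance to a set, as a function of the set, and the union with the endpoints are
1-Lipschitz for the Hausdorff metric. -/
theorem continuous_ofCompact : Continuous ofCompact := by
  have h : LipschitzWith 1 fun K : NonemptyCompacts (Icc (0 : ℝ) 1) => ofCompact K := by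
    refine LipschitzWith.of_dist_le_mul fun K K' => ?_
    rw [dist_def, NNReal.coe_one, one_mul]
    refine (ContinuousMap.dist_le dist_nonneg).2 fun x => ?_
    rw [chi_ofCompact, chi_ofCompact]
    have h1 := (Metric.lipschitz_infDist_set x).dist_le_mul (K ⊔ endpoints) (K' ⊔ endpoints)
    have h2 := (NonemptyCompacts.lipschitz_sup (α := Icc (0 : ℝ) 1)).dist_le_mul
      (K, endpoints) (K', endpoints)
    rw [NNReal.coe_one, one_mul] at h1 h2
    refine h1.trans (h2.trans ?_)
    simp [Prod.dist_eq]
  exact h.continuous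

theorem surjective_ofCompact : Function.Surjective ofCompact := by
  intro U
  have hcl : IsClosed (Subtype.val ⁻¹' U.carrierᶜ : Set (Icc (0 : ℝ) 1)) :=
    U.isOpen.isClosed_compl.preimage continuous_subtype_val
  refine ⟨⟨⟨_, hcl.isCompact⟩, ⟨0, fun h => lt_irrefl _ (U.subset h).1⟩⟩, ?_⟩
  ext y
  constructor
  · rintro ⟨hy, hyU⟩
    exact by_contra fun h => hyU ⟨⟨y, Ioo_subset_Icc_self hy⟩, h, rfl⟩
  · intro hy
    refine ⟨U.subset hy, ?_⟩
    rintro ⟨z, hz, rfl⟩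
    exact hz hy

instance : CompactSpace OpenSub :=
  ⟨by
    -- The hyperspace of non-empty compact subsets of `[0,1]` is compact, and so is its continuous
    -- image.
    rw [← surjective_ofCompact.range_eq]
    exact isCompact_range continuous_ofCompact⟩

end OpenSub

/-! ### Measurability of the asymptotic open set -/

theorem empiricalOpen_congr {γ γ' : Compo ℕ} {n : ℕ} (h : γ.restrict n = γ'.restrict n) :
    empiricalOpen γ n = empiricalOpen γ' n := by
  unfold empiricalOpen
  simp_rw [OpenSub.mk.injEq]
  rw [h]

theorem measurable_empiricalOpen (n : ℕ) : Measurable fun γ => empiricalOpen γ n := by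
  intro S _
  convert Compo.measurableSet_restrict_mem (n := n)
    ((Compo.restrict n) '' {γ | empiricalOpen γ n ∈ S}) using 1
  ext γ
  constructor
  · exact fun h => ⟨γ, h, rfl⟩
  · rintro ⟨γ', h, h'⟩
    change empiricalOpen γ n ∈ S
    rw [← empiricalOpen_congr h']
    exact h

/-- The asymptotic open set of a composition (with an arbitrary value where it does not exist). -/
def asymptoticOpen (γ : Compo ℕ) : OpenSub := limUnder atTop (empiricalOpen γ)

theorem IsAsymptoticOpenSet.asymptoticOpen_eq {γ : Compo ℕ} {U : OpenSub}
    (h : IsAsymptoticOpenSet γ U) : asymptoticOpen γ = U :=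
  Tendsto.limUnder_eq h

theorem measurable_asymptoticOpen : Measurable asymptoticOpen :=
  (StronglyMeasurable.limUnder fun n => (measurable_empiricalOpen n).stronglyMeasurable).measurable

theorem measurableSet_isAsymptoticOpenSet (U : OpenSub) :
    MeasurableSet {γ | IsAsymptoticOpenSet γ U} :=
  measurableSet_tendsto (𝓝 U) measurable_empiricalOpen

/-! ### Empirical frequencies and the law of large numbers -/

open Classical in
/-- The proportion of the integers of `[n]` satisfying `p`. -/
def freq (p : ℕ → Prop) (n : ℕ) : ℝ :=
  ((Finset.univ.filter fun i : Fin n => p i).card : ℝ) / n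

theorem freq_nonneg (p : ℕ → Prop) (n : ℕ) : 0 ≤ freq p n := by
  unfold freq
  positivity

theorem freq_le_one (p : ℕ → Prop) (n : ℕ) : freq p n ≤ 1 := by
  refine div_le_one_of_le₀ ?_ (Nat.cast_nonneg n)
  exact_mod_cast (Finset.card_le_univ _).trans_eq (Fintype.card_fin n)

theorem freq_mono {p q : ℕ → Prop} {n : ℕ} (h : ∀ i < n, p i → q i) : freq p n ≤ freq q n := by
  classical
  refine div_le_div_of_nonneg_right ?_ (Nat.cast_nonneg n)
  refine Nat.cast_le.2 (Finset.card_le_card fun i hi => ?_)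
  rw [Finset.mem_filter] at hi ⊢
  exact ⟨hi.1, h i i.2 hi.2⟩

theorem exists_of_freq_lt {p q : ℕ → Prop} {n : ℕ} (h : freq p n < freq q n) :
    ∃ i < n, q i ∧ ¬ p i := by
  by_contra! hc
  exact h.not_ge (freq_mono hc)

theorem freq_eq_sum (p : ℕ → Prop) (n : ℕ) :
    freq p n = (∑ i ∈ Finset.range n, {i | p i}.indicator (fun _ => (1 : ℝ)) i) / n := by
  classical
  unfold freq
  congr 1
  rw [← Fin.sum_univ_eq_sum_range (fun i => {i | p i}.indicator (fun _ => (1 : ℝ)) i),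
    Finset.card_filter, Nat.cast_sum]
  refine Finset.sum_congr rfl fun i _ => ?_
  by_cases h : p i <;> simp [h]

theorem uniformSeq_map_pair {i j : ℕ} (hij : i ≠ j) :
    uniformSeq.map (fun x => (x i, x j)) =
      (volume : Measure unitInterval).prod (volume : Measure unitInterval) :=
  Measure.infinitePi_map_eval_prod hij

theorem uniformSeq_map_eval (i : ℕ) :
    uniformSeq.map (fun x => x i) = (volume : Measure unitInterval) :=
  Measure.infinitePi_map_eval _ i

theorem ae_eval_of_ae {p : unitInterval → Prop} (h : ∀ᵐ u, p u) :
    ∀ᵐ x ∂uniformSeq, ∀ i, p (x i) := by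
  refine ae_all_iff.2 fun i => ?_
  have h' : ∀ᵐ u ∂(uniformSeq.map fun x => x i), p u := by rwa [uniformSeq_map_eval]
  exact ae_of_ae_map (measurable_pi_apply i).aemeasurable h'

theorem ae_injective_uniformSeq : ∀ᵐ x ∂uniformSeq, Function.Injective x := by
  have h : ∀ i j : ℕ, i ≠ j → ∀ᵐ x ∂uniformSeq, x i ≠ x j := by
    intro i j hij
    have h0 : ∀ᵐ p ∂(uniformSeq.map fun x => (x i, x j)), p.1 ≠ p.2 := by
      rw [uniformSeq_map_pair hij, Measure.ae_prod_iff_ae_ae]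
      · refine ae_of_all _ fun u => ?_
        have : ∀ᵐ v : unitInterval, v ≠ u := by
          simp [ae_iff]
        filter_upwards [this] with v hv using hv.symm
      · exact (measurableSet_eq_fun measurable_fst measurable_snd).compl
    exact ae_of_ae_map (f := fun x : ℕ → unitInterval => (x i, x j)) (by fun_prop) h0
  have h' : ∀ᵐ x ∂uniformSeq, ∀ i j, i ≠ j → x i ≠ x j :=
    ae_all_iff.2 fun i => ae_all_iff.2 fun j => by
      by_cases hij : i = j
      · simp [hij]
      · filter_upwards [h i j hij] with x hx _ using hx
  filter_upwards [h'] with x hx i j hij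
  exact by_contra fun hne => hx i j hne hij

/-- The law of large numbers for the empirical frequency of a set. -/
theorem ae_tendsto_freq {A : Set unitInterval} (hA : MeasurableSet A) :
    ∀ᵐ x ∂uniformSeq, Tendsto (freq fun i => x i ∈ A) atTop (𝓝 (volume.real A)) := by
  have hf : Measurable (A.indicator fun _ => (1 : ℝ)) := measurable_const.indicator hA
  have hint : ∀ i, ProbabilityTheory.IdentDistrib (fun x : ℕ → unitInterval => A.indicator (fun _ => (1 : ℝ)) (x i))
      (fun x => A.indicator (fun _ => (1 : ℝ)) (x 0)) uniformSeq uniformSeq := by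
    intro i
    have : ProbabilityTheory.IdentDistrib (fun x : ℕ → unitInterval => x i) (fun x => x 0)
        uniformSeq uniformSeq :=
      ⟨(measurable_pi_apply i).aemeasurable, (measurable_pi_apply 0).aemeasurable, by
        rw [uniformSeq_map_eval, uniformSeq_map_eval]⟩
    exact this.comp hf
  have hindep := ProbabilityTheory.iIndepFun_infinitePi
    (P := fun _ : ℕ => (volume : Measure unitInterval))
    (X := fun _ u => A.indicator (fun _ => (1 : ℝ)) u) fun _ => hf
  have h := ProbabilityTheory.strong_law_ae_real (μ := uniformSeq)
    (fun i x => A.indicator (fun _ => (1 : ℝ)) (x i)) ?_ (fun i j hij => hindep.indepFun hij) hint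
  · have hE : (∫ x, A.indicator (fun _ => (1 : ℝ)) (x 0) ∂uniformSeq) = volume.real A := by
      rw [← integral_map (μ := uniformSeq) (φ := fun x => x 0)
        (f := A.indicator fun _ => (1 : ℝ)) (measurable_pi_apply 0).aemeasurable hf.aestronglyMeasurable,
        uniformSeq_map_eval, integral_indicator_const _ hA, smul_eq_mul, mul_one]
    rw [hE] at h
    filter_upwards [h] with x hx
    convert hx using 1
    funext n
    rw [freq_eq_sum]
    rfl
  · refine Integrable.of_bound (C := 1)
      (hf.comp (measurable_pi_apply 0)).aestronglyMeasurable (ae_of_all _ fun x => ?_)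
    rw [indicator]
    split_ifs <;> simp

theorem volume_coe_mem {s : Set ℝ} (hs : s ⊆ Icc 0 1) (hm : MeasurableSet s) :
    volume {u : unitInterval | (u : ℝ) ∈ s} = volume s := by
  have h := unitInterval.measurePreserving_coe.measure_preimage hm.nullMeasurableSet
  rw [Measure.restrict_apply hm, inter_eq_left.2 hs] at h
  exact h

/-- Uniform convergence of the empirical distribution function (Glivenko–Cantelli). -/
theorem ae_eventually_abs_freq_sub_le {ε : ℝ} (hε : 0 < ε) :
    ∀ᵐ x ∂uniformSeq, ∀ᶠ n in atTop, ∀ t ∈ Icc (0 : ℝ) 1,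
      |freq (fun i => (x i : ℝ) ≤ t) n - t| ≤ ε ∧ |freq (fun i => (x i : ℝ) < t) n - t| ≤ ε := by
  -- A grid of mesh `1 / m`: one mesh is spent on the law of large numbers at the grid points, one
  -- on interpolating by monotonicity.
  obtain ⟨m, hm⟩ := exists_nat_gt (2 / ε)
  have hm0 : (0 : ℝ) < m := (by positivity : 0 < 2 / ε).trans hm
  have hmε : 2 / (m : ℝ) < ε := by rwa [div_lt_comm₀ hm0 hε]
  have h1 : ∀ᵐ x ∂uniformSeq, ∀ k : ℕ, k ≤ m →
      Tendsto (freq fun i => (x i : ℝ) ≤ (k / m : ℝ)) atTop (𝓝 (k / m : ℝ)) := by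
    refine ae_all_iff.2 fun k => ?_
    by_cases hk : k ≤ m
    · have hk1 : (k / m : ℝ) ∈ Icc (0 : ℝ) 1 :=
        ⟨by positivity, div_le_one_of_le₀ (by exact_mod_cast hk) hm0.le⟩
      filter_upwards [ae_tendsto_freq (measurableSet_Iic (a := (⟨k / m, hk1⟩ : unitInterval)))]
        with x hx _
      rw [Measure.real, unitInterval.volume_Iic, ENNReal.toReal_ofReal hk1.1] at hx
      exact hx
    · exact ae_of_all _ fun x h => absurd h hk
  filter_upwards [h1] with x hx
  have h2 : ∀ᶠ n in atTop, ∀ k ∈ Finset.range (m + 1),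
      |freq (fun i => (x i : ℝ) ≤ (k / m : ℝ)) n - k / m| < 1 / m := by
    rw [Filter.eventually_all_finset]
    intro k hk
    have := (hx k (by simpa [Nat.lt_succ_iff] using hk)).eventually
      (Metric.ball_mem_nhds _ (show (0 : ℝ) < 1 / m by positivity))
    filter_upwards [this] with n hn
    rwa [← Real.dist_eq]
  filter_upwards [h2] with n hn t ht
  have hup : ∀ t ∈ Icc (0 : ℝ) 1, freq (fun i => (x i : ℝ) ≤ t) n ≤ t + 2 / m := by
    intro t ht
    -- The first grid point at or above `t`.
    let k := ⌈t * m⌉₊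
    have hk : k ≤ m := Nat.ceil_le.2 (mul_le_of_le_one_left hm0.le ht.2)
    have hk1 : t * m ≤ k := Nat.le_ceil _
    have hk2 : (k : ℝ) < t * m + 1 := Nat.ceil_lt_add_one (mul_nonneg ht.1 hm0.le)
    have h3 := (abs_lt.1 (hn k (Finset.mem_range.2 (by omega)))).2
    have h4 : t ≤ k / m := (le_div_iff₀ hm0).2 hk1
    have h5 : (k / m : ℝ) < t + 1 / m := by
      rw [div_lt_iff₀ hm0, add_mul, div_mul_cancel₀ _ hm0.ne']
      exact hk2
    have h6 := freq_mono (n := n) (p := fun i => (x i : ℝ) ≤ t)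
      (q := fun i => (x i : ℝ) ≤ (k / m : ℝ)) fun i _ hi => hi.trans h4
    have : (2 / m : ℝ) = 1 / m + 1 / m := by ring
    linarith
  have hlow : ∀ t ∈ Icc (0 : ℝ) 1, t - 2 / m ≤ freq (fun i => (x i : ℝ) < t) n := by
    intro t ht
    rcases Nat.eq_zero_or_pos ⌈t * m⌉₊ with h0 | h0
    · have : t * m ≤ 0 := Nat.ceil_eq_zero.1 h0
      have h1 : t ≤ 0 := by nlinarith
      have h2 : (0 : ℝ) < 2 / m := by positivity
      linarith [freq_nonneg (fun i => (x i : ℝ) < t) n]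
    -- The last grid point strictly below `t`; strictness is needed because the lower bound is for
    -- the frequency of `x i < t`.
    · let k := ⌈t * m⌉₊ - 1
      have hks : (⌈t * m⌉₊ : ℝ) = k + 1 := by
        rw [← Nat.cast_succ, Nat.succ_eq_add_one, Nat.sub_add_cancel h0]
      have hk : ⌈t * m⌉₊ ≤ m := Nat.ceil_le.2 (mul_le_of_le_one_left hm0.le ht.2)
      have hk1 : t * m ≤ k + 1 := hks ▸ Nat.le_ceil _
      have hk2 : (k : ℝ) + 1 < t * m + 1 := hks ▸ Nat.ceil_lt_add_one (mul_nonneg ht.1 hm0.le)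
      have h3 := (abs_lt.1 (hn k (Finset.mem_range.2 (by omega)))).1
      have h4 : k / m < t := (div_lt_iff₀ hm0).2 (by linarith)
      have h5 : t - 1 / m ≤ (k / m : ℝ) := by
        rw [le_div_iff₀ hm0, sub_mul, div_mul_cancel₀ _ hm0.ne']
        linarith
      have h6 := freq_mono (n := n) (p := fun i => (x i : ℝ) ≤ (k / m : ℝ))
        (q := fun i => (x i : ℝ) < t) fun i _ hi => lt_of_le_of_lt hi h4
      have : (2 / m : ℝ) = 1 / m + 1 / m := by ring
      linarith
  -- The upper bound on the larger frequency and the lower bound on the smaller one control both.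
  have hle := freq_mono (n := n) (p := fun i => (x i : ℝ) < t)
    (q := fun i => (x i : ℝ) ≤ t) fun i _ hi => le_of_lt hi
  have h3 := hup t ht
  have h4 := hlow t ht
  constructor <;> rw [abs_le] <;> constructor <;> linarith

/-! ### Convergence of the empirical open sets of a paintbox -/

theorem paintbox_rel_iff {U : OpenSub} {x : ℕ → unitInterval} {i j : ℕ} :
    (paintbox U x).rel i j ↔ (x i : ℝ) ≤ x j ∨ uIcc (x i : ℝ) (x j) ⊆ U.carrier :=
  or_congr Iff.rfl (mem_connectedComponentIn_iff_uIcc _ _ _)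

theorem OpenSub.nonempty_sdiff (U : OpenSub) : (Icc (0 : ℝ) 1 \ U.carrier).Nonempty :=
  ⟨0, ⟨le_rfl, zero_le_one⟩, fun h => lt_irrefl _ (U.subset h).1⟩

/-- The hypotheses bound the Hausdorff distance of the complements, which in turn bounds the
difference of the distance functions `χ` uniformly. -/
theorem OpenSub.dist_le_of_forall {U V : OpenSub} {r : ℝ} (hr : 0 ≤ r)
    (h₁ : ∀ z ∈ Icc (0 : ℝ) 1 \ U.carrier, ∃ y ∈ Icc (0 : ℝ) 1 \ V.carrier, |z - y| ≤ r)
    (h₂ : ∀ y ∈ Icc (0 : ℝ) 1 \ V.carrier, ∃ z ∈ Icc (0 : ℝ) 1 \ U.carrier, |y - z| ≤ r) :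
    dist U V ≤ r := by
  rw [dist_def]
  refine (ContinuousMap.dist_le hr).2 fun x => ?_
  have hb : ∀ W : OpenSub, Bornology.IsBounded (Icc (0 : ℝ) 1 \ W.carrier) := fun W =>
    (Metric.isBounded_Icc 0 1).subset sdiff_subset
  have h := Metric.hausdorffDist_le_of_mem_dist hr h₁ h₂
  have h3 := Metric.infDist_le_infDist_add_hausdorffDist (x := (x : ℝ))
    (Metric.hausdorffEDist_ne_top_of_nonempty_of_bounded U.nonempty_sdiff V.nonempty_sdiff
      (hb U) (hb V))
  have h4 := Metric.infDist_le_infDist_add_hausdorffDist (x := (x : ℝ))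
    (Metric.hausdorffEDist_ne_top_of_nonempty_of_bounded V.nonempty_sdiff U.nonempty_sdiff
      (hb V) (hb U))
  rw [Metric.hausdorffDist_comm] at h4
  rw [Real.dist_eq]
  change |Metric.infDist (x : ℝ) (Icc 0 1 \ U.carrier) -
    Metric.infDist (x : ℝ) (Icc 0 1 \ V.carrier)| ≤ r
  rw [abs_le]
  constructor <;> linarith

theorem mem_empiricalOpen_iff {γ : Compo ℕ} {n : ℕ} {y : ℝ} :
    y ∈ (empiricalOpen γ n).carrier ↔
      ∃ j < n, freq (fun i => γ.Before i j) n < y ∧ y < freq (fun i => γ.rel i j) n := by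
  simp only [empiricalOpen, mem_iUnion]
  exact ⟨fun ⟨j, hj⟩ => ⟨j, j.2, hj⟩, fun ⟨j, hj, h⟩ => ⟨⟨j, hj⟩, h⟩⟩

/-- The empirical open set of a paintbox composition is as close to the open set as the empirical
distribution function is to the identity. -/
theorem dist_empiricalOpen_paintbox_le {U : OpenSub} {x : ℕ → unitInterval} {n : ℕ} {δ : ℝ}
    (hδ : 0 ≤ δ) (h : ∀ t ∈ Icc (0 : ℝ) 1, |freq (fun i => (x i : ℝ) ≤ t) n - t| ≤ δ ∧
      |freq (fun i => (x i : ℝ) < t) n - t| ≤ δ) :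
    dist (empiricalOpen (paintbox U x) n) U ≤ δ := by
  have hcl : IsClosed (Icc (0 : ℝ) 1 \ U.carrier) := isClosed_Icc.sdiff U.isOpen
  rw [dist_comm]
  refine OpenSub.dist_le_of_forall hδ ?_ ?_
  · rintro z ⟨hz, hzU⟩
    -- Since `z ∉ U`, no block has samples on both sides of `z`, so the empirical distribution
    -- function at `z` is a boundary between blocks.
    refine ⟨freq (fun i => (x i : ℝ) ≤ z) n, ⟨⟨freq_nonneg _ _, freq_le_one _ _⟩, ?_⟩, ?_⟩
    · rw [mem_empiricalOpen_iff]
      rintro ⟨j, -, h1, h2⟩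
      rcases le_or_gt (x j : ℝ) z with hj | hj
      · refine h2.not_ge (freq_mono fun i _ hi => ?_)
        rcases paintbox_rel_iff.1 hi with hi | hi
        · exact hi.trans hj
        · by_contra hc
          exact hzU (hi (mem_uIcc.2 (Or.inr ⟨hj, (not_le.1 hc).le⟩)))
      · refine h1.not_ge (freq_mono fun i _ hi => ⟨paintbox_rel_iff.2 (Or.inl ?_), fun hc => ?_⟩)
        · exact hi.trans hj.le
        · rcases paintbox_rel_iff.1 hc with hc | hc
          · exact absurd (hc.trans hi) (not_le.2 hj)
          · exact hzU (hc (mem_uIcc.2 (Or.inr ⟨hi, hj.le⟩)))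
    · rw [abs_sub_comm]
      exact (h z hz).1
  · rintro y ⟨hy, hyU⟩
    by_contra! hc
    -- `a` and `b` will be the points of the complement of `U` nearest to `y` on either side. If
    -- both are further than `δ`, the samples in `]a, b[ ⊆ U` belong to one block, whose empirical
    -- interval contains `y`.
    let A := (Icc (0 : ℝ) 1 \ U.carrier) ∩ Iic y
    let B := (Icc (0 : ℝ) 1 \ U.carrier) ∩ Ici y
    have hAne : A.Nonempty := ⟨0, ⟨⟨le_rfl, zero_le_one⟩, fun h => lt_irrefl _ (U.subset h).1⟩, hy.1⟩
    have hBne : B.Nonempty := ⟨1, ⟨⟨zero_le_one, le_rfl⟩, fun h => lt_irrefl _ (U.subset h).2⟩, hy.2⟩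
    have hAb : BddAbove A := ⟨y, fun z hz => hz.2⟩
    have hBb : BddBelow B := ⟨y, fun z hz => hz.2⟩
    obtain ⟨haK, hay⟩ := (hcl.inter isClosed_Iic).csSup_mem hAne hAb
    obtain ⟨hbK, hby⟩ := (hcl.inter isClosed_Ici).csInf_mem hBne hBb
    change sSup A ≤ y at hay
    change y ≤ sInf B at hby
    change sSup A ∈ _ at haK
    change sInf B ∈ _ at hbK
    set a := sSup A
    set b := sInf B
    have hya := hc a haK
    have hyb := hc b hbK
    rw [abs_of_nonneg (by linarith)] at hya
    rw [abs_sub_comm, abs_of_nonneg (by linarith)] at hyb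
    have hab : Ioo a b ⊆ U.carrier := by
      rintro z ⟨hz1, hz2⟩
      by_contra hzU
      have hzI : z ∈ Icc (0 : ℝ) 1 := ⟨haK.1.1.trans hz1.le, hz2.le.trans hbK.1.2⟩
      rcases le_total z y with hzy | hzy
      · exact hz1.not_ge (le_csSup hAb ⟨⟨hzI, hzU⟩, hzy⟩)
      · exact hz2.not_ge (csInf_le hBb ⟨⟨hzI, hzU⟩, hzy⟩)
    have hGa : freq (fun i => (x i : ℝ) ≤ a) n < y := by
      have := (abs_le.1 (h a haK.1).1).2
      linarith
    have hHb : y < freq (fun i => (x i : ℝ) < b) n := by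
      have := (abs_le.1 (h b hbK.1).2).1
      linarith
    -- A sample in `]a, b[`: it represents the block covering `y`.
    obtain ⟨j, hj, hjb, hja⟩ := exists_of_freq_lt (hGa.trans hHb)
    rw [not_le] at hja
    refine hyU (mem_empiricalOpen_iff.2 ⟨j, hj, ?_, ?_⟩)
    · refine lt_of_le_of_lt (freq_mono fun i _ hi => ?_) hGa
      by_contra hai
      rw [not_le] at hai
      refine hi.2 (paintbox_rel_iff.2 ?_)
      rcases le_total (x j : ℝ) (x i) with hji | hij
      · exact Or.inl hji
      · right
        rw [uIcc_of_ge hij]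
        exact fun z hz => hab ⟨hai.trans_le hz.1, hz.2.trans_lt hjb⟩
    · refine hHb.trans_le (freq_mono fun i _ hi => ?_)
      refine paintbox_rel_iff.2 ?_
      rcases le_total (x i : ℝ) (x j) with hij | hji
      · exact Or.inl hij
      · right
        rw [uIcc_of_ge hji]
        exact fun z hz => hab ⟨hja.trans_le hz.1, hz.2.trans_lt hi⟩

theorem ae_isAsymptoticOpenSet_paintbox (U : OpenSub) :
    ∀ᵐ x ∂uniformSeq, IsAsymptoticOpenSet (paintbox U x) U := by
  have h : ∀ᵐ x ∂uniformSeq, ∀ k : ℕ, ∀ᶠ n in atTop, ∀ t ∈ Icc (0 : ℝ) 1,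
      |freq (fun i => (x i : ℝ) ≤ t) n - t| ≤ 1 / (k + 1) ∧
        |freq (fun i => (x i : ℝ) < t) n - t| ≤ 1 / (k + 1) :=
    ae_all_iff.2 fun k => ae_eventually_abs_freq_sub_le (by positivity)
  filter_upwards [h] with x hx
  refine Metric.tendsto_atTop'.2 fun ε hε => ?_
  obtain ⟨k, hk⟩ := exists_nat_one_div_lt hε
  obtain ⟨N, hN⟩ := eventually_atTop.1 (hx k)
  exact ⟨N, fun n hn => (dist_empiricalOpen_paintbox_le (by positivity) (hN n hn.le)).trans_lt hk⟩

theorem measurable_paintbox (U : OpenSub) : Measurable (paintbox U) :=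
  measurable_paintbox_uncurry.comp measurable_prodMk_left

instance (U : OpenSub) : IsProbabilityMeasure (paintboxLaw U) :=
  Measure.isProbabilityMeasure_map (measurable_paintbox U).aemeasurable

theorem ae_isAsymptoticOpenSet_paintboxLaw (U : OpenSub) :
    ∀ᵐ γ ∂paintboxLaw U, IsAsymptoticOpenSet γ U :=
  (ae_map_iff (measurable_paintbox U).aemeasurable (measurableSet_isAsymptoticOpenSet U)).2
    (ae_isAsymptoticOpenSet_paintbox U)

theorem mixedLaw_apply (ν : Measure OpenSub) {S : Set (Compo ℕ)} (hS : MeasurableSet S) :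
    mixedLaw ν S = ∫⁻ U, paintboxLaw U S ∂ν :=
  Measure.bind_apply hS measurable_paintboxLaw.aemeasurable

/-- As `U_γ = U` almost surely under `P^U`, the mixing measure can be read off from the mixture.
Besides uniqueness, this gives a canonical choice of mixing measure, which is what makes
monotonicity pass to it. -/
theorem map_asymptoticOpen_mixedLaw (ν : Measure OpenSub) :
    (mixedLaw ν).map asymptoticOpen = ν := by
  ext S hS
  rw [Measure.map_apply measurable_asymptoticOpen hS,
    mixedLaw_apply _ (measurable_asymptoticOpen hS), ← lintegral_indicator_one hS]
  refine lintegral_congr fun U => ?_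
  have h : asymptoticOpen ⁻¹' S =ᵐ[paintboxLaw U] {_γ | U ∈ S} := by
    filter_upwards [ae_isAsymptoticOpenSet_paintboxLaw U] with γ hγ
    change (asymptoticOpen γ ∈ S) = (U ∈ S)
    rw [hγ.asymptoticOpen_eq]
  rw [measure_congr h]
  by_cases hU : U ∈ S <;> simp [hU]

/-! ### Continuity of the paintbox law in the open set -/

/-- The exceptional points are endpoints of components. Each is determined by a rational in the
adjacent gap and by its side, so there are countably many. -/
theorem ae_notMem_accessible (U : OpenSub) :
    ∀ᵐ u : unitInterval, (u : ℝ) ∉ U.carrier → ∀ v : ℝ, v ≠ u → ¬ uIoo v u ⊆ U.carrier := by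
  let E : ℚ → Set unitInterval := fun q => {u | (u : ℝ) ∉ U.carrier ∧ q < (u : ℝ) ∧
    Ioo (q : ℝ) u ⊆ U.carrier}
  let F : ℚ → Set unitInterval := fun q => {u | (u : ℝ) ∉ U.carrier ∧ (u : ℝ) < q ∧
    Ioo (u : ℝ) q ⊆ U.carrier}
  have hE : ∀ q, (E q).Subsingleton := by
    rintro q u ⟨hu, hqu, hu'⟩ v ⟨hv, hqv, hv'⟩
    apply Subtype.ext
    rcases lt_trichotomy (u : ℝ) v with h | h | h
    · exact absurd (hv' ⟨hqu, h⟩) hu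
    · exact h
    · exact absurd (hu' ⟨hqv, h⟩) hv
  have hF : ∀ q, (F q).Subsingleton := by
    rintro q u ⟨hu, hqu, hu'⟩ v ⟨hv, hqv, hv'⟩
    apply Subtype.ext
    rcases lt_trichotomy (u : ℝ) v with h | h | h
    · exact absurd (hu' ⟨h, hqv⟩) hv
    · exact h
    · exact absurd (hv' ⟨h, hqu⟩) hu
  have h : ∀ᵐ u : unitInterval, u ∉ ⋃ q, (E q ∪ F q) :=
    measure_eq_zero_iff_ae_notMem.1 (Countable.measure_zero
      (countable_iUnion fun q => ((hE q).countable.union (hF q).countable)) _)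
  filter_upwards [h] with u hu huU v hv hsub
  rcases lt_or_gt_of_ne hv with hvu | hvu
  · obtain ⟨q, hq1, hq2⟩ := exists_rat_btwn hvu
    rw [uIoo_of_lt hvu] at hsub
    exact hu (mem_iUnion.2 ⟨q, Or.inl ⟨huU, hq2, (Ioo_subset_Ioo_left hq1.le).trans hsub⟩⟩)
  · obtain ⟨q, hq1, hq2⟩ := exists_rat_btwn hvu
    rw [uIoo_of_gt hvu] at hsub
    exact hu (mem_iUnion.2 ⟨q, Or.inr ⟨huU, hq1, (Ioo_subset_Ioo_right hq2.le).trans hsub⟩⟩)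

/-- `χ_U(z) = 0`, so `χ_V(z)` is small for `V` near `U` and `V` misses a point close to `z`, which
is still between `a` and `b`. This fails when `z` is an endpoint of the segment. -/
theorem OpenSub.eventually_not_segment_subset {U : OpenSub} {a b z : ℝ} (hz : z ∈ Ioo a b)
    (ha : 0 ≤ a) (hb : b ≤ 1) (hzU : z ∉ U.carrier) :
    ∀ᶠ V in 𝓝 U, ¬ Icc a b ⊆ V.carrier := by
  have hz01 : z ∈ Icc (0 : ℝ) 1 := ⟨ha.trans hz.1.le, hz.2.le.trans hb⟩
  have hr : 0 < min (z - a) (b - z) := lt_min (sub_pos.2 hz.1) (sub_pos.2 hz.2)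
  filter_upwards [Metric.ball_mem_nhds U hr] with V hV hsub
  rw [Metric.mem_ball, dist_def] at hV
  have h1 := (ContinuousMap.dist_apply_le_dist (f := V.chi) (g := U.chi) ⟨z, hz01⟩).trans_lt hV
  have h2 : U.chi ⟨z, hz01⟩ = 0 := Metric.infDist_zero_of_mem ⟨hz01, hzU⟩
  rw [h2, Real.dist_eq, sub_zero] at h1
  have h3 : Metric.infDist z (Icc 0 1 \ V.carrier) < min (z - a) (b - z) :=
    (le_abs_self _).trans_lt h1
  obtain ⟨y, hy, hyz⟩ := (Metric.infDist_lt_iff V.nonempty_sdiff).1 h3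
  rw [Real.dist_eq, lt_min_iff, abs_lt, abs_lt] at hyz
  exact hy.2 (hsub ⟨by linarith [hyz.1.2], by linarith [hyz.2.1]⟩)

theorem ae_eventually_paintbox_rel_iff (U : OpenSub) :
    ∀ᵐ x ∂uniformSeq, ∀ i j, ∀ᶠ V in 𝓝 U,
      ((paintbox V x).rel i j ↔ (paintbox U x).rel i j) := by
  filter_upwards [ae_eval_of_ae (ae_notMem_accessible U)] with x hx i j
  simp only [paintbox_rel_iff]
  rcases le_or_gt (x i : ℝ) (x j) with hij | hij
  · simp [hij]
  simp only [not_le.2 hij, false_or]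
  by_cases h : uIcc (x i : ℝ) (x j) ⊆ U.carrier
  · have hc : Continuous fun V : OpenSub => (V, x i, x j) := by fun_prop
    filter_upwards [(isOpen_segment_subset.preimage hc).mem_nhds h] with V hV
    exact iff_of_true hV h
  -- A missed point exists in the closed segment. If it were only at an end, that sample would be an
  -- endpoint of a component, an excluded event.
  · have hz : ∃ z ∈ Ioo (x j : ℝ) (x i), z ∉ U.carrier := by
      by_contra! hc
      obtain ⟨w, hw, hwU⟩ := not_subset.1 h
      rw [uIcc_of_ge hij.le] at hw
      rcases hw.1.eq_or_lt with h1 | h1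
      · refine hx j (h1 ▸ hwU) (x i) hij.ne' ?_
        rw [uIoo_of_gt hij]
        exact hc
      rcases hw.2.eq_or_lt with h2 | h2
      · refine hx i (h2 ▸ hwU) (x j) hij.ne ?_
        rw [uIoo_of_lt hij]
        exact hc
      exact hwU (hc w ⟨h1, h2⟩)
    obtain ⟨z, hz, hzU⟩ := hz
    filter_upwards [OpenSub.eventually_not_segment_subset hz (x j).2.1 (x i).2.2 hzU] with V hV
    refine iff_of_false ?_ h
    rwa [uIcc_of_ge hij.le]

/-- Couple all the `P^V` by the same sample: the restrictions to `[n]` agree almost surely for `V`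
close enough to `U`, and dominated convergence concludes. -/
theorem continuous_paintboxLaw_cylinder {n : ℕ} (c : Compo (Fin n)) :
    Continuous fun U => paintboxLaw U {γ | γ.restrict n = c} := by
  refine continuous_iff_continuousAt.2 fun U => ?_
  have hm := Compo.measurableSet_restrict_eq c
  have h : ∀ V, paintboxLaw V {γ | γ.restrict n = c} =
      uniformSeq {x | (paintbox V x).restrict n = c} := fun V =>
    Measure.map_apply (measurable_paintbox V) hm
  simp only [ContinuousAt, h]
  refine tendsto_measure_of_ae_tendsto_indicator_of_isFiniteMeasure _ (measurable_paintbox U hm)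
    (fun V => measurable_paintbox V hm) ?_
  filter_upwards [ae_eventually_paintbox_rel_iff U] with x hx
  have h1 : ∀ᶠ V in 𝓝 U, ∀ i j : Fin n,
      ((paintbox V x).rel i j ↔ (paintbox U x).rel i j) :=
    Filter.eventually_all.2 fun i => Filter.eventually_all.2 fun j => hx i j
  filter_upwards [h1] with V hV
  have : (paintbox V x).restrict n = (paintbox U x).restrict n := by
    ext i j
    exact hV i j
  simp only [this]

/-! ### Sampling from a finite composition -/

/-- The index of the cell of the regular subdivision of `[0,1]` in `N + 1` intervals that
contains a point. -/
def cell (N : ℕ) (u : unitInterval) : Fin (N + 1) :=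
  -- The truncation at `N` puts `u = 1` in the last cell.
  ⟨min ⌊(N + 1 : ℝ) * u⌋₊ N, by omega⟩

theorem measurable_cell (N : ℕ) : Measurable (cell N) := by
  have h : Measurable fun u : unitInterval => ⌊(N + 1 : ℝ) * u⌋₊ := by fun_prop
  refine measurable_to_countable' fun p => ?_
  have : cell N ⁻¹' {p} = (fun u : unitInterval => ⌊(N + 1 : ℝ) * u⌋₊) ⁻¹'
      {k | min k N = p} := by
    ext u
    simp [cell, Fin.ext_iff]
  rw [this]
  exact h (by trivial)

theorem ae_cell_bounds (N : ℕ) :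
    ∀ᵐ u : unitInterval, (cell N u : ℝ) < (N + 1 : ℝ) * u ∧ (N + 1 : ℝ) * u < cell N u + 1 := by
  have h : ∀ᵐ u : unitInterval, ∀ k : ℕ, (N + 1 : ℝ) * u ≠ k := by
    refine ae_all_iff.2 fun k => ?_
    have hs : {u : unitInterval | (N + 1 : ℝ) * u = k}.Subsingleton := by
      intro u hu v hv
      have huv : (N + 1 : ℝ) * u = (N + 1 : ℝ) * v :=
        (show (N + 1 : ℝ) * u = k from hu).trans (show (N + 1 : ℝ) * v = k from hv).symm
      exact Subtype.ext (mul_left_cancel₀ (by positivity) huv)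
    exact measure_eq_zero_iff_ae_notMem.1 (hs.countable.measure_zero _)
  filter_upwards [h] with u hu
  have h0 : 0 ≤ (N + 1 : ℝ) * u := mul_nonneg (by positivity) u.2.1
  have h1 : (N + 1 : ℝ) * u < N + 1 := by
    refine lt_of_le_of_ne (mul_le_of_le_one_right (by positivity) u.2.2) ?_
    exact_mod_cast hu (N + 1)
  have h2 : ⌊(N + 1 : ℝ) * u⌋₊ < N + 1 := (Nat.floor_lt h0).2 (by exact_mod_cast h1)
  have h3 : (cell N u : ℕ) = ⌊(N + 1 : ℝ) * u⌋₊ := min_eq_left (by omega)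
  rw [h3]
  exact ⟨lt_of_le_of_ne (Nat.floor_le h0) (hu _).symm, Nat.lt_floor_add_one _⟩

theorem volume_cell (N : ℕ) (p : Fin (N + 1)) :
    (volume : Measure unitInterval).map (cell N) {p} = ENNReal.ofReal (1 / (N + 1)) := by
  have hN : (0 : ℝ) < N + 1 := by positivity
  have hp : (p : ℝ) + 1 ≤ N + 1 := by exact_mod_cast p.2
  rw [Measure.map_apply (measurable_cell N) (measurableSet_singleton p)]
  have h : cell N ⁻¹' {p} =ᵐ[volume]
      {u : unitInterval | (u : ℝ) ∈ Ioo (p / (N + 1) : ℝ) ((p + 1) / (N + 1))} := by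
    filter_upwards [ae_cell_bounds N] with u hu
    apply propext
    change cell N u = p ↔ (p / (N + 1) : ℝ) < u ∧ (u : ℝ) < (p + 1) / (N + 1)
    rw [div_lt_iff₀' hN, lt_div_iff₀' hN]
    constructor
    · rintro rfl
      exact hu
    · rintro ⟨h1, h2⟩
      have h3 : (cell N u : ℝ) < p + 1 := hu.1.trans h2
      have h4 : (p : ℝ) < cell N u + 1 := h1.trans hu.2
      norm_cast at h3 h4
      exact Fin.ext (by omega)
  rw [measure_congr h, volume_coe_mem _ measurableSet_Ioo, Real.volume_Ioo]
  · congr 1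
    ring
  · exact fun y hy => ⟨(by positivity : (0 : ℝ) ≤ p / (N + 1)).trans hy.1.le,
      hy.2.le.trans (div_le_one_of_le₀ hp hN.le)⟩

/-- The index of the cell is uniform, so permuting the indices leaves the law of the i.i.d. sequence
unchanged. -/
theorem map_perm_cell (N : ℕ) (σ : Equiv.Perm (Fin (N + 1))) :
    uniformSeq.map (fun x i => σ (cell N (x i))) = uniformSeq.map (fun x i => cell N (x i)) := by
  have h1 : Measurable fun u => σ (cell N u) := (measurable_of_finite σ).comp (measurable_cell N)
  have key : (volume : Measure unitInterval).map (fun u => σ (cell N u)) =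
      (volume : Measure unitInterval).map (cell N) := by
    refine Measure.ext_of_singleton fun p => ?_
    change volume.map (σ ∘ cell N) {p} = _
    rw [← Measure.map_map (measurable_of_finite σ) (measurable_cell N),
      Measure.map_apply (measurable_of_finite σ) (measurableSet_singleton p)]
    have : (σ ⁻¹' {p}) = {σ.symm p} := by
      ext q
      simp [Equiv.eq_symm_apply]
    rw [this, volume_cell, volume_cell]
  unfold uniformSeq
  rw [Measure.infinitePi_map_pi _ fun _ => h1, Measure.infinitePi_map_pi _ fun _ =>
    measurable_cell N, key]

open Classical in
/-- The blocks of a composition of `[M]`, listed in order, occupy successive intervals: there is a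
permutation `σ` such that the block of `σ p` covers the position `p`. -/
theorem exists_sorting_perm (γ : Compo ℕ) (M : ℕ) : ∃ σ : Equiv.Perm (Fin M), ∀ p,
    (Finset.univ.filter fun i : Fin M => γ.Before i (σ p)).card ≤ p ∧
      (p : ℕ) < (Finset.univ.filter fun i : Fin M => γ.rel i (σ p)).card := by
  let L : Fin M → ℕ := fun j => (Finset.univ.filter fun i : Fin M => γ.Before i j).card
  have hlt : ∀ i j : Fin M, γ.Before i j → L i < L j := by
    intro i j hij
    refine Finset.card_lt_card ⟨fun k hk => ?_, fun hc => ?_⟩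
    · simp only [Finset.mem_filter, Finset.mem_univ, true_and] at hk ⊢
      exact ⟨γ.trans _ _ _ hk.1 hij.1, fun h => hk.2 (γ.trans _ _ _ hij.1 h)⟩
    · have := hc (Finset.mem_filter.2 ⟨Finset.mem_univ i, hij⟩)
      exact (Finset.mem_filter.1 this).2.2 (γ.rel_refl i)
  -- Sorting by the number of strict predecessors lists the blocks in order, because this number
  -- increases strictly from a block to a later one.
  have hmono : Monotone (L ∘ Tuple.sort L) := Tuple.monotone_sort L
  refine ⟨Tuple.sort L, fun p => ⟨?_, ?_⟩⟩
  · calc _ ≤ (Finset.Iio p).card := ?_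
      _ = p := Fin.card_Iio p
    -- Strict predecessors of the element in position `p` all sit in positions `< p`.
    refine Finset.card_le_card_of_injOn (Tuple.sort L).symm (fun i hi => ?_)
      (Tuple.sort L).symm.injective.injOn
    rw [Finset.mem_coe, Finset.mem_Iio]
    by_contra hc
    have h1 := hmono (not_lt.1 hc)
    simp only [Function.comp_apply, Equiv.apply_symm_apply] at h1
    exact h1.not_gt (hlt i _ (Finset.mem_filter.1 hi).2)
  · have h0 : (p : ℕ) + 1 = (Finset.Iic p).card := (Fin.card_Iic p).symm
    rw [← Nat.succ_le_iff, Nat.succ_eq_add_one, h0]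
    -- Conversely, elements in positions `≤ p` are in the block of the element in position `p` or in
    -- an earlier one.
    refine Finset.card_le_card_of_injOn (Tuple.sort L) (fun q hq => ?_)
      (Tuple.sort L).injective.injOn
    rw [Finset.mem_coe, Finset.mem_filter]
    refine ⟨Finset.mem_univ _, ?_⟩
    by_contra hc
    have h1 := hmono (Finset.mem_Iic.1 hq)
    exact h1.not_gt (hlt _ _ ⟨(γ.total _ _).resolve_left hc, hc⟩)

theorem freq_rel_le_freq_before {γ : Compo ℕ} {a b : ℕ} (h : γ.Before a b) (n : ℕ) :
    freq (fun i => γ.rel i a) n ≤ freq (fun i => γ.Before i b) n :=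
  freq_mono fun _ _ hi =>
    ⟨γ.trans _ _ _ hi h.1, fun hb => h.2 (γ.trans _ _ _ hb hi)⟩

/-- When each `x i` falls inside the interval of the block of `g i`, comparing samples amounts to
comparing blocks: intervals of distinct blocks are disjoint and in the same order. -/
theorem paintbox_empiricalOpen {γ : Compo ℕ} {M : ℕ} {x : ℕ → unitInterval} {g : ℕ → Fin M}
    (hg : ∀ i, freq (fun k => γ.Before k (g i)) M < x i ∧
      (x i : ℝ) < freq (fun k => γ.rel k (g i)) M) :
    paintbox (empiricalOpen γ M) x = γ.comap fun i => (g i : ℕ) := by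
  ext i j
  rw [paintbox_rel_iff]
  change _ ↔ γ.rel (g i) (g j)
  constructor
  · intro h
    by_contra hc
    have hb : γ.Before (g j) (g i) := ⟨(γ.total _ _).resolve_left hc, hc⟩
    have h1 := freq_rel_le_freq_before hb M
    rcases h with h | h
    · linarith [(hg j).2, (hg i).1]
    -- The right end of the interval of the block of `g j` separates the two samples and is not in
    -- the open set.
    · have h2 : freq (fun k => γ.rel k (g j)) M ∈ uIcc (x i : ℝ) (x j) :=
        mem_uIcc.2 (Or.inr ⟨(hg j).2.le, h1.trans (hg i).1.le⟩)
      obtain ⟨k, -, hk1, hk2⟩ := mem_empiricalOpen_iff.1 (h h2)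
      by_cases hkj : γ.rel k (g j)
      · exact hk2.not_ge (freq_mono fun l _ hl => γ.trans _ _ _ hl hkj)
      · exact hk1.not_ge (freq_rel_le_freq_before ⟨(γ.total _ _).resolve_left hkj, hkj⟩ M)
  · intro h
    by_cases hji : γ.rel (g j) (g i)
    · right
      have h1 : freq (fun k => γ.Before k (g i)) M = freq (fun k => γ.Before k (g j)) M :=
        le_antisymm
          (freq_mono fun k _ hk => ⟨γ.trans _ _ _ hk.1 h, fun h' => hk.2 (γ.trans _ _ _ h h')⟩)
          (freq_mono fun k _ hk => ⟨γ.trans _ _ _ hk.1 hji, fun h' => hk.2 (γ.trans _ _ _ hji h')⟩)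
      have h2 : freq (fun k => γ.rel k (g i)) M = freq (fun k => γ.rel k (g j)) M :=
        le_antisymm (freq_mono fun k _ hk => γ.trans _ _ _ hk h)
          (freq_mono fun k _ hk => γ.trans _ _ _ hk hji)
      have hi := hg i
      rw [h1, h2] at hi
      intro y hy
      have hy' := (ordConnected_Ioo).uIcc_subset hi (hg j) hy
      exact mem_empiricalOpen_iff.2 ⟨g j, (g j).2, hy'.1, hy'.2⟩
    · left
      have h1 := freq_rel_le_freq_before (γ := γ) ⟨h, hji⟩ M
      linarith [(hg i).2, (hg j).1]

theorem measurable_comap_cell (γ : Compo ℕ) (N : ℕ) :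
    Measurable fun f : ℕ → Fin (N + 1) => γ.comap fun i => (f i : ℕ) := by
  refine measurable_compo_iff.2 fun i j => ?_
  have h : Measurable fun f : ℕ → Fin (N + 1) => (f i, f j) := by fun_prop
  exact h (Set.toFinite {p : Fin (N + 1) × Fin (N + 1) | γ.rel p.1 p.2}).measurableSet

/-- The paintbox law of an empirical open set is the law of the composition obtained by sampling
with replacement. -/
theorem paintboxLaw_empiricalOpen (γ : Compo ℕ) (N : ℕ) :
    paintboxLaw (empiricalOpen γ (N + 1)) =
      uniformSeq.map fun x => γ.comap fun i => (cell N (x i) : ℕ) := by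
  obtain ⟨σ, hσ⟩ := exists_sorting_perm γ (N + 1)
  have hm : Measurable fun (x : ℕ → unitInterval) i => cell N (x i) :=
    measurable_pi_lambda _ fun i => (measurable_cell N).comp (measurable_pi_apply i)
  have hmσ : Measurable fun (x : ℕ → unitInterval) i => σ (cell N (x i)) :=
    measurable_pi_lambda _ fun i =>
      (measurable_of_finite σ).comp ((measurable_cell N).comp (measurable_pi_apply i))
  have hN : (0 : ℝ) < ((N + 1 : ℕ) : ℝ) := by positivity
  calc paintboxLaw (empiricalOpen γ (N + 1))
      = uniformSeq.map fun x => γ.comap fun i => (σ (cell N (x i)) : ℕ) := by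
        refine Measure.map_congr ?_
        filter_upwards [ae_eval_of_ae (ae_cell_bounds N)] with x hx
        refine paintbox_empiricalOpen (g := fun i => σ (cell N (x i))) fun i => ?_
        obtain ⟨h1, h2⟩ := hσ (cell N (x i))
        obtain ⟨h3, h4⟩ := hx i
        constructor
        · refine (div_lt_iff₀ hN).2 ?_
          push_cast
          rw [mul_comm]
          exact lt_of_le_of_lt (by exact_mod_cast h1) h3
        · refine (lt_div_iff₀ hN).2 ?_
          push_cast
          rw [mul_comm]
          exact lt_of_lt_of_le h4 (by exact_mod_cast h2)
    _ = (uniformSeq.map fun x i => σ (cell N (x i))).map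
          fun f => γ.comap fun i => (f i : ℕ) := by
        rw [Measure.map_map (measurable_comap_cell γ N) hmσ]
        rfl
    _ = uniformSeq.map fun x => γ.comap fun i => (cell N (x i) : ℕ) := by
        -- The sorting permutation depends on `γ` only, not on the sample, so it can be dropped in
        -- law.
        rw [map_perm_cell, Measure.map_map (measurable_comap_cell γ N) hm]
        rfl

/-- A gap of more than two cells separates the integer parts by at least two, so they stay distinct
after truncation at `N`. -/
theorem cell_lt_cell {N : ℕ} {u v : unitInterval} (h : 2 < (N + 1 : ℝ) * (v - u)) :
    cell N u < cell N v := by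
  have hu : 0 ≤ (N + 1 : ℝ) * u := mul_nonneg (by positivity) u.2.1
  have h1 := Nat.floor_le hu
  have h2 := Nat.lt_floor_add_one ((N + 1 : ℝ) * v)
  have h3 : ⌊(N + 1 : ℝ) * u⌋₊ + 1 < ⌊(N + 1 : ℝ) * v⌋₊ := by
    have : ((⌊(N + 1 : ℝ) * u⌋₊ + 1 : ℕ) : ℝ) < (⌊(N + 1 : ℝ) * v⌋₊ : ℕ) := by
      push_cast
      nlinarith
    exact_mod_cast this
  have h4 : ⌊(N + 1 : ℝ) * v⌋₊ ≤ N + 1 := by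
    refine Nat.floor_le_of_le ?_
    push_cast
    exact mul_le_of_le_one_right (by positivity) v.2.2
  change min ⌊(N + 1 : ℝ) * u⌋₊ N < min ⌊(N + 1 : ℝ) * v⌋₊ N
  omega

theorem eventually_injective_cell {x : ℕ → unitInterval} (hx : Function.Injective x) (n : ℕ) :
    ∀ᶠ N in atTop, Function.Injective fun i : Fin n => (cell N (x i) : ℕ) := by
  have h : ∀ i j : Fin n, i ≠ j → ∀ᶠ N in atTop, cell N (x i) ≠ cell N (x j) := by
    intro i j hij
    have hne : (x i : ℝ) ≠ x j := fun h => hij (Fin.ext (hx (Subtype.ext h)))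
    have hpos : 0 < |(x i : ℝ) - x j| := abs_pos.2 (sub_ne_zero.2 hne)
    obtain ⟨N₀, hN₀⟩ := exists_nat_gt (2 / |(x i : ℝ) - x j|)
    filter_upwards [eventually_ge_atTop N₀] with N hN
    have h1 : 2 < (N + 1 : ℝ) * |(x i : ℝ) - x j| := by
      rw [← div_lt_iff₀ hpos]
      have : (N₀ : ℝ) ≤ N := by exact_mod_cast hN
      linarith
    rcases abs_cases ((x i : ℝ) - x j) with ⟨h2, -⟩ | ⟨h2, -⟩
    · rw [h2] at h1
      exact (cell_lt_cell h1).ne'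
    · rw [h2, neg_sub] at h1
      exact (cell_lt_cell h1).ne
  have h' : ∀ᶠ N in atTop, ∀ i j : Fin n, i ≠ j → cell N (x i) ≠ cell N (x j) :=
    Filter.eventually_all.2 fun i => Filter.eventually_all.2 fun j => by
      by_cases hij : i = j
      · simp [hij]
      · simpa [hij] using h i j hij
  filter_upwards [h'] with N hN i j hij
  exact by_contra fun hne => hN i j hne (Fin.ext hij)

/-! ### Exchangeable finite measures are mixtures of paintbox laws -/

/-- By Fubini, fix the sample and integrate over `γ` first. Once the cells of the first `n` samples
are distinct, exchangeability makes the inner mass exactly `m(γ_[n] = c)`; almost every sample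
eventually has distinct cells. -/
theorem tendsto_mixedLaw_empiricalOpen {m : Measure (Compo ℕ)} [IsFiniteMeasure m]
    (hm : IsExchangeable m) {n : ℕ} (c : Compo (Fin n)) :
    Tendsto (fun N => mixedLaw (m.map fun γ => empiricalOpen γ (N + 1)) {γ | γ.restrict n = c})
      atTop (𝓝 (m {γ | γ.restrict n = c})) := by
  have hc := Compo.measurableSet_restrict_eq c
  let S : ℕ → Set (Compo ℕ × (ℕ → unitInterval)) := fun N =>
    {p | p.1.comap (fun i : Fin n => (cell N (p.2 i) : ℕ)) = c}
  have hS : ∀ N, MeasurableSet (S N) := by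
    intro N
    have : S N = ⋃ g : Fin n → Fin (N + 1), {γ : Compo ℕ | γ.comap (fun i => (g i : ℕ)) = c} ×ˢ
        {x : ℕ → unitInterval | (fun i : Fin n => cell N (x i)) = g} := by
      ext ⟨γ, x⟩
      simp [S]
    rw [this]
    refine MeasurableSet.iUnion fun g => (Compo.measurableSet_comap_eq _ c).prod ?_
    have hg : Measurable fun (x : ℕ → unitInterval) (i : Fin n) => cell N (x i) :=
      measurable_pi_lambda _ fun i => (measurable_cell N).comp (measurable_pi_apply (i : ℕ))
    exact hg (measurableSet_singleton g)
  have h1 : ∀ N, mixedLaw (m.map fun γ => empiricalOpen γ (N + 1)) {γ | γ.restrict n = c} =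
      ∫⁻ x, m {γ | γ.comap (fun i : Fin n => (cell N (x i) : ℕ)) = c} ∂uniformSeq := by
    intro N
    rw [mixedLaw_apply _ hc, lintegral_map (f := fun U => paintboxLaw U {γ | γ.restrict n = c})
      ((Measure.measurable_coe hc).comp measurable_paintboxLaw) (measurable_empiricalOpen _)]
    have h2 := Measure.prod_apply (μ := m) (ν := uniformSeq) (hS N)
    rw [Measure.prod_apply_symm (hS N)] at h2
    refine Eq.trans (lintegral_congr fun γ => ?_) h2.symm
    rw [paintboxLaw_empiricalOpen, Measure.map_apply _ hc]
    · rfl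
    · have hmx : Measurable fun (x : ℕ → unitInterval) i => cell N (x i) :=
        measurable_pi_lambda _ fun i => (measurable_cell N).comp (measurable_pi_apply i)
      exact (measurable_comap_cell γ N).comp hmx
  simp only [h1]
  have h3 : m {γ | γ.restrict n = c} = ∫⁻ _x, m {γ | γ.restrict n = c} ∂uniformSeq := by simp
  rw [h3]
  refine tendsto_lintegral_of_dominated_convergence (fun _ => m univ)
    (fun N => measurable_measure_prodMk_right (hS N))
    (fun N => ae_of_all _ fun x => measure_mono (subset_univ _)) (by simp) ?_
  filter_upwards [ae_injective_uniformSeq] with x hx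
  refine tendsto_const_nhds.congr' ?_
  filter_upwards [eventually_injective_cell hx n] with N hN
  exact (hm.measure_comap_mem hN {c}).symm

/-- A finite exchangeable measure on compositions is a mixture of paintbox laws. -/
theorem IsExchangeable.exists_eq_mixedLaw {m : Measure (Compo ℕ)} [IsFiniteMeasure m]
    (hm : IsExchangeable m) : ∃ ν : Measure OpenSub, IsFiniteMeasure ν ∧ m = mixedLaw ν := by
  let ν : ℕ → FiniteMeasure OpenSub := fun N =>
    ⟨m.map fun γ => empiricalOpen γ (N + 1), inferInstance⟩
  have hmass : ∀ N, (ν N).mass = (m univ).toNNReal := by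
    intro N
    change ((m.map fun γ => empiricalOpen γ (N + 1)) univ).toNNReal = _
    rw [Measure.map_apply (measurable_empiricalOpen _) MeasurableSet.univ, preimage_univ]
  -- The measures `ν N` have constant mass on a compact space, so they converge along an
  -- ultrafilter, with no subsequence to extract.
  let F : Ultrafilter ℕ := Ultrafilter.of atTop
  obtain ⟨ν', hν', hlim⟩ := (isCompact_setOfPred_finiteMeasure_eq_of_compactSpace OpenSub
    (m univ).toNNReal).ultrafilter_le_nhds (F.map ν) (by
      rw [le_principal_iff]
      exact Filter.Eventually.of_forall (f := (F : Filter ℕ)) hmass)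
  refine ⟨ν', inferInstance, ?_⟩
  have hfin : IsFiniteMeasure (mixedLaw (ν' : Measure OpenSub)) := by
    refine ⟨?_⟩
    rw [mixedLaw_apply _ MeasurableSet.univ]
    simp
  refine Compo.measure_ext_of_isFiniteMeasure fun n c => ?_
  have h1 := (tendsto_mixedLaw_empiricalOpen hm c).mono_left (Ultrafilter.of_le atTop)
  refine tendsto_nhds_unique h1 ?_
  let f : C(OpenSub, ℝ≥0) := ⟨fun U => (paintboxLaw U {γ | γ.restrict n = c}).toNNReal,
    continuous_iff_continuousAt.2 fun U => (ENNReal.tendsto_toNNReal (measure_ne_top _ _)).comp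
      (continuous_paintboxLaw_cylinder c).continuousAt⟩
  have hf : ∀ U, (f U : ℝ≥0∞) = paintboxLaw U {γ | γ.restrict n = c} := fun U =>
    ENNReal.coe_toNNReal (measure_ne_top _ _)
  have h2 := ((FiniteMeasure.continuous_lintegral_continuousMap f).tendsto ν').comp
    (show Tendsto ν F (𝓝 ν') from hlim)
  simp only [hf] at h2
  rw [mixedLaw_apply _ (Compo.measurableSet_restrict_eq c)]
  refine h2.congr fun N => ?_
  rw [mixedLaw_apply _ (Compo.measurableSet_restrict_eq c)]
  rfl

/-! ### The dislocation part of a fragmentation measure -/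

/-- The limit is the sum of the successive increments; finiteness of each `m k` lets the subtraction
be undone. -/
theorem exists_measure_tendsto_lintegral {α : Type*} [MeasurableSpace α] {m : ℕ → Measure α}
    [∀ k, IsFiniteMeasure (m k)] (hm : Monotone m) :
    ∃ m' : Measure α, ∀ f : α → ℝ≥0∞,
      Tendsto (fun k => ∫⁻ a, f a ∂m k) atTop (𝓝 (∫⁻ a, f a ∂m')) := by
  let D : ℕ → Measure α := fun k => Nat.casesOn k (m 0) fun k => m (k + 1) - m k
  have hD : ∀ k, ∑ i ∈ Finset.range (k + 1), D i = m k := by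
    intro k
    induction k with
    | zero => simp [D]
    | succ k ih =>
      rw [Finset.sum_range_succ, ih, add_comm]
      exact Measure.sub_add_cancel_of_le (hm k.le_succ)
  refine ⟨Measure.sum D, fun f => ?_⟩
  rw [lintegral_sum_measure]
  refine ((ENNReal.tendsto_nat_tsum _).comp (tendsto_add_atTop_nat 1)).congr fun k => ?_
  rw [← hD k, lintegral_finsetSum_measure]
  rfl

/-- The event that the restriction to `[k]` is non-trivial. -/
def nontrivialOn (k : ℕ) : Set (Compo ℕ) := {γ | γ.restrict k ≠ one (Fin k)}

theorem measurableSet_nontrivialOn (k : ℕ) : MeasurableSet (nontrivialOn k) :=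
  measurableSet_restrict_mem {c | c ≠ one (Fin k)}

theorem nontrivialOn_mono : Monotone nontrivialOn := by
  intro k l hkl γ hγ h
  refine hγ ?_
  rw [restrict_eq_one_iff] at h ⊢
  exact fun i hi j hj => h i (by omega) j (by omega)

/-- The composition induced on the integers `≥ k`, relabelled by `ℕ`. -/
def Compo.shift (k : ℕ) : Compo ℕ → Compo ℕ := Compo.comap (· + k)

theorem measurable_shift (k : ℕ) : Measurable (shift k) := measurable_comap _

/-- For an exchangeable measure, the joint law of the pullbacks along two injections with disjoint
ranges does not depend on the injections. -/
theorem IsExchangeable.measure_comap_pair {μ : Measure (Compo ℕ)} (hμ : IsExchangeable μ)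
    {k n : ℕ} {f f' : Fin k → ℕ} {g g' : Fin n → ℕ} (hf : Function.Injective (Fin.append f g))
    (hf' : Function.Injective (Fin.append f' g')) (S : Set (Compo (Fin k)))
    (T : Set (Compo (Fin n))) :
    μ {γ | γ.comap f ∈ S ∧ γ.comap g ∈ T} = μ {γ | γ.comap f' ∈ S ∧ γ.comap g' ∈ T} := by
  let R : Set (Compo (Fin (k + n))) :=
    {d | d.comap (Fin.castAdd n) ∈ S ∧ d.comap (Fin.natAdd k) ∈ T}
  have key : ∀ (f : Fin k → ℕ) (g : Fin n → ℕ),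
      {γ : Compo ℕ | γ.comap f ∈ S ∧ γ.comap g ∈ T} = {γ | γ.comap (Fin.append f g) ∈ R} := by
    intro f g
    ext γ
    have h1 : (γ.comap (Fin.append f g)).comap (Fin.castAdd n) = γ.comap f := by
      simp only [Compo.comap, Fin.append_left]
    have h2 : (γ.comap (Fin.append f g)).comap (Fin.natAdd k) = γ.comap g := by
      simp only [Compo.comap, Fin.append_right]
    simp only [R, mem_ofPred_eq, h1, h2]
  rw [key, key, hμ.measure_comap_mem hf, hμ.measure_comap_mem hf']

theorem measure_inter_nontrivialOn {μ : Measure (Compo ℕ)} {k n : ℕ} {g : Fin n → ℕ}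
    (c : Compo (Fin n)) :
    μ.restrict (nontrivialOn k) {γ | γ.comap g = c} =
      μ {γ | γ.comap (Fin.val : Fin k → ℕ) ∈ {d | d ≠ one (Fin k)} ∧ γ.comap g ∈ ({c} : Set _)} := by
  rw [Measure.restrict_apply (measurableSet_comap_eq g c), inter_comm]
  rfl

theorem IsFragmentationMeasure.isFiniteMeasure_restrict {μ : Measure (Compo ℕ)}
    (hμ : IsFragmentationMeasure μ) (k : ℕ) : IsFiniteMeasure (μ.restrict (nontrivialOn k)) :=
  ⟨by
    rw [Measure.restrict_apply_univ]
    exact hμ.finite k⟩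

theorem append_val_injective {k n : ℕ} {g : Fin n → ℕ} (hg : Function.Injective g)
    (hk : ∀ i, k ≤ g i) : Function.Injective (Fin.append (Fin.val : Fin k → ℕ) g) :=
  Fin.append_injective_iff.2 ⟨Fin.val_injective, hg, fun i j => by have := hk j; omega⟩

/-- Non-triviality on `[k]` involves only integers `< k`, so it is unaffected by permuting the
integers from `k` on. -/
theorem isExchangeable_shift {μ : Measure (Compo ℕ)} (hμ : IsExchangeable μ) (k : ℕ) :
    IsExchangeable ((μ.restrict (nontrivialOn k)).map (shift k)) := by
  intro n σ c
  have h1 : MeasurableSet {γ : Compo ℕ | (γ.restrict n).perm σ = c} :=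
    measurableSet_comap_eq (fun i => (σ.symm i : ℕ)) c
  rw [Measure.map_apply (measurable_shift k) (measurableSet_restrict_eq c),
    Measure.map_apply (measurable_shift k) h1]
  change μ.restrict (nontrivialOn k) {γ | γ.comap (fun i : Fin n => (i : ℕ) + k) = c} =
    μ.restrict (nontrivialOn k) {γ | γ.comap (fun i : Fin n => (σ.symm i : ℕ) + k) = c}
  rw [measure_inter_nontrivialOn, measure_inter_nontrivialOn]
  refine hμ.measure_comap_pair (append_val_injective ?_ ?_) (append_val_injective ?_ ?_) _ _
  · exact fun i j h => Fin.ext (by simpa using h)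
  · exact fun i => Nat.le_add_left _ _
  · exact fun i j h => σ.symm.injective (Fin.ext (by simpa using h))
  · exact fun i => Nat.le_add_left _ _

/-- On the event that `[k]` is cut, forgetting `k` or `k + 1` integers gives the same law by
exchangeability. Going to `k + 1` then only enlarges the event. -/
theorem monotone_map_shift {μ : Measure (Compo ℕ)} (hμ : IsFragmentationMeasure μ) :
    Monotone fun k => (μ.restrict (nontrivialOn k)).map (shift k) := by
  refine monotone_nat_of_le_succ fun k => ?_
  have hfin := hμ.isFiniteMeasure_restrict k
  have h : (μ.restrict (nontrivialOn k)).map (shift k) =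
      (μ.restrict (nontrivialOn k)).map (shift (k + 1)) := by
    refine measure_ext_of_isFiniteMeasure fun n c => ?_
    rw [Measure.map_apply (measurable_shift _) (measurableSet_restrict_eq c),
      Measure.map_apply (measurable_shift _) (measurableSet_restrict_eq c)]
    change μ.restrict (nontrivialOn k) {γ | γ.comap (fun i : Fin n => (i : ℕ) + k) = c} =
      μ.restrict (nontrivialOn k) {γ | γ.comap (fun i : Fin n => (i : ℕ) + (k + 1)) = c}
    rw [measure_inter_nontrivialOn, measure_inter_nontrivialOn]
    refine hμ.exchangeable.measure_comap_pair (append_val_injective ?_ ?_)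
      (append_val_injective ?_ ?_) _ _
    · exact fun i j h => Fin.ext (by simpa using h)
    · exact fun i => Nat.le_add_left _ _
    · exact fun i j h => Fin.ext (by simpa using h)
    · exact fun i => by omega
  rw [h]
  exact Measure.map_mono (Measure.restrict_mono (nontrivialOn_mono k.le_succ) le_rfl)
    (measurable_shift _)

theorem ae_paintboxLaw_full : ∀ᵐ γ ∂paintboxLaw OpenSub.full, γ = one ℕ := by
  refine (ae_map_iff (measurable_paintbox _).aemeasurable measurableSet_singleton_one).2 ?_
  have h : ∀ᵐ u : unitInterval, (u : ℝ) ∈ Ioo (0 : ℝ) 1 := by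
    have h0 : ∀ᵐ u : unitInterval, u ≠ 0 := by simp [ae_iff]
    have h1 : ∀ᵐ u : unitInterval, u ≠ 1 := by simp [ae_iff]
    filter_upwards [h0, h1] with u hu0 hu1
    exact ⟨unitInterval.pos_iff_ne_zero.2 hu0, unitInterval.lt_one_iff_ne_one.2 hu1⟩
  filter_upwards [ae_eval_of_ae h] with x hx
  exact eq_one_iff.2 fun i j => paintbox_rel_iff.2
    (Or.inr (ordConnected_Ioo.uIcc_subset (hx i) (hx j)))

/-- `P^U` for the full interval is the point mass at the trivial composition, so an atom of `ν`
there is invisible on non-trivial cylinders and may be removed. -/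
theorem mixedLaw_restrict_ne_full (ν : Measure OpenSub) {n : ℕ} {c : Compo (Fin n)}
    (hc : c ≠ one (Fin n)) :
    mixedLaw (ν.restrict {OpenSub.full}ᶜ) {γ | γ.restrict n = c} =
      mixedLaw ν {γ | γ.restrict n = c} := by
  have hm := measurableSet_restrict_eq c
  rw [mixedLaw_apply _ hm, mixedLaw_apply _ hm, ← lintegral_indicator
    (measurableSet_singleton _).compl]
  refine lintegral_congr fun U => ?_
  by_cases hU : U = OpenSub.full
  · rw [indicator_of_notMem (by simp [hU]), hU]
    symm
    rw [measure_eq_zero_iff_ae_notMem]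
    filter_upwards [ae_paintboxLaw_full] with γ hγ h
    exact hc (by rw [← h, hγ]; rfl)
  · rw [indicator_of_mem hU]

/-- The marginals of a fragmentation measure are those of a mixture of paintbox laws, up to the
contribution of the compositions with at most finitely many elements outside one block. -/
theorem IsFragmentationMeasure.exists_mixedLaw_add {μ : Measure (Compo ℕ)}
    (hμ : IsFragmentationMeasure μ) :
    ∃ ν : Measure OpenSub, ν {OpenSub.full} = 0 ∧
      ∀ (n : ℕ) (c : Compo (Fin n)), c ≠ one (Fin n) →
        μ {γ | γ.restrict n = c} = mixedLaw ν {γ | γ.restrict n = c} +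
          μ {γ | γ.restrict n = c ∧ γ.shift n = one ℕ} := by
  have hfin := hμ.isFiniteMeasure_restrict
  let p : ℕ → Measure (Compo ℕ) := fun k => (μ.restrict (nontrivialOn k)).map (shift k)
  -- Defining the mixing measure as the law of the asymptotic open set makes it monotone in `k`,
  -- since images of measures are.
  let ν : ℕ → Measure OpenSub := fun k => (p k).map asymptoticOpen
  have hν : ∀ k, p k = mixedLaw (ν k) := by
    intro k
    obtain ⟨ν', -, h⟩ := (isExchangeable_shift hμ.exchangeable k).exists_eq_mixedLaw
    have h' : ν k = ν' := by
      change (p k).map asymptoticOpen = ν'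
      rw [show p k = mixedLaw ν' from h, map_asymptoticOpen_mixedLaw]
    rw [h']
    exact h
  have hmono : Monotone ν := fun k l hkl =>
    Measure.map_mono (monotone_map_shift hμ hkl) measurable_asymptoticOpen
  obtain ⟨ν', hν'⟩ := exists_measure_tendsto_lintegral hmono
  refine ⟨ν'.restrict {OpenSub.full}ᶜ, ?_, fun n c hc => ?_⟩
  · rw [Measure.restrict_apply (measurableSet_singleton _)]
    simp
  have hm := measurableSet_restrict_eq c
  rw [mixedLaw_restrict_ne_full _ hc]
  have h1 : Tendsto (fun k => p k {γ | γ.restrict n = c}) atTop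
      (𝓝 (mixedLaw ν' {γ | γ.restrict n = c})) := by
    rw [mixedLaw_apply _ hm]
    refine (hν' _).congr fun k => ?_
    rw [hν k, mixedLaw_apply _ hm]
  have hcfin : μ {γ | γ.restrict n = c} ≠ ∞ := by
    refine ((measure_mono ?_).trans_lt (hμ.finite n)).ne
    rintro γ rfl
    exact hc
  have hval : Function.Injective (Fin.val : Fin n → ℕ) := Fin.val_injective
  let B : ℕ → Set (Compo ℕ) := fun k =>
    {γ | γ.restrict n = c ∧ (γ.shift n).restrict k = one (Fin k)}
  -- Move the window `[n]` to `k, …, k + n - 1` and split according to whether `[k]` is cut.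
  have h2 : ∀ k, μ {γ | γ.restrict n = c} = p k {γ | γ.restrict n = c} + μ (B k) := by
    intro k
    have h3 := hμ.exchangeable.measure_comap_mem (f := fun i : Fin n => (i : ℕ) + k)
      (fun i j h => Fin.ext (by simpa using h)) {c}
    change μ {γ | γ.comap (fun i : Fin n => (i : ℕ) + k) = c} = μ {γ | γ.restrict n = c} at h3
    rw [← h3, ← measure_inter_add_sdiff _ (measurableSet_nontrivialOn k)]
    congr 1
    · change _ = (μ.restrict (nontrivialOn k)).map (shift k) {γ | γ.restrict n = c}
      rw [Measure.map_apply (measurable_shift k) hm, Measure.restrict_apply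
        (measurable_shift k hm)]
      rfl
    -- When `[k]` is not cut, exchange the roles: the window returns to `[n]` and the uncut block of
    -- `k` integers goes right after it.
    · have h4 := hμ.exchangeable.measure_comap_pair
        (f := (Fin.val : Fin k → ℕ)) (g := fun i : Fin n => (i : ℕ) + k)
        (f' := fun i : Fin k => (i : ℕ) + n) (g' := (Fin.val : Fin n → ℕ))
        (append_val_injective (fun i j h => Fin.ext (by simpa using h))
          fun i => Nat.le_add_left _ _)
        (Fin.append_injective_iff.2 ⟨fun i j h => Fin.ext (by simpa using h), Fin.val_injective,
          fun i j => by omega⟩) {one (Fin k)} {c}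
      convert h4 using 2
      · ext γ
        change (_ ∧ ¬ _) ↔ _
        simp only [nontrivialOn, mem_ofPred_eq, mem_singleton_iff, not_not]
        exact and_comm
      · ext γ
        exact and_comm
  have h5 : Tendsto (fun k => μ (B k)) atTop
      (𝓝 (μ {γ | γ.restrict n = c ∧ γ.shift n = one ℕ})) := by
    have h6 : {γ : Compo ℕ | γ.restrict n = c ∧ γ.shift n = one ℕ} = ⋂ k, B k := by
      ext γ
      simp only [B, mem_iInter, mem_ofPred_eq, eq_one_iff_restrict (γ := γ.shift n)]
      exact ⟨fun h k => ⟨h.1, h.2 k⟩, fun h => ⟨(h 0).1, fun k => (h k).2⟩⟩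
    rw [h6]
    refine tendsto_measure_iInter_atTop (fun k => ?_) ?_ ⟨0, ?_⟩
    · exact (hm.inter (measurable_shift n (measurableSet_restrict_eq _))).nullMeasurableSet
    · intro k l hkl γ hγ
      refine ⟨hγ.1, ?_⟩
      have := hγ.2
      rw [restrict_eq_one_iff] at this ⊢
      exact fun i hi j hj => this i (by omega) j (by omega)
    · exact ((measure_mono fun γ hγ => hγ.1).trans_lt hcfin.lt_top).ne
  have h7 := h1.add h5
  simp only [← h2] at h7
  exact tendsto_nhds_unique tendsto_const_nhds h7

/-! ### The erosion part of a fragmentation measure -/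

theorem measurableSet_singleton_compo (γ : Compo ℕ) : MeasurableSet {γ} := by
  have : ({γ} : Set (Compo ℕ)) = ⋂ n, {γ' | γ'.restrict n = γ.restrict n} := by
    ext γ'
    simp only [mem_singleton_iff, mem_iInter, mem_ofPred_eq]
    refine ⟨fun h n => by rw [h], fun h => ?_⟩
    ext i j
    have h1 := congrArg Compo.rel (h (i + j + 1))
    exact iff_of_eq (congrFun (congrFun h1 ⟨i, by omega⟩) ⟨j, by omega⟩)
  rw [this]
  exact MeasurableSet.iInter fun n => measurableSet_restrict_eq _

instance : MeasurableSingletonClass (Compo ℕ) := ⟨measurableSet_singleton_compo⟩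

theorem IsFragmentationMeasure.measure_cylinder_ne_top {μ : Measure (Compo ℕ)}
    (hμ : IsFragmentationMeasure μ) {n : ℕ} {c : Compo (Fin n)} (hc : c ≠ one (Fin n)) :
    μ {γ | γ.restrict n = c} ≠ ∞ := by
  refine ((measure_mono ?_).trans_lt (hμ.finite n)).ne
  rintro γ rfl
  exact hc

theorem comap_perm_eq_iff (τ : Equiv.Perm ℕ) {γ γ' : Compo ℕ} :
    γ.comap τ = γ' ↔ γ = γ'.perm τ := by
  constructor
  · rintro rfl
    simp [Compo.comap, Compo.perm]
  · rintro rfl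
    simp [Compo.comap, Compo.perm]

/-- A permutation of `ℕ` need not preserve `[n]`, but its restriction to `[n]` is an injection, so
exchangeability still gives invariance on cylinders. The trivial composition is fixed and null. -/
theorem IsFragmentationMeasure.measure_singleton_perm {μ : Measure (Compo ℕ)}
    (hμ : IsFragmentationMeasure μ) (τ : Equiv.Perm ℕ) (γ : Compo ℕ) :
    μ {γ.perm τ} = μ {γ} := by
  have hpre : ∀ γ : Compo ℕ, Compo.comap τ ⁻¹' {γ} = {γ.perm τ} := by
    intro γ
    ext γ'
    exact comap_perm_eq_iff τ
  have h : μ.map (Compo.comap τ) = μ := by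
    symm
    refine measure_ext (fun n c hc => hμ.measure_cylinder_ne_top hc) (fun n c hc => ?_) ?_ ?_
    · rw [Measure.map_apply (measurable_comap τ) (measurableSet_restrict_eq c)]
      exact (hμ.exchangeable.measure_comap_mem (f := fun i : Fin n => τ i)
        (fun i j h => Fin.ext (τ.injective h)) {c}).symm
    · simp [hμ.one_eq_zero]
    · rw [Measure.map_apply (measurable_comap τ) (measurableSet_singleton _), hpre]
      rfl
  conv_rhs => rw [← h]
  rw [Measure.map_apply (measurable_comap τ) (measurableSet_singleton _), hpre]

theorem left_injective : Function.Injective left := by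
  intro i j h
  by_contra hij
  have h1 : ∀ a, a = i := fun a => by
    have h2 : (left i).rel a i := by
      rw [h]
      exact Or.inr hij
    exact h2.resolve_right fun hc => hc rfl
  exact hij (h1 j).symm

theorem right_injective : Function.Injective right := by
  intro i j h
  by_contra hij
  have h1 : ∀ a, a = i := fun a => by
    have h2 : (right i).rel i a := by
      rw [h]
      exact Or.inr hij
    exact h2.resolve_right fun hc => hc rfl
  exact hij (h1 j).symm

theorem left_ne_right (i j : ℕ) : left i ≠ right j := by
  intro h
  have h1 : (left i).rel (i + j + 1) i := by
    rw [h]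
    exact Or.inr (by omega)
  have h2 : i + j + 1 = i := h1.resolve_right fun hc => hc rfl
  omega

theorem left_ne_one (i : ℕ) : left i ≠ one ℕ := by
  intro h
  have h1 : (left i).rel (i + 1) i := by
    rw [h]
    trivial
  have h2 : i + 1 = i := h1.resolve_right fun hc => hc rfl
  omega

theorem right_ne_one (i : ℕ) : right i ≠ one ℕ := by
  intro h
  have h1 : (right i).rel i (i + 1) := by
    rw [h]
    trivial
  have h2 : i + 1 = i := h1.resolve_right fun hc => hc rfl
  omega

theorem shift_eq_one_iff {k : ℕ} {γ : Compo ℕ} :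
    γ.shift k = one ℕ ↔ ∀ i j, k ≤ i → k ≤ j → γ.rel i j := by
  rw [eq_one_iff]
  refine ⟨fun h i j hi hj => ?_, fun h i j => h _ _ (Nat.le_add_left _ _) (Nat.le_add_left _ _)⟩
  have := h (i - k) (j - k)
  change γ.rel (i - k + k) (j - k + k) at this
  rwa [Nat.sub_add_cancel hi, Nat.sub_add_cancel hj] at this

/-- Every integer `≥ k` may be replaced by `k`, so the restriction to `[k + 1]` determines the
composition. -/
theorem finite_shift_eq_one (k : ℕ) : {γ : Compo ℕ | γ.shift k = one ℕ}.Finite := by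
  refine Set.Finite.of_finite_image (f := Compo.restrict (k + 1)) (Set.toFinite _) ?_
  intro γ hγ γ' hγ' h
  have hred : ∀ {γ : Compo ℕ}, γ.shift k = one ℕ →
      ∀ i j, (γ.rel i j ↔ γ.rel (min i k) (min j k)) := by
    intro γ hγ
    have hs : ∀ i, γ.rel i (min i k) ∧ γ.rel (min i k) i := by
      intro i
      rcases le_total i k with hi | hi
      · rw [min_eq_left hi]
        exact ⟨γ.rel_refl i, γ.rel_refl i⟩
      · rw [min_eq_right hi]
        exact ⟨shift_eq_one_iff.1 hγ _ _ hi le_rfl, shift_eq_one_iff.1 hγ _ _ le_rfl hi⟩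
    exact fun i j =>
      ⟨fun h => γ.trans _ _ _ (γ.trans _ _ _ (hs i).2 h) (hs j).1,
        fun h => γ.trans _ _ _ (γ.trans _ _ _ (hs i).1 h) (hs j).2⟩
  ext i j
  rw [hred hγ i j, hred hγ' i j]
  have h1 := congrArg Compo.rel h
  exact iff_of_eq (congrFun (congrFun h1 ⟨min i k, by omega⟩) ⟨min j k, by omega⟩)

/-- A composition all of whose elements but `i` are in one block. -/
theorem eq_left_or_right {γ : Compo ℕ} {i : ℕ} (h : ∀ a b, a ≠ i → b ≠ i → γ.rel a b)
    (h1 : γ ≠ one ℕ) : γ = left i ∨ γ = right i := by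
  have hne : ∃ b, b ≠ i ∧ ¬ γ.Same i b := by
    by_contra! hc
    refine h1 (eq_one_iff.2 fun a b => ?_)
    rcases eq_or_ne a i with rfl | ha
    · rcases eq_or_ne b a with rfl | hb
      · exact γ.rel_refl _
      · exact (hc b hb).1
    · rcases eq_or_ne b i with rfl | hb
      · exact (hc a ha).2
      · exact h a b ha hb
  obtain ⟨b, hb, hib⟩ := hne
  rcases γ.total i b with hr | hr
  · left
    have hr' : ¬ γ.rel b i := fun hc => hib ⟨hr, hc⟩
    ext x y
    constructor
    · intro hxy
      by_contra! hc
      obtain ⟨hx, hy⟩ : x ≠ i ∧ y = i := by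
        have : ¬ (x = i ∨ y ≠ i) := hc
        tauto
      subst hy
      exact hr' (γ.trans _ _ _ (h b x hb hx) hxy)
    · intro hxy
      rcases eq_or_ne x i with hx | hx
      · subst hx
        rcases eq_or_ne y x with rfl | hy
        · exact γ.rel_refl _
        · exact γ.trans _ _ _ hr (h b y hb hy)
      · exact h x y hx ((show x = i ∨ y ≠ i from hxy).resolve_left hx)
  · right
    have hr' : ¬ γ.rel i b := fun hc => hib ⟨hc, hr⟩
    ext x y
    constructor
    · intro hxy
      by_contra! hc
      obtain ⟨hy, hx⟩ : y ≠ i ∧ x = i := by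
        have : ¬ (y = i ∨ x ≠ i) := hc
        tauto
      subst hx
      exact hr' (γ.trans _ _ _ hxy (h y b hy hb))
    · intro hxy
      rcases eq_or_ne y i with hy | hy
      · subst hy
        rcases eq_or_ne x y with rfl | hx
        · exact γ.rel_refl _
        · exact γ.trans _ _ _ (h x b hx hb) hr
      · exact h x y ((show y = i ∨ x ≠ i from hxy).resolve_left hy) hy

/-- A composition with one block containing all large integers, and at least two elements outside
that block, has mass zero for every fragmentation measure. -/
theorem IsFragmentationMeasure.measure_singleton_eq_zero {μ : Measure (Compo ℕ)}
    (hμ : IsFragmentationMeasure μ) {γ : Compo ℕ} {k : ℕ} (hγ : γ.shift k = one ℕ)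
    (hl : ∀ i, γ ≠ left i) (hr : ∀ i, γ ≠ right i) : μ {γ} = 0 := by
  by_cases h1 : γ = one ℕ
  · rw [h1, hμ.one_eq_zero]
  rw [shift_eq_one_iff] at hγ
  have hS : ∀ i, k ≤ i → γ.Same i k := fun i hi => ⟨hγ _ _ hi le_rfl, hγ _ _ le_rfl hi⟩
  have hall : ∀ i, (∀ b, b ≠ i → γ.Same b k) → False := by
    intro i hi
    rcases eq_left_or_right (i := i) (fun a b ha hb => γ.trans _ _ _ (hi a ha).1 (hi b hb).2) h1
      with h | h
    · exact hl i h
    · exact hr i h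
  obtain ⟨a, -, ha⟩ : ∃ a, a ≠ k ∧ ¬ γ.Same a k := by
    by_contra! hc
    exact hall k hc
  -- `a` will keep the composition non-trivial near the origin while `b` is moved to infinity.
  obtain ⟨b, hba, hb⟩ : ∃ b, b ≠ a ∧ ¬ γ.Same b k := by
    by_contra! hc
    exact hall a hc
  have hak : a < k := by
    by_contra hc
    exact ha (hS a (not_lt.1 hc))
  have hbk : b < k := by
    by_contra hc
    exact hb (hS b (not_lt.1 hc))
  -- Targets beyond `k` leave `a` and `k` fixed, with `k` marking the big block. In `δ m`, the
  -- integer `k + 1 + m` is outside that block, which distinguishes the `δ m`.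
  let δ : ℕ → Compo ℕ := fun m => γ.perm (Equiv.swap b (k + 1 + m))
  have hsame : ∀ m i j, (δ m).Same i j ↔
      γ.Same (Equiv.swap b (k + 1 + m) i) (Equiv.swap b (k + 1 + m) j) := by
    intro m i j
    simp only [δ, Compo.Same, Compo.perm, Equiv.symm_swap]
  have hk : ∀ m, Equiv.swap b (k + 1 + m) k = k := fun m =>
    Equiv.swap_apply_of_ne_of_ne (by omega) (by omega)
  have hsub : ∀ m, δ m ∈ nontrivialOn (k + 1) := by
    intro m h
    rw [restrict_eq_one_iff] at h
    have h2 : (δ m).Same a k := ⟨h a (by omega) k (by omega), h k (by omega) a (by omega)⟩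
    rw [hsame, hk, Equiv.swap_apply_of_ne_of_ne hba.symm (by omega)] at h2
    exact ha h2
  have hinj : Function.Injective δ := by
    intro m m' h
    by_contra hne
    have h2 : ¬ (δ m).Same (k + 1 + m) k := by
      rw [hsame, hk, Equiv.swap_apply_right]
      exact hb
    rw [h, hsame, hk, Equiv.swap_apply_of_ne_of_ne (by omega) (by omega)] at h2
    exact h2 (hS _ (by omega))
  have hsum : ∑' m, μ {δ m} ≤ μ (nontrivialOn (k + 1)) := by
    rw [← measure_iUnion (fun m m' hmm => disjoint_singleton.2 fun h => hmm (hinj h))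
      fun m => measurableSet_singleton _]
    refine measure_mono (iUnion_subset fun m => ?_)
    rintro _ rfl
    exact hsub m
  simp only [δ, hμ.measure_singleton_perm] at hsum
  by_contra h0
  rw [ENNReal.tsum_const_eq_top_of_ne_zero h0] at hsum
  exact (hμ.finite (k + 1)).ne (top_le_iff.1 hsum)

theorem IsFragmentationMeasure.measure_left {μ : Measure (Compo ℕ)}
    (hμ : IsFragmentationMeasure μ) (i : ℕ) : μ {left i} = μ {left 0} := by
  have := hμ.measure_singleton_perm (Equiv.swap 0 i) (left 0)
  rwa [perm_left, Equiv.swap_apply_left] at this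

theorem IsFragmentationMeasure.measure_right {μ : Measure (Compo ℕ)}
    (hμ : IsFragmentationMeasure μ) (i : ℕ) : μ {right i} = μ {right 0} := by
  have := hμ.measure_singleton_perm (Equiv.swap 0 i) (right 0)
  rwa [perm_right, Equiv.swap_apply_left] at this

theorem IsFragmentationMeasure.measure_singleton_ne_top {μ : Measure (Compo ℕ)}
    (hμ : IsFragmentationMeasure μ) {γ : Compo ℕ} (hγ : γ ≠ one ℕ) : μ {γ} ≠ ∞ := by
  rw [ne_eq, eq_one_iff_restrict, not_forall] at hγ
  obtain ⟨n, hn⟩ := hγ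
  exact ((measure_mono (singleton_subset_iff.2 hn)).trans_lt (hμ.finite n)).ne

theorem epsLeft_apply {S : Set (Compo ℕ)} (hS : MeasurableSet S) :
    epsLeft S = ∑' i, S.indicator 1 (left i) := by
  rw [epsLeft, Measure.sum_apply _ hS]
  exact tsum_congr fun i => Measure.dirac_apply' _ hS

theorem epsRight_apply {S : Set (Compo ℕ)} (hS : MeasurableSet S) :
    epsRight S = ∑' i, S.indicator 1 (right i) := by
  rw [epsRight, Measure.sum_apply _ hS]
  exact tsum_congr fun i => Measure.dirac_apply' _ hS

theorem measure_inter_range_eq {μ : Measure (Compo ℕ)} {g : ℕ → Compo ℕ}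
    (hg : Function.Injective g) {c : ℝ≥0∞} (hc : ∀ i, μ {g i} = c) (S : Set (Compo ℕ)) :
    μ (S ∩ range g) = c * ∑' i, S.indicator 1 (g i) := by
  have h : S ∩ range g = ⋃ i, S ∩ {g i} := by
    rw [← inter_iUnion, iUnion_singleton_eq_range]
  rw [h, measure_iUnion, ← ENNReal.tsum_mul_left]
  · refine tsum_congr fun i => ?_
    by_cases hi : g i ∈ S
    · rw [inter_eq_right.2 (singleton_subset_iff.2 hi), hc, indicator_of_mem hi]
      simp
    · rw [inter_singleton_eq_empty.2 hi, indicator_of_notMem hi]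
      simp
  · intro i j hij
    exact (disjoint_singleton.2 fun h => hij (hg h)).mono inter_subset_right inter_subset_right
  · exact fun i => ((countable_singleton (g i)).mono inter_subset_right).measurableSet

/-- On compositions with a block containing all integers `≥ n`, a fragmentation measure is a
combination of the two erosion measures. -/
theorem IsFragmentationMeasure.measure_of_subset_shift_eq_one {μ : Measure (Compo ℕ)}
    (hμ : IsFragmentationMeasure μ) {n : ℕ} {S : Set (Compo ℕ)}
    (hS : S ⊆ {γ | γ.shift n = one ℕ}) :
    μ S = μ {left 0} * epsLeft S + μ {right 0} * epsRight S := by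
  have hfin : S.Finite := (finite_shift_eq_one n).subset hS
  have hm : MeasurableSet S := hfin.measurableSet
  rw [epsLeft_apply hm, epsRight_apply hm, ← measure_inter_range_eq left_injective hμ.measure_left,
    ← measure_inter_range_eq right_injective hμ.measure_right,
    ← measure_union _ (hfin.inter_of_left _).measurableSet]
  · refine measure_congr (ae_eq_set.2 ⟨?_, ?_⟩)
    · rw [← inter_union_distrib_left, sdiff_self_inter]
      have hc : (S \ (range left ∪ range right)).Countable := hfin.countable.mono sdiff_subset
      rw [← biUnion_of_singleton (S \ (range left ∪ range right)), measure_biUnion_null_iff hc]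
      rintro γ ⟨hγ, hγ'⟩
      exact hμ.measure_singleton_eq_zero (hS hγ) (fun i h => hγ' (Or.inl ⟨i, h.symm⟩))
        fun i h => hγ' (Or.inr ⟨i, h.symm⟩)
    · rw [← inter_union_distrib_left, sdiff_eq_bot_iff.2 inter_subset_left]
      exact measure_empty
  · refine Set.disjoint_left.2 ?_
    rintro _ ⟨-, i, rfl⟩ ⟨-, j, h⟩
    exact left_ne_right i j h.symm

/-- A singleton `{i}` with `i ≥ n` does not cut `[n]`; hence `i < n`, and all integers from `n` on
are in the other block. -/
theorem left_shift_eq_one {n i : ℕ} (h : (left i).restrict n ≠ one (Fin n)) :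
    (left i).shift n = one ℕ := by
  by_cases hi : i < n
  · rw [shift_eq_one_iff]
    exact fun a b _ hb => Or.inr (by omega)
  · refine absurd (restrict_eq_one_iff.2 fun a ha b hb => ?_) h
    exact Or.inr (by omega)

theorem right_shift_eq_one {n i : ℕ} (h : (right i).restrict n ≠ one (Fin n)) :
    (right i).shift n = one ℕ := by
  by_cases hi : i < n
  · rw [shift_eq_one_iff]
    exact fun a b ha _ => Or.inr (by omega)
  · refine absurd (restrict_eq_one_iff.2 fun a ha b hb => ?_) h
    exact Or.inr (by omega)

theorem IsFragmentationMeasure.measure_restrict_eq_and_shift_eq_one {μ : Measure (Compo ℕ)}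
    (hμ : IsFragmentationMeasure μ) {n : ℕ} {c : Compo (Fin n)} (hc : c ≠ one (Fin n)) :
    μ {γ | γ.restrict n = c ∧ γ.shift n = one ℕ} =
      μ {left 0} * epsLeft {γ | γ.restrict n = c} +
        μ {right 0} * epsRight {γ | γ.restrict n = c} := by
  have hm := measurableSet_restrict_eq c
  have hm' : MeasurableSet {γ : Compo ℕ | γ.restrict n = c ∧ γ.shift n = one ℕ} :=
    hm.inter (measurable_shift n (measurableSet_singleton _))
  rw [hμ.measure_of_subset_shift_eq_one (S := {γ | γ.restrict n = c ∧ γ.shift n = one ℕ})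
    fun γ hγ => hγ.2, epsLeft_apply hm, epsRight_apply hm, epsLeft_apply hm', epsRight_apply hm']
  congr 2
  · refine tsum_congr fun i => ?_
    by_cases h : (left i).restrict n = c
    · rw [indicator_of_mem (show left i ∈ {γ : Compo ℕ | γ.restrict n = c} from h),
        indicator_of_mem (show left i ∈ {γ : Compo ℕ | γ.restrict n = c ∧ γ.shift n = one ℕ} from
          ⟨h, left_shift_eq_one (h ▸ hc)⟩)]
    · rw [indicator_of_notMem (show left i ∉ {γ : Compo ℕ | γ.restrict n = c} from h),
        indicator_of_notMem fun h' => h h'.1]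
  · refine tsum_congr fun i => ?_
    by_cases h : (right i).restrict n = c
    · rw [indicator_of_mem (show right i ∈ {γ : Compo ℕ | γ.restrict n = c} from h),
        indicator_of_mem (show right i ∈ {γ : Compo ℕ | γ.restrict n = c ∧ γ.shift n = one ℕ} from
          ⟨h, right_shift_eq_one (h ▸ hc)⟩)]
    · rw [indicator_of_notMem (show right i ∉ {γ : Compo ℕ | γ.restrict n = c} from h),
        indicator_of_notMem fun h' => h h'.1]

/-! ### Asymptotic open sets of erosion compositions -/

theorem freq_add_freq_not (p : ℕ → Prop) {n : ℕ} (hn : 0 < n) :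
    freq p n + freq (fun i => ¬ p i) n = 1 := by
  classical
  have h := Finset.card_filter_add_card_filter_not (s := (Finset.univ : Finset (Fin n)))
    fun i => p i
  rw [Finset.card_univ, Fintype.card_fin] at h
  have hn' : (n : ℝ) ≠ 0 := by positivity
  unfold freq
  rw [← add_div, div_eq_one_iff_eq hn']
  convert congrArg (Nat.cast (R := ℝ)) h using 1
  push_cast
  congr

theorem freq_le_one_div {p : ℕ → Prop} (hp : ∀ a b, p a → p b → a = b) (n : ℕ) :
    freq p n ≤ 1 / n := by
  classical
  refine div_le_div_of_nonneg_right ?_ (Nat.cast_nonneg n)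
  refine Nat.cast_le_one.2 (Finset.card_le_one.2 fun a ha b hb => ?_)
  rw [Finset.mem_filter] at ha hb
  exact Fin.ext (hp _ _ ha.2 hb.2)

theorem freq_eq_le (i n : ℕ) : freq (fun k => k = i) n ≤ 1 / n :=
  freq_le_one_div (fun _ _ ha hb => ha.trans hb.symm) n

/-- One exceptional integer moves each end of the big empirical interval by at most `1 / n`. -/
theorem isAsymptoticOpenSet_full {γ : Compo ℕ} {i : ℕ}
    (h : ∀ a b, a ≠ i → b ≠ i → γ.rel a b) : IsAsymptoticOpenSet γ OpenSub.full := by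
  refine Metric.tendsto_atTop.2 fun ε hε => ?_
  obtain ⟨N, hN⟩ := exists_nat_gt (1 / ε)
  -- At least two integers are needed for `[n]` to contain some `j ≠ i`.
  refine ⟨N + 2, fun n hn => ?_⟩
  have hn0 : (0 : ℝ) < n := by exact_mod_cast (by omega : 0 < n)
  refine lt_of_le_of_lt (OpenSub.dist_le_of_forall (r := 1 / n) (by positivity) ?_ ?_) ?_
  · rintro y ⟨hy, hyU⟩
    obtain ⟨j, hj, hji⟩ : ∃ j < n, j ≠ i := by
      by_cases hi : i = 0
      · exact ⟨1, by omega, by omega⟩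
      · exact ⟨0, by omega, fun h => hi h.symm⟩
    have h1 : freq (fun k => γ.Before k j) n ≤ 1 / n := by
      refine (freq_mono fun k _ hk => ?_).trans (freq_eq_le i n)
      by_contra hki
      exact hk.2 (h j k hji hki)
    have h2 : 1 - 1 / n ≤ freq (fun k => γ.rel k j) n := by
      have h3 := freq_add_freq_not (fun k => k = i) (n := n) (by omega)
      have h4 : freq (fun k => ¬ k = i) n ≤ freq (fun k => γ.rel k j) n :=
        freq_mono fun k _ hk => h k j hk hji
      linarith [freq_eq_le i n]
    rw [mem_empiricalOpen_iff] at hyU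
    have h3 : y ≤ 1 / n ∨ 1 - 1 / n ≤ y := by
      by_contra! hc
      exact hyU ⟨j, hj, h1.trans_lt hc.1, hc.2.trans_le h2⟩
    rcases h3 with h3 | h3
    · refine ⟨0, ⟨⟨le_rfl, zero_le_one⟩, fun hc => lt_irrefl _ (OpenSub.full.subset hc).1⟩, ?_⟩
      rwa [sub_zero, abs_of_nonneg hy.1]
    · refine ⟨1, ⟨⟨zero_le_one, le_rfl⟩, fun hc => lt_irrefl _ (OpenSub.full.subset hc).2⟩, ?_⟩
      rw [abs_sub_comm, abs_of_nonneg (by linarith [hy.2])]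
      linarith
  · rintro z ⟨hz, hzU⟩
    refine ⟨z, ⟨hz, fun hc => hzU ((empiricalOpen γ n).subset hc)⟩, ?_⟩
    rw [sub_self, abs_zero]
    positivity
  · rw [div_lt_comm₀ hn0 hε]
    exact hN.trans_le (by exact_mod_cast (by omega : N ≤ n))

theorem isAsymptoticOpenSet_left (i : ℕ) : IsAsymptoticOpenSet (left i) OpenSub.full :=
  isAsymptoticOpenSet_full fun _ _ _ hb => Or.inr hb

theorem isAsymptoticOpenSet_right (i : ℕ) : IsAsymptoticOpenSet (right i) OpenSub.full :=
  isAsymptoticOpenSet_full fun _ _ ha _ => Or.inr ha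

theorem isAsymptoticOpenSet_one : IsAsymptoticOpenSet (one ℕ) OpenSub.full :=
  isAsymptoticOpenSet_full (i := 0) fun _ _ _ _ => trivial

theorem ae_sum_dirac {α : Type*} [MeasurableSpace α] {g : ℕ → α} {p : α → Prop}
    (hp : MeasurableSet {a | p a}) (h : ∀ i, p (g i)) :
    ∀ᵐ a ∂Measure.sum fun i => Measure.dirac (g i), p a :=
  Measure.ae_sum_iff.2 fun i => (ae_dirac_iff hp).2 (h i)

theorem ae_mixedLaw {ν : Measure OpenSub} {p : Compo ℕ → Prop} (hp : MeasurableSet {γ | p γ})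
    (h : ∀ᵐ U ∂ν, ∀ᵐ γ ∂paintboxLaw U, p γ) : ∀ᵐ γ ∂mixedLaw ν, p γ := by
  change mixedLaw ν {γ | p γ}ᶜ = 0
  rw [mixedLaw_apply _ hp.compl, lintegral_eq_zero_iff (f := fun U => paintboxLaw U {γ | p γ}ᶜ)
    ((Measure.measurable_coe hp.compl).comp measurable_paintboxLaw)]
  filter_upwards [h] with U hU using hU

/-! ### Existence of the decomposition -/

/-- Given the first sample, the second joins it with probability the length of its component, at
most `s₁`. Finiteness of `μ` on compositions cutting `[2]` then yields the integrability of `1 -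
s₁`. -/
theorem one_sub_maxLength_le (U : OpenSub) :
    1 - U.maxLength ≤ paintboxLaw U (nontrivialOn 2) := by
  have hm := measurableSet_restrict_eq (one (Fin 2))
  have h1 : paintboxLaw U {γ | γ.restrict 2 = one (Fin 2)} ≤ U.maxLength := by
    have hseg : MeasurableSet {p : unitInterval × unitInterval |
        uIcc (p.1 : ℝ) p.2 ⊆ U.carrier} := by
      have hc : Continuous fun p : unitInterval × unitInterval => (U, p.1, p.2) := by fun_prop
      exact (isOpen_segment_subset.preimage hc).measurableSet
    have hle : uniformSeq {x | (paintbox U x).restrict 2 = one (Fin 2)} ≤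
        uniformSeq.map (fun x => (x 0, x 1))
          {p : unitInterval × unitInterval | uIcc (p.1 : ℝ) p.2 ⊆ U.carrier} := by
      rw [Measure.map_apply (by fun_prop) hseg]
      refine measure_mono_ae ?_
      filter_upwards [ae_injective_uniformSeq] with x hx h
      have h' : (paintbox U x).restrict 2 = one (Fin 2) := h
      rw [restrict_eq_one_iff] at h'
      have h01 := paintbox_rel_iff.1 (h' 0 (by omega) 1 (by omega))
      have h10 := paintbox_rel_iff.1 (h' 1 (by omega) 0 (by omega))
      change uIcc (x 0 : ℝ) (x 1) ⊆ U.carrier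
      rcases h01 with h01 | h01
      · rcases h10 with h10 | h10
        · exact absurd (hx (Subtype.ext (le_antisymm h01 h10))) zero_ne_one
        · rwa [uIcc_comm]
      · exact h01
    rw [paintboxLaw, Measure.map_apply (measurable_paintbox U) hm]
    refine hle.trans ?_
    rw [uniformSeq_map_pair zero_ne_one, Measure.prod_apply hseg]
    calc _ ≤ ∫⁻ _u : unitInterval, U.maxLength := lintegral_mono fun u => ?_
      _ = U.maxLength := by simp
    by_cases hu : (u : ℝ) ∈ U.carrier
    · have hsub : connectedComponentIn U.carrier (u : ℝ) ⊆ Icc 0 1 :=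
        (connectedComponentIn_subset _ _).trans (U.subset.trans Ioo_subset_Icc_self)
      have hset : Prod.mk u ⁻¹' {p : unitInterval × unitInterval |
          uIcc (p.1 : ℝ) p.2 ⊆ U.carrier} =
            {v : unitInterval | (v : ℝ) ∈ connectedComponentIn U.carrier (u : ℝ)} := by
        ext v
        exact (mem_connectedComponentIn_iff_uIcc _ _ _).symm
      rw [hset, volume_coe_mem hsub U.isOpen.connectedComponentIn.measurableSet]
      exact le_iSup₂ (f := fun I (_ : I ∈ U.components) => volume I) _ ⟨_, hu, rfl⟩
    · have hset : Prod.mk u ⁻¹' {p : unitInterval × unitInterval |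
          uIcc (p.1 : ℝ) p.2 ⊆ U.carrier} = ∅ :=
        eq_empty_of_forall_notMem fun v hv => hu (hv left_mem_uIcc)
      rw [hset, measure_empty]
      exact zero_le
  have h2 : nontrivialOn 2 = {γ | γ.restrict 2 = one (Fin 2)}ᶜ := rfl
  rw [h2, prob_compl_eq_one_sub hm]
  exact tsub_le_tsub_left h1 1

/-- The asymptotic open set of the trivial composition is the full interval, which `ν` does not
charge. -/
theorem mixedLaw_singleton_one {ν : Measure OpenSub} (hν : ν {OpenSub.full} = 0) :
    mixedLaw ν {one ℕ} = 0 := by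
  rw [measure_eq_zero_iff_ae_notMem]
  refine ae_mixedLaw (measurableSet_singleton (one ℕ)).compl ?_
  filter_upwards [measure_eq_zero_iff_ae_notMem.1 hν] with U hU
  filter_upwards [ae_isAsymptoticOpenSet_paintboxLaw U] with γ hγ h
  rw [show γ = one ℕ from h] at hγ
  exact hU (tendsto_nhds_unique hγ isAsymptoticOpenSet_one)

/-- Every fragmentation measure is the sum of an erosion part and a dislocation part. -/
theorem IsFragmentationMeasure.exists_isDecomposition {μ : Measure (Compo ℕ)}
    (hμ : IsFragmentationMeasure μ) :
    ∃ (c_l c_r : ℝ≥0) (ν : Measure OpenSub), IsDecomposition μ c_l c_r ν := by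
  obtain ⟨ν, hν, h⟩ := hμ.exists_mixedLaw_add
  have hl : ((μ {left 0}).toNNReal : ℝ≥0∞) = μ {left 0} :=
    ENNReal.coe_toNNReal (hμ.measure_singleton_ne_top (left_ne_one 0))
  have hr : ((μ {right 0}).toNNReal : ℝ≥0∞) = μ {right 0} :=
    ENNReal.coe_toNNReal (hμ.measure_singleton_ne_top (right_ne_one 0))
  have hdec : μ = (μ {left 0}).toNNReal • epsLeft + (μ {right 0}).toNNReal • epsRight +
      mixedLaw ν := by
    have hsum : ∀ S : Set (Compo ℕ), ((μ {left 0}).toNNReal • epsLeft +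
        (μ {right 0}).toNNReal • epsRight + mixedLaw ν) S =
        μ {left 0} * epsLeft S + μ {right 0} * epsRight S + mixedLaw ν S := by
      intro S
      rw [Measure.add_apply, Measure.add_apply, Measure.smul_apply, Measure.smul_apply,
        ENNReal.smul_def, ENNReal.smul_def, hl, hr, smul_eq_mul, smul_eq_mul]
    refine measure_ext (fun n c hc => hμ.measure_cylinder_ne_top hc) (fun n c hc => ?_)
      (by simp [hμ.one_eq_zero]) ?_
    · rw [hsum, h n c hc, hμ.measure_restrict_eq_and_shift_eq_one hc, add_comm]
    · rw [hsum, hμ.one_eq_zero, mixedLaw_singleton_one hν,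
        epsLeft_apply (measurableSet_singleton _), epsRight_apply (measurableSet_singleton _)]
      simp [left_ne_one, right_ne_one]
  refine ⟨_, _, ν, ⟨hν, ?_⟩, hdec⟩
  calc ∫⁻ U, (1 - U.maxLength) ∂ν ≤ ∫⁻ U, paintboxLaw U (nontrivialOn 2) ∂ν :=
        lintegral_mono fun U => one_sub_maxLength_le U
    _ = mixedLaw ν (nontrivialOn 2) := (mixedLaw_apply _ (measurableSet_nontrivialOn 2)).symm
    _ ≤ μ (nontrivialOn 2) := by
        conv_rhs => rw [hdec]
        exact Measure.le_add_left le_rfl _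
    _ < ∞ := hμ.finite 2

/-! ### The two parts as restrictions, and uniqueness -/

theorem ae_isAsymptoticOpenSet_epsLeft : ∀ᵐ γ ∂epsLeft, IsAsymptoticOpenSet γ OpenSub.full :=
  ae_sum_dirac (measurableSet_isAsymptoticOpenSet _) isAsymptoticOpenSet_left

theorem ae_isAsymptoticOpenSet_epsRight : ∀ᵐ γ ∂epsRight, IsAsymptoticOpenSet γ OpenSub.full :=
  ae_sum_dirac (measurableSet_isAsymptoticOpenSet _) isAsymptoticOpenSet_right

theorem IsDislocationMeasure.ae_mixedLaw_not_full {ν : Measure OpenSub}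
    (hν : IsDislocationMeasure ν) : ∀ᵐ γ ∂mixedLaw ν, ¬ IsAsymptoticOpenSet γ OpenSub.full := by
  refine ae_mixedLaw (measurableSet_isAsymptoticOpenSet _).compl ?_
  filter_upwards [measure_eq_zero_iff_ae_notMem.1 hν.full_eq_zero] with U hU
  filter_upwards [ae_isAsymptoticOpenSet_paintboxLaw U] with γ hγ h
  exact hU (tendsto_nhds_unique hγ h)

theorem measurableSet_exists_isAsymptoticOpenSet :
    MeasurableSet {γ | ∃ U, IsAsymptoticOpenSet γ U} :=
  MeasureTheory.measurableSet_exists_tendsto measurable_empiricalOpen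

theorem ae_mixedLaw_exists (ν : Measure OpenSub) :
    ∀ᵐ γ ∂mixedLaw ν, ∃ U, IsAsymptoticOpenSet γ U :=
  ae_mixedLaw measurableSet_exists_isAsymptoticOpenSet (ae_of_all _ fun U =>
    (ae_isAsymptoticOpenSet_paintboxLaw U).mono fun _ hγ => ⟨U, hγ⟩)

namespace IsDecomposition

variable {μ : Measure (Compo ℕ)} {c_l c_r : ℝ≥0} {ν : Measure OpenSub}

theorem restrict_full (h : IsDecomposition μ c_l c_r ν) :
    μ.restrict {γ | IsAsymptoticOpenSet γ OpenSub.full} = c_l • epsLeft + c_r • epsRight := by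
  have h1 : (mixedLaw ν).restrict {γ | IsAsymptoticOpenSet γ OpenSub.full} = 0 :=
    Measure.restrict_eq_zero.2 (measure_eq_zero_iff_ae_notMem.2 h.1.ae_mixedLaw_not_full)
  rw [h.2, Measure.restrict_add, Measure.restrict_add, Measure.restrict_smul,
    Measure.restrict_smul, h1, add_zero,
    Measure.restrict_eq_self_of_ae_mem (s := {γ | IsAsymptoticOpenSet γ OpenSub.full})
      ae_isAsymptoticOpenSet_epsLeft,
    Measure.restrict_eq_self_of_ae_mem (s := {γ | IsAsymptoticOpenSet γ OpenSub.full})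
      ae_isAsymptoticOpenSet_epsRight]

theorem restrict_not_full (h : IsDecomposition μ c_l c_r ν) :
    μ.restrict {γ | IsAsymptoticOpenSet γ OpenSub.full}ᶜ = mixedLaw ν := by
  have h0 : ∀ m : Measure (Compo ℕ), (∀ᵐ γ ∂m, IsAsymptoticOpenSet γ OpenSub.full) →
      m.restrict {γ | IsAsymptoticOpenSet γ OpenSub.full}ᶜ = 0 :=
    fun m hm => Measure.restrict_eq_zero.2 hm
  rw [h.2, Measure.restrict_add, Measure.restrict_add, Measure.restrict_smul,
    Measure.restrict_smul, h0 _ ae_isAsymptoticOpenSet_epsLeft,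
    h0 _ ae_isAsymptoticOpenSet_epsRight, smul_zero, smul_zero, add_zero, zero_add]
  exact Measure.restrict_eq_self_of_ae_mem h.1.ae_mixedLaw_not_full

/-- This passes from the complement of `U_γ = ]0,1[` to the event that `U_γ` exists and differs from
`]0,1[`. -/
theorem ae_exists (h : IsDecomposition μ c_l c_r ν) :
    ∀ᵐ γ ∂μ, ∃ U, IsAsymptoticOpenSet γ U := by
  rw [h.2, ae_add_measure_iff, ae_add_measure_iff]
  exact ⟨⟨Measure.ae_smul_measure (ae_isAsymptoticOpenSet_epsLeft.mono fun _ hγ => ⟨_, hγ⟩) _,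
    Measure.ae_smul_measure (ae_isAsymptoticOpenSet_epsRight.mono fun _ hγ => ⟨_, hγ⟩) _⟩,
    ae_mixedLaw_exists ν⟩

theorem restrict_ne_full (h : IsDecomposition μ c_l c_r ν) :
    μ.restrict {γ | ∃ U, IsAsymptoticOpenSet γ U ∧ U ≠ OpenSub.full} = mixedLaw ν := by
  rw [← h.restrict_not_full]
  refine Measure.restrict_congr_set ?_
  filter_upwards [h.ae_exists] with γ hγ
  obtain ⟨U, hU⟩ := hγ
  refine propext ⟨?_, fun hn => ⟨U, hU, ?_⟩⟩
  · rintro ⟨V, hV, hne⟩ hf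
    exact hne (tendsto_nhds_unique hV hf)
  · rintro rfl
    exact hn hU

theorem measure_left (h : IsDecomposition μ c_l c_r ν) :
    μ.restrict {γ | IsAsymptoticOpenSet γ OpenSub.full} {left 0} = c_l := by
  have h1 : epsLeft {left 0} = 1 := by
    rw [epsLeft_apply (measurableSet_singleton _), tsum_eq_single 0]
    · simp
    · intro i hi
      simp [left_injective.eq_iff, hi]
  have h2 : epsRight {left 0} = 0 := by
    rw [epsRight_apply (measurableSet_singleton _)]
    simp [(left_ne_right _ _).symm]
  rw [h.restrict_full, Measure.add_apply, Measure.smul_apply, Measure.smul_apply, h1, h2]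
  simp [ENNReal.smul_def]

theorem measure_right (h : IsDecomposition μ c_l c_r ν) :
    μ.restrict {γ | IsAsymptoticOpenSet γ OpenSub.full} {right 0} = c_r := by
  have h1 : epsLeft {right 0} = 0 := by
    rw [epsLeft_apply (measurableSet_singleton _)]
    simp [left_ne_right]
  have h2 : epsRight {right 0} = 1 := by
    rw [epsRight_apply (measurableSet_singleton _), tsum_eq_single 0]
    · simp
    · intro i hi
      simp [right_injective.eq_iff, hi]
  rw [h.restrict_full, Measure.add_apply, Measure.smul_apply, Measure.smul_apply, h1, h2]
  simp [ENNReal.smul_def]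

theorem unique {c_l' c_r' : ℝ≥0} {ν' : Measure OpenSub} (h : IsDecomposition μ c_l c_r ν)
    (h' : IsDecomposition μ c_l' c_r' ν') : c_l' = c_l ∧ c_r' = c_r ∧ ν' = ν := by
  refine ⟨?_, ?_, ?_⟩
  · exact_mod_cast h'.measure_left.symm.trans h.measure_left
  · exact_mod_cast h'.measure_right.symm.trans h.measure_right
  · rw [← map_asymptoticOpen_mixedLaw ν', ← h'.restrict_not_full, h.restrict_not_full,
      map_asymptoticOpen_mixedLaw]

end IsDecomposition

/-! ### Ranked enumeration of the interval components -/

/-- A family of positive numbers can be enumerated along its decreasing rearrangement. -/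
theorem exists_equiv_of_ranked {α : Type*} {C : Set α} {v : α → ℝ≥0∞} {s : ℕ → ℝ≥0∞}
    (hv : ∀ i ∈ C, v i ≠ 0) (hv' : ∀ i ∈ C, v i ≠ ∞) (hs' : ∀ k, s k ≠ ∞)
    (hs : ∀ t, t ≠ 0 → ∃ k, s k ≤ t)
    (h : ∀ t k, t < s k ↔ ∃ F : Finset α, (F : Set α) ⊆ C ∧ F.card = k + 1 ∧ ∀ i ∈ F, t < v i) :
    ∃ e : C ≃ {k // s k ≠ 0}, ∀ i : C, v i = s (e i) := by
  classical
  -- Infinitely many values above `t` would force every `s k` above `t`.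
  have hfin : ∀ t, t ≠ 0 → {i ∈ C | t < v i}.Finite := by
    intro t ht
    by_contra hinf
    obtain ⟨k, hk⟩ := hs t ht
    obtain ⟨F, hF, hFc⟩ := Set.Infinite.exists_subset_card_eq hinf (k + 1)
    exact hk.not_gt ((h t k).2 ⟨F, fun i hi => (hF hi).1, hFc, fun i hi => (hF hi).2⟩)
  have hcard : ∀ (P : Set α) (k : ℕ), P.Finite →
      (k < P.ncard ↔ ∃ F : Finset α, (F : Set α) ⊆ P ∧ F.card = k + 1) := by
    intro P k hP
    rw [← Nat.succ_le_iff, Set.ncard_eq_toFinset_card P hP, Finset.le_card_iff_exists_subset_card]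
    simp only [Set.Finite.subset_toFinset]
  -- The ranks with `s k > t` form an initial segment, of length the number of values `> t`.
  have hlt : ∀ t, t ≠ 0 → {k | t < s k} = Iio {i ∈ C | t < v i}.ncard := by
    intro t ht
    ext k
    rw [mem_Iio, hcard _ _ (hfin t ht), mem_ofPred_eq, h]
    exact exists_congr fun F =>
      ⟨fun ⟨h1, h2, h3⟩ => ⟨fun i hi => ⟨h1 hi, h3 i hi⟩, h2⟩,
        fun ⟨h1, h2⟩ => ⟨fun i hi => (h1 hi).1, h2, fun i hi => (h1 hi).2⟩⟩
  -- Finitely many values exceed `a / 2`, so some threshold just below `a` has no value between it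
  -- and `a`: this turns strict counts into counts of values `≥ a`.
  have hthr : ∀ a, a ≠ 0 → a ≠ ∞ → ∃ t, t ≠ 0 ∧ t < a ∧ {i ∈ C | t < v i} = {i ∈ C | a ≤ v i} := by
    intro a ha hat
    have ha2 : a / 2 ≠ 0 := ENNReal.div_ne_zero.2 ⟨ha, by simp⟩
    have ha2lt : a / 2 < a := ENNReal.half_lt_self ha hat
    let T := (hfin _ ha2).toFinset.filter fun i => v i < a
    have hT : T.sup v < a := (Finset.sup_lt_iff (pos_iff_ne_zero.2 ha)).2 fun i hi =>
      (Finset.mem_filter.1 hi).2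
    refine ⟨T.sup v ⊔ a / 2, fun h0 => ha2 (le_zero_iff.1 (h0 ▸ le_sup_right)),
      sup_lt_iff.2 ⟨hT, ha2lt⟩, ?_⟩
    ext i
    refine and_congr_right fun hi => ⟨fun hlt' => ?_, fun hle => ?_⟩
    · by_contra! hc
      have : i ∈ T := Finset.mem_filter.2
        ⟨(hfin _ ha2).mem_toFinset.2 ⟨hi, le_sup_right.trans_lt hlt'⟩, hc⟩
      exact ((Finset.le_sup this).trans le_sup_left).not_gt hlt'
    · exact (sup_lt_iff.2 ⟨hT, ha2lt⟩).trans_le hle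
  have hle : ∀ a, a ≠ 0 → a ≠ ∞ → {k | a ≤ s k} = Iio {i ∈ C | a ≤ v i}.ncard ∧
      {i ∈ C | a ≤ v i}.Finite := by
    intro a ha hat
    obtain ⟨t, ht0, hta, ht⟩ := hthr a ha hat
    refine ⟨?_, ht ▸ hfin t ht0⟩
    rw [← ht, ← hlt t ht0]
    ext k
    refine ⟨fun hk => hta.trans_le hk, fun hk => ?_⟩
    obtain ⟨F, hF1, hF2, hF3⟩ := (h t k).1 hk
    refine le_of_forall_lt fun u hu => (h u k).2 ⟨F, hF1, hF2, fun i hi => hu.trans_le ?_⟩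
    have : i ∈ {i ∈ C | a ≤ v i} := ht ▸ ⟨hF1 hi, hF3 i hi⟩
    exact this.2
  have hIio : ∀ m : ℕ, (Iio m).ncard = m := fun m => by
    rw [Set.ncard_eq_toFinset_card']
    simp
  -- It suffices to match the two families one value at a time; multiplicities are differences of
  -- the counts for `≥ a` and `> a`.
  have hfiber : ∀ a, Nonempty ({i : C // v i = a} ≃ {k : {k // s k ≠ 0} // s k = a}) := by
    intro a
    by_cases ha : a = 0 ∨ a = ∞
    · have h1 : IsEmpty {i : C // v i = a} := by
        refine ⟨fun i => ?_⟩
        rcases ha with rfl | rfl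
        exacts [hv _ i.1.2 i.2, hv' _ i.1.2 i.2]
      have h2 : IsEmpty {k : {k // s k ≠ 0} // s k = a} := by
        refine ⟨fun k => ?_⟩
        rcases ha with rfl | rfl
        exacts [k.1.2 k.2, hs' _ k.2]
      exact ⟨Equiv.equivOfIsEmpty _ _⟩
    · rw [not_or] at ha
      obtain ⟨hle1, hle2⟩ := hle a ha.1 ha.2
      have hA : {i | i ∈ C ∧ v i = a} = {i ∈ C | a ≤ v i} \ {i ∈ C | a < v i} := by
        ext i
        simp only [mem_ofPred_eq, Set.mem_sdiff, not_and, not_lt]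
        exact ⟨fun h => ⟨⟨h.1, h.2.ge⟩, fun _ => h.2.le⟩,
          fun h => ⟨h.1.1, le_antisymm (h.2 h.1.1) h.1.2⟩⟩
      have hB : {k | s k ≠ 0 ∧ s k = a} = {k | a ≤ s k} \ {k | a < s k} := by
        ext k
        simp only [mem_ofPred_eq, Set.mem_sdiff, not_lt]
        exact ⟨fun h => ⟨h.2.ge, h.2.le⟩, fun h =>
          ⟨fun h0 => ha.1 (le_zero_iff.1 (h0 ▸ h.1)), le_antisymm h.2 h.1⟩⟩
      have hsub : {i ∈ C | a < v i} ⊆ {i ∈ C | a ≤ v i} := fun i hi => ⟨hi.1, hi.2.le⟩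
      have hfinA : {i | i ∈ C ∧ v i = a}.Finite := hA ▸ hle2.subset sdiff_subset
      have hfinB : {k | s k ≠ 0 ∧ s k = a}.Finite := by
        rw [hB, hle1]
        exact (Set.finite_Iio _).subset sdiff_subset
      have hcardAB : {i | i ∈ C ∧ v i = a}.ncard = {k | s k ≠ 0 ∧ s k = a}.ncard := by
        rw [hA, hB, Set.ncard_sdiff hsub (hfin a ha.1), hle1, hlt a ha.1,
          Set.ncard_sdiff (Iio_subset_Iio (Set.ncard_le_ncard hsub hle2)) (Set.finite_Iio _),
          hIio, hIio]
      have := hfinA.to_subtype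
      have := hfinB.to_subtype
      obtain ⟨f⟩ := (Finite.card_eq (α := {i | i ∈ C ∧ v i = a})
        (β := {k | s k ≠ 0 ∧ s k = a})).1 (by
          rw [Nat.card_coe_set_eq, Nat.card_coe_set_eq, hcardAB])
      exact ⟨(Equiv.subtypeSubtypeEquivSubtypeInter _ (fun i => v i = a)).trans
        (f.trans (Equiv.subtypeSubtypeEquivSubtypeInter _ (fun k => s k = a)).symm)⟩
  have f := fun a => (hfiber a).some
  refine ⟨(Equiv.sigmaFiberEquiv fun i : C => v i).symm.trans
    ((Equiv.sigmaCongrRight f).trans (Equiv.sigmaFiberEquiv fun k : {k // s k ≠ 0} => s k)),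
    fun i => ?_⟩
  exact ((f (v i)) ⟨i, rfl⟩).2.symm

theorem OpenSub.volume_le_one (U : OpenSub) {I : Set ℝ} (hI : I ∈ U.components) :
    volume I ≤ 1 := by
  simpa using U.sum_volume_le_one {I} (by simpa using hI)

theorem OpenSub.isOpen_of_mem_components {U : OpenSub} {I : Set ℝ} (hI : I ∈ U.components) :
    IsOpen I := by
  obtain ⟨x, -, rfl⟩ := hI
  exact U.isOpen.connectedComponentIn

theorem OpenSub.volume_component_ne_zero (U : OpenSub) {I : Set ℝ} (hI : I ∈ U.components) :
    volume I ≠ 0 := by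
  have ho := isOpen_of_mem_components hI
  obtain ⟨x, hx, rfl⟩ := hI
  exact (ho.measure_pos _ ⟨x, mem_connectedComponentIn hx⟩).ne'

theorem exists_le_of_tsum_ne_top {s : ℕ → ℝ≥0∞} (hs : ∑' k, s k ≠ ∞) {t : ℝ≥0∞} (ht : t ≠ 0) :
    ∃ k, s k ≤ t := by
  have h := ENNReal.tendsto_atTop_zero_of_tsum_ne_top hs
  exact (h.eventually_le_const (pos_iff_ne_zero.2 ht)).exists

/-- The components of an open set, enumerated so that their lengths are the ranked lengths. -/
theorem OpenSub.exists_ranking (U : OpenSub) :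
    ∃ e : U.components ≃ {k // U.rankedLength k ≠ 0},
      ∀ I : U.components, volume (I : Set ℝ) = U.rankedLength (e I) := by
  have hsum : ∑' k, U.rankedLength k ≠ ∞ :=
    (U.tsum_rankedLength_le_one.trans_lt ENNReal.one_lt_top).ne
  refine exists_equiv_of_ranked (fun I hI => U.volume_component_ne_zero hI)
    (fun I hI => ((U.volume_le_one hI).trans_lt ENNReal.one_lt_top).ne)
    (fun k => ENNReal.ne_top_of_tsum_ne_top hsum k)
    (fun t ht => exists_le_of_tsum_ne_top hsum ht) fun t k => ?_
  unfold rankedLength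
  rw [lt_iSup_iff]
  constructor
  · rintro ⟨⟨F, hF, hc⟩, hlt⟩
    exact ⟨F, hF, hc, fun I hI => hlt.trans_le (iInf₂_le I hI)⟩
  · rintro ⟨F, hF, hc, hlt⟩
    refine ⟨⟨F, hF, hc⟩, ?_⟩
    have hne : F.Nonempty := Finset.card_pos.1 (by omega)
    obtain ⟨I, hI⟩ := hne
    change t < ⨅ I ∈ F, volume I
    rw [← Finset.inf_eq_iInf, Finset.lt_inf_iff ((hlt I hI).trans_le le_top)]
    exact hlt

/-! ### Partitions generated by independent labels -/

/-- The partition of `ℕ` whose blocks are the sets of integers with a given non-zero label, the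
integers with label zero being singletons. -/
def labelPartition (l : ℕ → ℕ) : Setoid ℕ where
  r i j := i = j ∨ (l i = l j ∧ l i ≠ 0)
  iseqv := by
    refine ⟨fun i => Or.inl rfl, ?_, ?_⟩
    · rintro i j (h | ⟨h, h0⟩)
      · exact Or.inl h.symm
      · exact Or.inr ⟨h.symm, h ▸ h0⟩
    · rintro i j m (rfl | ⟨h, h0⟩) (rfl | ⟨h', h0'⟩)
      · exact Or.inl rfl
      · exact Or.inr ⟨h', h0'⟩
      · exact Or.inr ⟨h, h0⟩
      · exact Or.inr ⟨h.trans h', h0⟩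

theorem measurable_labelPartition : Measurable labelPartition := by
  refine measurable_partition_iff.2 fun i j => ?_
  have h1 : Measurable fun l : ℕ → ℕ => l i := measurable_pi_apply i
  have h2 : Measurable fun l : ℕ → ℕ => l j := measurable_pi_apply j
  exact (MeasurableSet.const (i = j)).union
    ((measurableSet_eq_fun h1 h2).inter (measurableSet_eq_fun h1 measurable_const).compl)

/-- The partition is a function of i.i.d. labels, so only the law of one label matters. -/
theorem map_labelPartition_congr {κ κ' : unitInterval → ℕ} (hκ : Measurable κ)
    (hκ' : Measurable κ')
    (h : ∀ k, volume (κ ⁻¹' {k + 1}) = volume (κ' ⁻¹' {k + 1})) :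
    uniformSeq.map (fun x => labelPartition fun i => κ (x i)) =
      uniformSeq.map (fun x => labelPartition fun i => κ' (x i)) := by
  have hlaw : (volume : Measure unitInterval).map κ = (volume : Measure unitInterval).map κ' := by
    have h1 : ∀ k, (volume : Measure unitInterval).map κ {k + 1} =
        (volume : Measure unitInterval).map κ' {k + 1} := fun k => by
      rw [Measure.map_apply hκ (measurableSet_singleton _),
        Measure.map_apply hκ' (measurableSet_singleton _), h]
    have p1 : IsProbabilityMeasure ((volume : Measure unitInterval).map κ) :=
      Measure.isProbabilityMeasure_map hκ.aemeasurable
    have p2 : IsProbabilityMeasure ((volume : Measure unitInterval).map κ') :=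
      Measure.isProbabilityMeasure_map hκ'.aemeasurable
    -- The mass of the label zero is what the other labels leave of total mass 1.
    have h0 : ({0} : Set ℕ) = (⋃ k : ℕ, {k + 1})ᶜ := by
      ext k
      cases k <;> simp
    have hdisj : Pairwise (Function.onFun Disjoint fun k : ℕ => ({k + 1} : Set ℕ)) :=
      fun a b hab => disjoint_singleton.2 (by omega)
    refine Measure.ext_of_singleton fun k => ?_
    cases k with
    | zero =>
      rw [h0, prob_compl_eq_one_sub (MeasurableSet.of_discrete),
        prob_compl_eq_one_sub (MeasurableSet.of_discrete),
        measure_iUnion hdisj fun _ => measurableSet_singleton _,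
        measure_iUnion hdisj fun _ => measurableSet_singleton _, tsum_congr h1]
    | succ k => exact h1 k
  have key : ∀ κ : unitInterval → ℕ, Measurable κ →
      uniformSeq.map (fun x => labelPartition fun i => κ (x i)) =
        (Measure.infinitePi fun _ : ℕ => (volume : Measure unitInterval).map κ).map
          labelPartition := by
    intro κ hκ
    rw [← Measure.infinitePi_map_pi _ fun _ => hκ, Measure.map_map measurable_labelPartition]
    · rfl
    · exact measurable_pi_lambda _ fun i => hκ.comp (measurable_pi_apply i)
  rw [key κ hκ, key κ' hκ', hlaw]

/-- Labels for the paintbox of an open set: the rank of the component, or zero outside the open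
set. -/
theorem OpenSub.exists_label (U : OpenSub) : ∃ κ : unitInterval → ℕ, Measurable κ ∧
    (∀ k, volume (κ ⁻¹' {k + 1}) = U.rankedLength k) ∧
    ∀ u v : unitInterval, κ u = κ v ∧ κ u ≠ 0 ↔ uIcc (u : ℝ) v ⊆ U.carrier := by
  classical
  obtain ⟨e, he⟩ := U.exists_ranking
  let comp : ∀ u : ℝ, u ∈ U.carrier → U.components := fun u hu => ⟨_, u, hu, rfl⟩
  -- Ranks start at zero, so they are shifted by one to reserve the label zero for points outside
  -- `U`.
  let κ : unitInterval → ℕ := fun u =>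
    if hu : (u : ℝ) ∈ U.carrier then (e (comp u hu) : ℕ) + 1 else 0
  have hκ0 : ∀ u, κ u ≠ 0 ↔ (u : ℝ) ∈ U.carrier := by
    intro u
    by_cases hu : (u : ℝ) ∈ U.carrier <;> simp [κ, hu]
  have hpre : ∀ k (hk : U.rankedLength k ≠ 0), κ ⁻¹' {k + 1} =
      {u : unitInterval | (u : ℝ) ∈ (e.symm ⟨k, hk⟩ : Set ℝ)} := by
    intro k hk
    obtain ⟨y, hy, hI⟩ := (e.symm ⟨k, hk⟩).2
    ext u
    simp only [mem_preimage, mem_singleton_iff, mem_ofPred_eq]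
    constructor
    · intro h
      have hu : (u : ℝ) ∈ U.carrier := (hκ0 u).1 (by omega)
      have h1 : e (comp u hu) = ⟨k, hk⟩ := Subtype.ext (by simpa [κ, hu] using h)
      rw [← h1, e.symm_apply_apply]
      exact mem_connectedComponentIn hu
    · intro h
      have hu : (u : ℝ) ∈ U.carrier := by
        rw [hI] at h
        exact connectedComponentIn_subset _ _ h
      have h1 : comp u hu = e.symm ⟨k, hk⟩ := by
        refine Subtype.ext ?_
        rw [hI] at h ⊢
        exact (connectedComponentIn_eq h).symm
      simp [κ, hu, h1]
  have hpre0 : ∀ k, U.rankedLength k = 0 → κ ⁻¹' {k + 1} = ∅ := by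
    intro k hk
    refine eq_empty_of_forall_notMem fun u h => ?_
    have h' : κ u = k + 1 := h
    have hu : (u : ℝ) ∈ U.carrier := (hκ0 u).1 (by omega)
    have h1 : (e (comp u hu) : ℕ) = k := by simpa [κ, hu] using h'
    exact (e (comp u hu)).2 (h1 ▸ hk)
  refine ⟨κ, measurable_to_countable' fun k => ?_, fun k => ?_, fun u v => ?_⟩
  · cases k with
    | zero =>
      have : κ ⁻¹' {0} = {u : unitInterval | (u : ℝ) ∈ U.carrier}ᶜ := by
        ext u
        rw [mem_compl_iff, mem_ofPred_eq, ← hκ0, not_not]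
        rfl
      rw [this]
      exact (measurable_subtype_coe U.isOpen.measurableSet).compl
    | succ k =>
      by_cases hk : U.rankedLength k = 0
      · rw [hpre0 k hk]
        exact MeasurableSet.empty
      · rw [hpre k hk]
        exact measurable_subtype_coe
          (isOpen_of_mem_components (e.symm ⟨k, hk⟩).2).measurableSet
  · by_cases hk : U.rankedLength k = 0
    · rw [hpre0 k hk, measure_empty, hk]
    · rw [hpre k hk, volume_coe_mem _ (isOpen_of_mem_components (e.symm ⟨k, hk⟩).2).measurableSet,
        he, e.apply_symm_apply]
      obtain ⟨y, hy, hI⟩ := (e.symm ⟨k, hk⟩).2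
      rw [hI]
      exact (connectedComponentIn_subset _ _).trans (U.subset.trans Ioo_subset_Icc_self)
  · rw [hκ0, ← mem_connectedComponentIn_iff_uIcc]
    constructor
    · rintro ⟨h, hu⟩
      have hv : (v : ℝ) ∈ U.carrier := (hκ0 v).1 (h ▸ (hκ0 u).2 hu)
      have h1 : e (comp u hu) = e (comp v hv) := Subtype.ext (by simpa [κ, hu, hv] using h)
      have h2 : connectedComponentIn U.carrier (u : ℝ) = connectedComponentIn U.carrier (v : ℝ) :=
        congrArg Subtype.val (e.injective h1)
      rw [h2]
      exact mem_connectedComponentIn hv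
    · intro h
      have hu : (u : ℝ) ∈ U.carrier := connectedComponentIn_nonempty_iff.1 ⟨_, h⟩
      have hv : (v : ℝ) ∈ U.carrier := connectedComponentIn_subset _ _ h
      have h1 : comp u hu = comp v hv := Subtype.ext (connectedComponentIn_eq h)
      exact ⟨by simp [κ, hu, hv, h1], hu⟩

theorem MassSeq.sum_le_one (s : MassSeq) (k : ℕ) : ∑ l ∈ Finset.range k, s.1 l ≤ 1 :=
  (ENNReal.sum_le_tsum _).trans s.2.2

/-- Labels for the paintbox of a mass sequence: the rank of the interval, or zero outside the
intervals. -/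
theorem MassSeq.exists_label (s : MassSeq) : ∃ κ : unitInterval → ℕ, Measurable κ ∧
    (∀ k, volume (κ ⁻¹' {k + 1}) = s.1 k) ∧
    ∀ x, massPaintbox s x = labelPartition fun i => κ (x i) := by
  classical
  let J : ℕ → Set unitInterval := fun k => {u | ∑ l ∈ Finset.range k, s.1 l ≤ ENNReal.ofReal u ∧
    ENNReal.ofReal u < ∑ l ∈ Finset.range (k + 1), s.1 l}
  have hJm : ∀ k, MeasurableSet (J k) := by
    intro k
    have hu : Measurable fun u : unitInterval => ENNReal.ofReal u := by fun_prop
    exact (measurableSet_le measurable_const hu).inter (measurableSet_lt hu measurable_const)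
  have mono : Monotone fun k : ℕ => ∑ l ∈ Finset.range k, s.1 l := fun a b hab =>
    Finset.sum_le_sum_of_subset (Finset.range_mono hab)
  have huniq : ∀ u k k', u ∈ J k → u ∈ J k' → k = k' := by
    intro u k k' h h'
    rcases lt_trichotomy k k' with hlt | hlt | hlt
    · exact absurd (h.2.trans_le ((mono (Nat.succ_le_of_lt hlt)).trans h'.1)) (lt_irrefl _)
    · exact hlt
    · exact absurd (h'.2.trans_le ((mono (Nat.succ_le_of_lt hlt)).trans h.1)) (lt_irrefl _)
  let κ : unitInterval → ℕ := fun u => if h : ∃ k, u ∈ J k then h.choose + 1 else 0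
  have hκ : ∀ u k, κ u = k + 1 ↔ u ∈ J k := by
    intro u k
    by_cases h : ∃ k, u ∈ J k
    · have h1 : κ u = h.choose + 1 := dif_pos h
      rw [h1, Nat.add_right_cancel_iff]
      exact ⟨fun h2 => h2 ▸ h.choose_spec, fun h2 => huniq u _ _ h.choose_spec h2⟩
    · have h1 : κ u = 0 := dif_neg h
      rw [h1]
      exact iff_of_false (by omega) fun h2 => h ⟨k, h2⟩
  have hpre : ∀ k, κ ⁻¹' {k + 1} = J k := fun k => by
    ext u
    exact hκ u k
  refine ⟨κ, measurable_to_countable' fun k => ?_, fun k => ?_, fun x => ?_⟩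
  · cases k with
    | zero =>
      have : κ ⁻¹' {0} = (⋃ k, J k)ᶜ := by
        ext u
        rw [mem_compl_iff, mem_iUnion]
        simp only [← hκ, mem_preimage, mem_singleton_iff]
        constructor
        · rintro h ⟨k, hk⟩
          omega
        · intro h
          by_contra h0
          exact h ⟨κ u - 1, by omega⟩
      rw [this]
      exact (MeasurableSet.iUnion hJm).compl
    | succ k =>
      rw [hpre]
      exact hJm k
  · have h1 : ∀ k, ∑ l ∈ Finset.range k, s.1 l ≠ ∞ := fun k =>
      ((s.sum_le_one k).trans_lt ENNReal.one_lt_top).ne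
    have h2 : J k = {u : unitInterval | (u : ℝ) ∈ Ico (∑ l ∈ Finset.range k, s.1 l).toReal
        (∑ l ∈ Finset.range (k + 1), s.1 l).toReal} := by
      ext u
      change (_ ∧ _) ↔ (_ ∧ _)
      rw [ENNReal.le_ofReal_iff_toReal_le (h1 k) u.2.1, ENNReal.ofReal_lt_iff_lt_toReal u.2.1
        (h1 (k + 1))]
    rw [hpre, h2, volume_coe_mem _ measurableSet_Ico, Real.volume_Ico, ENNReal.ofReal_sub _
      ENNReal.toReal_nonneg, ENNReal.ofReal_toReal (h1 _), ENNReal.ofReal_toReal (h1 _),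
      Finset.sum_range_succ, ENNReal.add_sub_cancel_left (h1 k)]
    intro y hy
    refine ⟨ENNReal.toReal_nonneg.trans hy.1, hy.2.le.trans ?_⟩
    exact ENNReal.toReal_le_of_le_ofReal zero_le_one (by simpa using s.sum_le_one (k + 1))
  · refine Setoid.ext fun i j => or_congr Iff.rfl ?_
    change (∃ k, x i ∈ J k ∧ x j ∈ J k) ↔ _
    simp only [← hκ]
    constructor
    · rintro ⟨k, hi, hj⟩
      exact ⟨hi.trans hj.symm, by omega⟩
    · rintro ⟨h, h0⟩
      exact ⟨κ (x i) - 1, by omega, by omega⟩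

/-- The image on partitions of the paintbox law of an open set is the paintbox law of its ranked
lengths. -/
theorem paintboxLaw_map_toPartition (U : OpenSub) :
    (paintboxLaw U).map Compo.toPartition = massPaintboxLaw U.toMassSeq := by
  obtain ⟨κ, hκ, hκv, hκr⟩ := U.exists_label
  obtain ⟨κ', hκ', hκv', hκr'⟩ := U.toMassSeq.exists_label
  have h1 : massPaintboxLaw U.toMassSeq =
      uniformSeq.map fun x => labelPartition fun i => κ' (x i) := by
    unfold massPaintboxLaw
    congr 1
    funext x
    exact hκr' x
  rw [h1, ← map_labelPartition_congr hκ hκ' fun k => (hκv k).trans (hκv' k).symm, paintboxLaw,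
    Measure.map_map measurable_toPartition (measurable_paintbox U)]
  refine Measure.map_congr ?_
  -- Ties must be excluded: outside `U` the paintbox would put tied integers in one block, whereas
  -- label zero makes them singletons.
  filter_upwards [ae_injective_uniformSeq] with x hx
  refine Setoid.ext fun i j => ?_
  change ((paintbox U x).rel i j ∧ (paintbox U x).rel j i) ↔
    (i = j ∨ (κ (x i) = κ (x j) ∧ κ (x i) ≠ 0))
  rw [hκr, paintbox_rel_iff, paintbox_rel_iff, uIcc_comm (x j : ℝ)]
  constructor
  · rintro ⟨h | h, h' | h'⟩
    · exact Or.inl (hx (Subtype.ext (le_antisymm h h')))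
    · exact Or.inr h'
    · exact Or.inr h
    · exact Or.inr h
  · rintro (rfl | h)
    · exact ⟨Or.inl le_rfl, Or.inl le_rfl⟩
    · exact ⟨Or.inr h, Or.inr h⟩

theorem mixedPartLaw_apply (ν : Measure MassSeq) {S : Set (Setoid ℕ)} (hS : MeasurableSet S) :
    mixedPartLaw ν S = ∫⁻ s, massPaintboxLaw s S ∂ν :=
  Measure.bind_apply hS measurable_massPaintboxLaw.aemeasurable

theorem mixedLaw_map_toPartition (ν : Measure OpenSub) :
    (mixedLaw ν).map Compo.toPartition = mixedPartLaw (ν.map OpenSub.toMassSeq) := by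
  ext S hS
  rw [Measure.map_apply measurable_toPartition hS, mixedLaw_apply _ (measurable_toPartition hS),
    mixedPartLaw_apply _ hS, lintegral_map (f := fun s => massPaintboxLaw s S)
      ((Measure.measurable_coe hS).comp measurable_massPaintboxLaw) measurable_toMassSeq]
  refine lintegral_congr fun U => ?_
  rw [← paintboxLaw_map_toPartition, Measure.map_apply measurable_toPartition hS]

/-! ### Ranked block frequencies of a partition -/

/-- The upper asymptotic frequency of the block of `i`. -/
def blockFreq (π : Setoid ℕ) (i : ℕ) : ℝ≥0∞ :=
  -- The upper limit is defined and measurable on all partitions, including those without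
  -- frequencies.
  limsup (fun n => ENNReal.ofReal (freq (fun j => π.r i j) n)) atTop

/-- The `(k+1)`-st largest upper asymptotic frequency of a block. -/
def rankedFreq (π : Setoid ℕ) (k : ℕ) : ℝ≥0∞ :=
  ⨆ F : Finset ℕ, ⨆ _ : F.card = k + 1 ∧ ∀ i ∈ F, ∀ j ∈ F, i ≠ j → ¬ π.r i j,
    ⨅ i ∈ F, blockFreq π i

theorem measurableSet_related (i j : ℕ) : MeasurableSet {π : Setoid ℕ | π.r i j} :=
  measurable_partition_iff.1 measurable_id i j

theorem measurable_blockFreq (i : ℕ) : Measurable fun π => blockFreq π i := by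
  refine Measurable.limsup fun n => ENNReal.measurable_ofReal.comp ?_
  simp only [freq_eq_sum]
  refine (Finset.measurable_sum _ fun j _ => ?_).div_const _
  exact (measurable_const (a := (1 : ℝ))).indicator (measurableSet_related i j)

theorem measurable_rankedFreq : Measurable rankedFreq := by
  classical
  refine measurable_pi_lambda _ fun k => Measurable.iSup fun F => ?_
  have h : (fun π : Setoid ℕ => ⨆ _ : F.card = k + 1 ∧ ∀ i ∈ F, ∀ j ∈ F, i ≠ j → ¬ π.r i j,
      ⨅ i ∈ F, blockFreq π i) =
      {π : Setoid ℕ | F.card = k + 1 ∧ ∀ i ∈ F, ∀ j ∈ F, i ≠ j → ¬ π.r i j}.indicator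
        fun π => ⨅ i ∈ F, blockFreq π i := by
    funext π
    by_cases hπ : F.card = k + 1 ∧ ∀ i ∈ F, ∀ j ∈ F, i ≠ j → ¬ π.r i j
    · rw [iSup_pos hπ, indicator_of_mem (by exact hπ)]
    · rw [iSup_neg hπ, indicator_of_notMem (by exact hπ), bot_eq_zero]
  rw [h]
  refine Measurable.indicator ?_ ?_
  · exact Measurable.biInf _ F.countable_toSet fun i _ => measurable_blockFreq i
  · refine (MeasurableSet.const _).inter ?_
    refine measurableSet_forall fun i => measurableSet_forall fun _ => measurableSet_forall
      fun j => measurableSet_forall fun _ => measurableSet_forall fun _ => ?_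
    exact (measurableSet_related i j).compl

/-- Pigeonhole: `k + 1` integers in distinct blocks cannot all have labels in `1, …, k`, so one has
frequency at most `s k`. Conversely, representatives of the labels `1, …, k + 1` attain `s k`. -/
theorem rankedFreq_labelPartition {l : ℕ → ℕ} {s : ℕ → ℝ≥0∞} (hs : Antitone s)
    (hl : ∀ i k, l i = k + 1 → blockFreq (labelPartition l) i = s k)
    (hl0 : ∀ i, l i = 0 → blockFreq (labelPartition l) i = 0)
    (hex : ∀ k, s k ≠ 0 → ∃ i, l i = k + 1) : rankedFreq (labelPartition l) = s := by
  classical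
  funext k
  refine le_antisymm (iSup₂_le fun F hF => ?_) ?_
  · obtain ⟨i, hi, h⟩ : ∃ i ∈ F, l i = 0 ∨ k + 1 ≤ l i := by
      by_contra! hc
      have hinj : Set.InjOn l F := fun a ha b hb hab => by
        by_contra hne
        exact hF.2 a ha b hb hne (Or.inr ⟨hab, (hc a ha).1⟩)
      have hsub : F.image l ⊆ Finset.Icc 1 k := fun m hm => by
        obtain ⟨a, ha, rfl⟩ := Finset.mem_image.1 hm
        have := hc a ha
        rw [Finset.mem_Icc]
        omega
      have := Finset.card_le_card hsub
      rw [Finset.card_image_of_injOn hinj, Nat.card_Icc, hF.1] at this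
      omega
    refine (iInf₂_le i hi).trans ?_
    rcases h with h | h
    · rw [hl0 i h]
      exact zero_le
    · rw [hl i (l i - 1) (by omega)]
      exact hs (by omega)
  · by_cases hk : s k = 0
    · rw [hk]
      exact zero_le
    have hne : ∀ m : Fin (k + 1), s m ≠ 0 := fun m h0 =>
      hk (le_zero_iff.1 ((hs (Nat.lt_succ_iff.1 m.2)).trans h0.le))
    choose f hf using fun m : Fin (k + 1) => hex m (hne m)
    have hinj : Function.Injective f := fun a b hab => by
      have h1 := hf a
      have h2 := hf b
      rw [hab] at h1
      exact Fin.ext (by omega)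
    refine le_trans ?_ (le_iSup₂ (Finset.univ.image f) ⟨?_, ?_⟩)
    · refine le_iInf₂ fun i hi => ?_
      obtain ⟨m, -, rfl⟩ := Finset.mem_image.1 hi
      rw [hl _ _ (hf m)]
      exact hs (Nat.lt_succ_iff.1 m.2)
    · rw [Finset.card_image_of_injective _ hinj, Finset.card_univ, Fintype.card_fin]
    · intro i hi j hj hij h
      obtain ⟨a, -, rfl⟩ := Finset.mem_image.1 hi
      obtain ⟨b, -, rfl⟩ := Finset.mem_image.1 hj
      rcases h with h | h
      · exact hij h
      · refine hij (congrArg f (Fin.ext ?_))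
        have h1 := hf a
        have h2 := hf b
        have h3 := h.1
        omega

theorem tendsto_freq_zero {p : ℕ → Prop} (hp : ∀ a b, p a → p b → a = b) :
    Tendsto (freq p) atTop (𝓝 0) :=
  squeeze_zero (fun n => freq_nonneg p n) (fun n => freq_le_one_div hp n)
    tendsto_one_div_atTop_nhds_zero_nat

theorem blockFreq_eq {π : Setoid ℕ} {i : ℕ} {a : ℝ}
    (h : Tendsto (freq fun j => π.r i j) atTop (𝓝 a)) : blockFreq π i = ENNReal.ofReal a :=
  (ENNReal.tendsto_ofReal h).limsup_eq

theorem blockFreq_labelPartition {l : ℕ → ℕ} {k i : ℕ} {a : ℝ}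
    (h : Tendsto (freq fun j => l j = k + 1) atTop (𝓝 a)) (hi : l i = k + 1) :
    blockFreq (labelPartition l) i = ENNReal.ofReal a := by
  refine blockFreq_eq ?_
  have h1 : (fun j => (labelPartition l).r i j) = fun j => l j = k + 1 := by
    funext j
    refine propext ⟨?_, fun hj => Or.inr ⟨hi.trans hj.symm, by omega⟩⟩
    rintro (rfl | h)
    · exact hi
    · exact h.1.symm.trans hi
  rw [h1]
  exact h

theorem blockFreq_labelPartition_zero {l : ℕ → ℕ} {i : ℕ} (hi : l i = 0) :
    blockFreq (labelPartition l) i = 0 := by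
  rw [← ENNReal.ofReal_zero]
  refine blockFreq_eq (tendsto_freq_zero fun a b ha hb => ?_)
  rcases ha with rfl | ha
  · rcases hb with rfl | hb
    · rfl
    · exact absurd hi hb.2
  · exact absurd hi ha.2

/-- The ranked block frequencies of the paintbox of `s` are almost surely `s`. -/
theorem ae_rankedFreq_massPaintboxLaw (s : MassSeq) :
    ∀ᵐ π ∂massPaintboxLaw s, rankedFreq π = s.1 := by
  obtain ⟨κ, hκ, hκv, hκr⟩ := s.exists_label
  have hm : Measurable (massPaintbox s) :=
    measurable_massPaintbox_uncurry.comp measurable_prodMk_left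
  refine (ae_map_iff hm.aemeasurable (measurable_rankedFreq (measurableSet_singleton s.1))).2 ?_
  have hf : ∀ᵐ x ∂uniformSeq, ∀ k, Tendsto (freq fun i => x i ∈ κ ⁻¹' {k + 1}) atTop
      (𝓝 (volume.real (κ ⁻¹' {k + 1}))) :=
    ae_all_iff.2 fun k => ae_tendsto_freq (hκ (measurableSet_singleton _))
  filter_upwards [hf] with x hx
  have hs : ∀ k, ENNReal.ofReal (volume.real (κ ⁻¹' {k + 1})) = s.1 k := fun k => by
    rw [ofReal_measureReal, hκv]
  rw [hκr]
  refine rankedFreq_labelPartition s.2.1 (fun i k hi => ?_)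
    (fun i hi => blockFreq_labelPartition_zero hi) fun k hk => ?_
  · rw [← hs k]
    exact blockFreq_labelPartition (hx k) hi
  · by_contra! hc
    -- A label that is never drawn has frequency zero, contradicting `s k ≠ 0`.
    have h0 : Tendsto (freq fun i => x i ∈ κ ⁻¹' {k + 1}) atTop (𝓝 0) :=
      tendsto_freq_zero fun a _ ha _ => absurd ha (hc a)
    rw [← hs k, tendsto_nhds_unique (hx k) h0, ENNReal.ofReal_zero] at hk
    exact hk rfl

theorem singlePartition_eq_labelPartition (i : ℕ) :
    singlePartition i = labelPartition fun j => if j = i then 0 else 1 := by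
  refine Setoid.ext fun a b => ?_
  change (a = i ↔ b = i) ↔ (a = b ∨ _)
  by_cases ha : a = i <;> by_cases hb : b = i <;> simp [ha, hb]
  rintro rfl
  exact hb rfl

theorem rankedFreq_singlePartition (i : ℕ) :
    rankedFreq (singlePartition i) = MassSeq.one.1 := by
  rw [singlePartition_eq_labelPartition]
  have hfreq : Tendsto (freq fun j => (if j = i then 0 else 1) = 0 + 1) atTop (𝓝 1) := by
    have h1 : (fun j => (if j = i then 0 else 1) = 0 + 1) = fun j => ¬ j = i := by
      funext j
      by_cases hj : j = i <;> simp [hj]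
    have h2 : Tendsto (fun n => 1 - freq (fun j => j = i) n) atTop (𝓝 (1 - 0)) :=
      (tendsto_freq_zero fun _ _ ha hb => ha.trans hb.symm).const_sub 1
    rw [sub_zero] at h2
    refine h2.congr' ?_
    filter_upwards [eventually_gt_atTop 0] with n hn
    rw [h1, ← freq_add_freq_not (fun j => j = i) hn, add_sub_cancel_left]
  refine rankedFreq_labelPartition MassSeq.one.2.1 (fun j k hj => ?_)
    (fun j hj => blockFreq_labelPartition_zero hj) fun k hk => ?_
  · have hk : k = 0 := by
      split_ifs at hj
      omega
    subst hk
    rw [blockFreq_labelPartition hfreq hj]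
    simp [MassSeq.one]
  · have hk : k = 0 := by
      by_contra h
      simp [MassSeq.one, h] at hk
    subst hk
    exact ⟨i + 1, by simp⟩

/-! ### Uniqueness of the decomposition on partitions -/

/-- The ranked frequencies recover the mixing measure. They are compared as plain sequences, since
for an arbitrary partition they need not form a mass sequence. -/
theorem map_rankedFreq_mixedPartLaw (ν : Measure MassSeq) :
    (mixedPartLaw ν).map rankedFreq = ν.map Subtype.val := by
  ext B hB
  rw [Measure.map_apply measurable_rankedFreq hB, Measure.map_apply measurable_subtype_coe hB,
    mixedPartLaw_apply _ (measurable_rankedFreq hB),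
    ← lintegral_indicator_one (measurable_subtype_coe hB)]
  refine lintegral_congr fun s => ?_
  have hp : IsProbabilityMeasure (massPaintboxLaw s) := by
    have : IsProbabilityMeasure uniformSeq := by unfold uniformSeq; infer_instance
    exact Measure.isProbabilityMeasure_map
      (measurable_massPaintbox_uncurry.comp measurable_prodMk_left).aemeasurable
  by_cases hs : s.1 ∈ B
  · rw [indicator_of_mem (by exact hs), Pi.one_apply]
    refine (mem_ae_iff_prob_eq_one (measurable_rankedFreq hB)).1 ?_
    filter_upwards [ae_rankedFreq_massPaintboxLaw s] with π hπ
    rwa [mem_preimage, hπ]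
  · rw [indicator_of_notMem (by exact hs)]
    refine measure_eq_zero_iff_ae_notMem.2 ?_
    filter_upwards [ae_rankedFreq_massPaintboxLaw s] with π hπ h
    exact hs (hπ ▸ h)

theorem measure_ext_of_map_val {ν ν' : Measure MassSeq}
    (h : ν.map Subtype.val = ν'.map Subtype.val) : ν = ν' := by
  ext B hB
  obtain ⟨A, hA, rfl⟩ := hB
  rw [← Measure.map_apply measurable_subtype_coe hA, h,
    Measure.map_apply measurable_subtype_coe hA]

theorem measurableSet_rankedFreq_eq_one :
    MeasurableSet {π | rankedFreq π = MassSeq.one.1} :=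
  measurable_rankedFreq (measurableSet_singleton _)

theorem ae_rankedFreq_epsPart : ∀ᵐ π ∂epsPart, rankedFreq π = MassSeq.one.1 :=
  ae_sum_dirac measurableSet_rankedFreq_eq_one rankedFreq_singlePartition

theorem IsMassDislocationMeasure.ae_rankedFreq_ne {ν : Measure MassSeq}
    (hν : IsMassDislocationMeasure ν) :
    ∀ᵐ π ∂mixedPartLaw ν, rankedFreq π ≠ MassSeq.one.1 := by
  have h : (mixedPartLaw ν).map rankedFreq {MassSeq.one.1} = 0 := by
    rw [map_rankedFreq_mixedPartLaw, Measure.map_apply measurable_subtype_coe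
      (measurableSet_singleton _), ← hν.one_eq_zero]
    congr 1
    ext s
    exact Subtype.ext_iff.symm
  rw [Measure.map_apply measurable_rankedFreq (measurableSet_singleton _)] at h
  exact measure_eq_zero_iff_ae_notMem.1 h

/-- The partitions in which `1` and `2` are in the same block, and `0` in another one. -/
def splitZero : Set (Setoid ℕ) := {π | ¬ π.r 0 1 ∧ π.r 1 2}

/-- Separating `0` from `1` alone would also allow `i = 1`; requiring `1 ∼ 2` isolates the atom `i =
0`, whose mass is the erosion coefficient. -/
theorem epsPart_splitZero : epsPart splitZero = 1 := by
  have hm : MeasurableSet splitZero :=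
    (measurableSet_related 0 1).compl.inter (measurableSet_related 1 2)
  have hmem : ∀ i, singlePartition i ∈ splitZero ↔ i = 0 := by
    intro i
    change ¬ (0 = i ↔ 1 = i) ∧ (1 = i ↔ 2 = i) ↔ i = 0
    omega
  rw [epsPart, Measure.sum_apply _ hm, tsum_eq_single 0]
  · rw [Measure.dirac_apply' _ hm, indicator_of_mem ((hmem 0).2 rfl), Pi.one_apply]
  · intro i hi
    rw [Measure.dirac_apply' _ hm, indicator_of_notMem fun h => hi ((hmem i).1 h)]

namespace IsPartitionDecomposition

variable {μ : Measure (Setoid ℕ)} {ν : Measure MassSeq} {c : ℝ≥0}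

theorem restrict_eq_one (h : IsPartitionDecomposition μ ν c) :
    μ.restrict {π | rankedFreq π = MassSeq.one.1} = c • epsPart := by
  have h1 : (mixedPartLaw ν).restrict {π | rankedFreq π = MassSeq.one.1} = 0 :=
    Measure.restrict_eq_zero.2 (measure_eq_zero_iff_ae_notMem.2 h.1.ae_rankedFreq_ne)
  rw [h.2, Measure.restrict_add, Measure.restrict_smul, h1, zero_add,
    Measure.restrict_eq_self_of_ae_mem (s := {π | rankedFreq π = MassSeq.one.1})
      ae_rankedFreq_epsPart]

theorem restrict_ne_one (h : IsPartitionDecomposition μ ν c) :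
    μ.restrict {π | rankedFreq π = MassSeq.one.1}ᶜ = mixedPartLaw ν := by
  have h1 : epsPart.restrict {π | rankedFreq π = MassSeq.one.1}ᶜ = 0 :=
    Measure.restrict_eq_zero.2 ae_rankedFreq_epsPart
  rw [h.2, Measure.restrict_add, Measure.restrict_smul, h1, smul_zero, add_zero]
  exact Measure.restrict_eq_self_of_ae_mem h.1.ae_rankedFreq_ne

theorem restrict_splitZero (h : IsPartitionDecomposition μ ν c) :
    μ.restrict {π | rankedFreq π = MassSeq.one.1} splitZero = c := by
  rw [h.restrict_eq_one, Measure.smul_apply, epsPart_splitZero]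
  simp [ENNReal.smul_def]

theorem unique {ν' : Measure MassSeq} {c' : ℝ≥0} (h : IsPartitionDecomposition μ ν c)
    (h' : IsPartitionDecomposition μ ν' c') : c' = c ∧ ν' = ν := by
  refine ⟨?_, measure_ext_of_map_val ?_⟩
  · exact_mod_cast h'.restrict_splitZero.symm.trans h.restrict_splitZero
  · rw [← map_rankedFreq_mixedPartLaw, ← map_rankedFreq_mixedPartLaw, ← h'.restrict_ne_one,
      h.restrict_ne_one]

end IsPartitionDecomposition

/-! ### The image of a fragmentation measure on partitions -/

theorem toPartition_left (i : ℕ) : (Compo.left i).toPartition = singlePartition i := by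
  refine Setoid.ext fun a b => ?_
  change (a = i ∨ b ≠ i) ∧ (b = i ∨ a ≠ i) ↔ (a = i ↔ b = i)
  tauto

theorem toPartition_right (i : ℕ) : (Compo.right i).toPartition = singlePartition i := by
  refine Setoid.ext fun a b => ?_
  change (b = i ∨ a ≠ i) ∧ (a = i ∨ b ≠ i) ↔ (a = i ↔ b = i)
  tauto

theorem epsLeft_map_toPartition : epsLeft.map Compo.toPartition = epsPart := by
  rw [epsLeft, Measure.map_sum measurable_toPartition.aemeasurable]
  simp only [Measure.map_dirac' measurable_toPartition, toPartition_left, epsPart]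

theorem epsRight_map_toPartition : epsRight.map Compo.toPartition = epsPart := by
  rw [epsRight, Measure.map_sum measurable_toPartition.aemeasurable]
  simp only [Measure.map_dirac' measurable_toPartition, toPartition_right, epsPart]

theorem OpenSub.rankedLength_zero (U : OpenSub) : U.rankedLength 0 = U.maxLength := by
  refine le_antisymm (iSup_le ?_) (iSup₂_le fun I hI => ?_)
  · rintro ⟨F, hF, hc⟩
    obtain ⟨I, rfl⟩ := Finset.card_eq_one.1 hc
    have hI : I ∈ U.components := hF (by simp)
    exact (iInf₂_le I (Finset.mem_singleton_self I)).trans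
      (le_iSup₂ (f := fun I _ => volume I) I hI)
  · refine le_trans ?_ (le_iSup (fun F : {F : Finset (Set ℝ) //
      (F : Set (Set ℝ)) ⊆ U.components ∧ F.card = 0 + 1} => ⨅ I ∈ F.1, volume I)
      ⟨{I}, by simpa using hI, by simp⟩)
    simp

/-- Some component has length 1. If this interval missed a point `y` of `]0,1[`, it would lie on one
side of `y` and be shorter than 1. -/
theorem OpenSub.eq_full_of_toMassSeq_eq_one {U : OpenSub} (h : U.toMassSeq = MassSeq.one) :
    U = full := by
  have h1 : U.rankedLength 0 = 1 := congrFun (congrArg Subtype.val h) 0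
  obtain ⟨e, he⟩ := U.exists_ranking
  obtain ⟨I, hI⟩ := e.surjective ⟨0, by simp [h1]⟩
  have hv : volume (I : Set ℝ) = 1 := by rw [he, hI, h1]
  obtain ⟨x, hx, hIx⟩ := I.2
  have hoc : OrdConnected (I : Set ℝ) := hIx ▸ isPreconnected_connectedComponentIn.ordConnected
  have hsub : (I : Set ℝ) ⊆ U.carrier := hIx ▸ connectedComponentIn_subset _ _
  refine OpenSub.ext (subset_antisymm U.subset fun y hy => hsub ?_)
  by_contra hyI
  have hlt : ∀ a b : ℝ, b - a < 1 → ¬ (I : Set ℝ) ⊆ Ioo a b := fun a b hab hs => by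
    have := measure_mono (μ := volume) hs
    rw [hv, Real.volume_Ioo] at this
    exact this.not_gt (ENNReal.ofReal_lt_one.2 hab)
  by_cases hz : ∃ z ∈ (I : Set ℝ), z < y
  · obtain ⟨z, hz, hzy⟩ := hz
    refine hlt 0 y (by linarith [hy.2]) fun w hw => ⟨(U.subset (hsub hw)).1, ?_⟩
    by_contra! hyw
    exact hyI (hoc.out hz hw ⟨hzy.le, hyw⟩)
  · push Not at hz
    refine hlt y 1 (by linarith [hy.1]) fun w hw => ⟨(hz w hw).lt_of_ne ?_, (U.subset (hsub hw)).2⟩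
    rintro rfl
    exact hyI hw

theorem IsDislocationMeasure.map_toMassSeq {ν : Measure OpenSub} (hν : IsDislocationMeasure ν) :
    IsMassDislocationMeasure (ν.map OpenSub.toMassSeq) where
  one_eq_zero := by
    rw [Measure.map_apply measurable_toMassSeq (measurableSet_singleton _)]
    exact measure_mono_null (fun U hU => OpenSub.eq_full_of_toMassSeq_eq_one hU) hν.full_eq_zero
  integral_lt_top := by
    have hm : Measurable fun s : MassSeq => 1 - s.1 0 :=
      ((measurable_pi_apply 0).comp measurable_subtype_coe).const_sub 1
    rw [lintegral_map hm measurable_toMassSeq]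
    refine lt_of_eq_of_lt (lintegral_congr fun U => ?_) hν.integral_lt_top
    change 1 - U.rankedLength 0 = _
    rw [U.rankedLength_zero]

theorem IsDecomposition.map_toPartition {μ : Measure (Compo ℕ)} {c_l c_r : ℝ≥0}
    {ν : Measure OpenSub} (h : IsDecomposition μ c_l c_r ν) :
    IsPartitionDecomposition (μ.map Compo.toPartition) (ν.map OpenSub.toMassSeq)
      (c_l + c_r) := by
  refine ⟨h.1.map_toMassSeq, ?_⟩
  rw [h.2, Measure.map_add _ _ measurable_toPartition, Measure.map_add _ _ measurable_toPartition,
    Measure.map_smul, Measure.map_smul, epsLeft_map_toPartition, epsRight_map_toPartition,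
    mixedLaw_map_toPartition, add_smul, add_comm]

end Frag

end

theorem theorem2p6 :
    IsExchangeable epsLeft ∧ IsExchangeable epsRight ∧
    ∀ μ : Measure (Compo ℕ), IsFragmentationMeasure μ →
      ∃ (c_l c_r : ℝ≥0) (ν : Measure OpenSub),
        -- existence and uniqueness of the decomposition
        IsDecomposition μ c_l c_r ν ∧
        (∀ (c_l' c_r' : ℝ≥0) (ν' : Measure OpenSub), IsDecomposition μ c_l' c_r' ν' →
          c_l' = c_l ∧ c_r' = c_r ∧ ν' = ν) ∧
        -- the two parts are restrictions of `μ`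
        μ.restrict {γ | IsAsymptoticOpenSet γ OpenSub.full} = c_l • epsLeft + c_r • epsRight ∧
        μ.restrict {γ | ∃ U, IsAsymptoticOpenSet γ U ∧ U ≠ OpenSub.full} = mixedLaw ν ∧
        -- the image on partitions
        IsPartitionDecomposition (μ.map Compo.toPartition) (ν.map OpenSub.toMassSeq)
          (c_l + c_r) ∧
        ∀ (c : ℝ≥0) (ν' : Measure MassSeq),
          IsPartitionDecomposition (μ.map Compo.toPartition) ν' c →
            c = c_l + c_r ∧ ν' = ν.map OpenSub.toMassSeq := by
  refine ⟨isExchangeable_epsLeft, isExchangeable_epsRight, fun μ hμ => ?_⟩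
  obtain ⟨c_l, c_r, ν, h⟩ := hμ.exists_isDecomposition
  exact ⟨c_l, c_r, ν, h, fun _ _ _ h' => h.unique h', h.restrict_full, h.restrict_ne_full,
    h.map_toPartition, fun _ _ h' => h.map_toPartition.unique h'⟩
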